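/- **Corollary (toric magnetic geodesic equation).** Let $X$ be a compact complex manifold of dimension $n$ with a holomorphic action of $\mathbb T=(\mathbb C^*)^n$, and let $x_0\in X$ be such that $z\mapsto z\cdot x_0$ identifies $\mathbb T$ with an open dense orbit of $X$. Let $\omega$ be an $(S^1)^n$-invariant Kähler form on $X$ with $\omega=dd^c(F_0\circ L)$ on $\mathbb T$, where $F_0:\mathbb R^n\to\mathbb R$ is smooth, $L(z)=(\log|z_1|,\dots,\log|z_n|)$, $d=\partial+\bar\partial$ and $d^c=\frac1{2\pi i}(\partial-\bar\partial)$. For smooth $u:X\to\mathbb R$ put $\omega_u=\omega+dd^cu$, $V_\alpha=\int_X\omega^n$ and $MA(u)=\omega_u^n/V_\alpha$. Let $\mathcal H=\{u\in C^\infty(X):\omega_u>0\}$ be the space of Kähler potentials and $\mathcal H_{tor}$ its subset of $(S^1)^n$-invariant functions (toric Kähler potentials). A *magnetic geodesic* is a smooth path $(\varphi_t)_{0\le t\le 1}$ in $\mathcal H$ which is an extremal, under smooth variations in $\mathcal H$ with fixed end points, of the generalized Landau–Hall functional $$LH(\varphi)=\frac12\int_0^1\!\int_X\dot\varphi_t^2\,MA(\varphi_t)\,dt+\int_0^1\!\int_X\dot\varphi_t\,MA(\dot\varphi_t)\,dt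 .$$ For $F:\mathbb R^n\to\mathbb R$ smooth let $D^2F$ be its Hessian and $MA_{\mathbb R}(F)=n!\det(D^2F)\,dV$ its real Monge–Ampère measure, and for $n\times n$ matrices let $$\mathcal D(A_1,\dots,A_n)=\sum_{\sigma,\tau\in S_n}\operatorname{sgn}(\sigma)\operatorname{sgn}(\tau)\prod_{k=1}^n(A_k)_{\sigma(k)\tau(k)}$$ be the (non-normalized) mixed discriminant, so that $\mathcal D(A,\dots,A)=n!\det A$; $A^{[m]}$ means that $A$ is repeated $m$ times. Let $(\varphi_t)_{0\le t\le1}$ be a smooth path in $\mathcal H$ with $\varphi_t\in\mathcal H_{tor}$ for all $t$, and let $F_t=F_{\varphi_t}:\mathbb R^n\to\mathbb R$ be the function with $F_{\varphi_t}\circ L=F_0\circ L+\varphi_t$ on $\mathbb T$. Then every $F_t$ is well defined, smooth and strictly convex; $MA_{\mathbb R}(F_0)$ has a finite positive total mass $V=\int_{\mathbb R^n}MA_{\mathbb R}(F_0)$; and the following are equivalent: 1. $\varphi$ is a magnetic geodesic; 2. $\varphi$ satisfies the magnetic geodesic equation on $X$ for all $t\in[0,1]$: $$\ddot\varphi\,MA(\varphi)=\frac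 n{V_\alpha}d\dot\varphi\wedge d^c\dot\varphi\wedge\omega_\varphi^{n-1}-\frac{2n}{V_\alpha}dd^c\ddot\varphi\wedge\omega_{\dot\varphi}^{n-1}-\frac{n(n-1)}{V_\alpha}dd^c\dot\varphi\wedge dd^c\ddot\varphi\wedge\omega_{\dot\varphi}^{n-2};$$ 3. $F$ satisfies the following equation on $\mathbb R^n$ for all $t\in[0,1]$ (between densities with respect to $dV$): $$\ddot F\,\frac{MA_{\mathbb R}(F)}{V}=\frac nV\,\mathcal D\big(\nabla\dot F\,(\nabla\dot F)^{T},(D^2F)^{[n-1]}\big)-\frac{2n}V\,\mathcal D\big(D^2\ddot F,(D^2(F_0+\dot F))^{[n-1]}\big)-\frac{n(n-1)}V\,\mathcal D\big(D^2\dot F,D^2\ddot F,(D^2(F_0+\dot F))^{[n-2]}\big).$$ (Terms with a zero coefficient, i.e. the last one for $n=1$, are read as $0$.) -/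

import Mathlib

open Set
open scoped Manifold ContDiff ComplexOrder Topology Matrix

noncomputable section

/-! ## Linear algebra: the coefficient of a wedge product of (1,1)-forms -/

/-- The (non-normalised) mixed discriminant of `n` square matrices of size `n`,
`∑_{σ,τ} sgn σ sgn τ ∏ₖ (A k) (σ k) (τ k)`. It is symmetric and multilinear, and it equals
`n! det B` when all `A k` are equal to `B`. It is the coefficient of
`⋀ₖ (∑ᵢⱼ (A k) i j ξᵢ ∧ ηⱼ)` with respect to `(ξ₁ ∧ η₁) ∧ ⋯ ∧ (ξₙ ∧ ηₙ)`. -/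
def mixedDet {R : Type*} [CommRing R] {n : ℕ} (A : Fin n → Matrix (Fin n) (Fin n) R) : R :=
  ∑ σ : Equiv.Perm (Fin n), ∑ τ : Equiv.Perm (Fin n),
    ((Equiv.Perm.sign σ : ℤ) : R) * ((Equiv.Perm.sign τ : ℤ) : R) * ∏ k, A k (σ k) (τ k)

/-- The list of factors of `A ∧ C^{n-1}`. -/
def slots₁ {M : Type*} {n : ℕ} (A C : M) : Fin n → M :=
  fun k => if k.val = 0 then A else C

/-- The list of factors of `A ∧ B ∧ C^{n-2}`. -/
def slots₂ {M : Type*} {n : ℕ} (A B C : M) : Fin n → M :=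
  fun k => if k.val = 0 then A else if k.val = 1 then B else C

/-! ## Calculus on `ℂⁿ` -/

/-- The Wirtinger derivative `∂g/∂zₖ = (∂g/∂xₖ - i ∂g/∂yₖ)/2`. -/
def wirt {n : ℕ} (k : Fin n) (g : (Fin n → ℂ) → ℂ) (w : Fin n → ℂ) : ℂ :=
  (fderiv ℝ g w (Pi.single k 1) - Complex.I * fderiv ℝ g w (Pi.single k Complex.I)) / 2

/-- The Wirtinger derivative `∂g/∂z̄ₖ = (∂g/∂xₖ + i ∂g/∂yₖ)/2`. -/
def wirtBar {n : ℕ} (k : Fin n) (g : (Fin n → ℂ) → ℂ) (w : Fin n → ℂ) : ℂ :=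
  (fderiv ℝ g w (Pi.single k 1) + Complex.I * fderiv ℝ g w (Pi.single k Complex.I)) / 2

/-- The complex Hessian `∂²u/∂zᵢ∂z̄ⱼ` of a real function `u`. With
`d = ∂ + ∂̄`, `dᶜ = (∂ - ∂̄)/(2πi)` one has `ddᶜu = (i/π) ∑ᵢⱼ (∂²u/∂zᵢ∂z̄ⱼ) dzᵢ ∧ dz̄ⱼ`. -/
def cHess {n : ℕ} (u : (Fin n → ℂ) → ℝ) (w : Fin n → ℂ) : Matrix (Fin n) (Fin n) ℂ :=
  Matrix.of fun i j => wirt i (wirtBar j (fun v => (u v : ℂ))) w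

/-- The matrix `(∂u/∂zᵢ)(∂u/∂z̄ⱼ)`:
`du ∧ dᶜu = (i/π) ∑ᵢⱼ (∂u/∂zᵢ)(∂u/∂z̄ⱼ) dzᵢ ∧ dz̄ⱼ`. -/
def cGradSq {n : ℕ} (u : (Fin n → ℂ) → ℝ) (w : Fin n → ℂ) : Matrix (Fin n) (Fin n) ℂ :=
  Matrix.of fun i j => wirt i (fun v => (u v : ℂ)) w * wirtBar j (fun v => (u v : ℂ)) w

/-- The complex Jacobian matrix of a holomorphic map. -/
def cJac {n : ℕ} (f : (Fin n → ℂ) → (Fin n → ℂ)) (w : Fin n → ℂ) : Matrix (Fin n) (Fin n) ℂ :=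
  Matrix.of fun i j => fderiv ℂ f w (Pi.single j 1) i

/-- Pull-back under a holomorphic map `f` of the (1,1)-form `(i/π) ∑ G i j dzᵢ ∧ dz̄ⱼ`,
where `G` is the coefficient matrix at the point `f w`. -/
def pullCoeff {n : ℕ} (f : (Fin n → ℂ) → (Fin n → ℂ)) (G : Matrix (Fin n) (Fin n) ℂ)
    (w : Fin n → ℂ) : Matrix (Fin n) (Fin n) ℂ :=
  (cJac f w)ᵀ * G * (cJac f w).map star

/-- The density, with respect to Lebesgue measure on `ℂⁿ`, of the wedge product of the real
(1,1)-forms `(i/π) ∑ᵢⱼ (A k) i j dzᵢ ∧ dz̄ⱼ`, `k = 1, …, n` (recall `i dz ∧ dz̄ = 2 dx ∧ dy`). -/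
def wedgeDensity {n : ℕ} (A : Fin n → Matrix (Fin n) (Fin n) ℂ) : ℝ :=
  (2 / Real.pi) ^ n * (mixedDet A).re

/-! ## Compact complex manifolds and Kähler forms

A complex manifold of dimension `n` is a charted space over `Fin n → ℂ` with analytic transition
maps over `ℂ`. Smooth real functions on it are smooth for the underlying real structure. -/

/-- A Kähler form `ω` on the complex manifold `X` (a variable `κ : KahlerForm n X` below). In the holomorphic chart `e` it is
`(i/π) ∑ᵢⱼ (coeff e) i j dzᵢ ∧ dz̄ⱼ`; the coefficients are smooth, compatible with changes of charts,
hermitian positive definite, and the form is closed. -/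
structure KahlerForm (n : ℕ) (X : Type*) [TopologicalSpace X] [ChartedSpace (Fin n → ℂ) X] where
  coeff : OpenPartialHomeomorph X (Fin n → ℂ) → (Fin n → ℂ) → Matrix (Fin n) (Fin n) ℂ
  smooth : ∀ e ∈ atlas (Fin n → ℂ) X, ∀ i j,
    ContDiffOn ℝ ∞ (fun w => coeff e w i j) e.target
  compatible : ∀ e ∈ atlas (Fin n → ℂ) X, ∀ e' ∈ atlas (Fin n → ℂ) X,
    ∀ x ∈ e.source ∩ e'.source,
      coeff e (e x) = pullCoeff (fun v => e' (e.symm v)) (coeff e' (e' x)) (e x)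
  posDef : ∀ e ∈ atlas (Fin n → ℂ) X, ∀ w ∈ e.target, (coeff e w).PosDef
  closed : ∀ e ∈ atlas (Fin n → ℂ) X, ∀ w ∈ e.target, ∀ i j k,
    wirt k (fun v => coeff e v i j) w = wirt i (fun v => coeff e v k j) w

/-- A continuous partition of unity subordinate to the cover of a compact manifold by the domains
of its preferred charts. -/
lemma exists_chartPartition (n : ℕ) (X : Type*) [TopologicalSpace X]
    [ChartedSpace (Fin n → ℂ) X] [CompactSpace X] [T2Space X] :
    ∃ ρ : PartitionOfUnity X X univ, ρ.IsSubordinate fun p => (chartAt (Fin n → ℂ) p).source :=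
  PartitionOfUnity.exists_isSubordinate isClosed_univ _
    (fun p => (chartAt (Fin n → ℂ) p).open_source)
    (fun p _ => mem_iUnion.2 ⟨p, mem_chart_source _ p⟩)

/-- The integral over `X` of the form of top degree whose density in the chart `e` is `η e`,
by means of a partition of unity (the result does not depend on it). -/
def integralTop {n : ℕ} {X : Type*} [TopologicalSpace X]
    [ChartedSpace (Fin n → ℂ) X] [CompactSpace X] [T2Space X]
    (η : OpenPartialHomeomorph X (Fin n → ℂ) → (Fin n → ℂ) → ℝ) : ℝ :=
  ∑ᶠ p : X, ∫ w in (chartAt (Fin n → ℂ) p).target,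
    (exists_chartPartition n X).choose p ((chartAt (Fin n → ℂ) p).symm w) *
      η (chartAt (Fin n → ℂ) p) w

section Kahler

variable {n : ℕ} {X : Type*} [TopologicalSpace X] [ChartedSpace (Fin n → ℂ) X]

/-- The coefficients in the chart `e` of `ddᶜu`. -/
def ddcCoeff (u : X → ℝ) (e : OpenPartialHomeomorph X (Fin n → ℂ)) (w : Fin n → ℂ) :
    Matrix (Fin n) (Fin n) ℂ :=
  cHess (fun v => u (e.symm v)) w

/-- The coefficients in the chart `e` of `du ∧ dᶜu`. -/
def dWedgeDcCoeff (u : X → ℝ) (e : OpenPartialHomeomorph X (Fin n → ℂ)) (w : Fin n → ℂ) :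
    Matrix (Fin n) (Fin n) ℂ :=
  cGradSq (fun v => u (e.symm v)) w

namespace KahlerForm

variable (κ : KahlerForm n X)

/-- The coefficients in the chart `e` of `ω_u = ω + ddᶜu`. -/
def perturb (u : X → ℝ) (e : OpenPartialHomeomorph X (Fin n → ℂ)) (w : Fin n → ℂ) :
    Matrix (Fin n) (Fin n) ℂ :=
  κ.coeff e w + ddcCoeff u e w

/-- The space `ℋ` of Kähler potentials: smooth real functions `u` on `X` with `ω + ddᶜu > 0`. -/
def potentials : Set (X → ℝ) :=
  {u | ContMDiff 𝓘(ℝ, Fin n → ℂ) 𝓘(ℝ, ℝ) ∞ u ∧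
    ∀ e ∈ atlas (Fin n → ℂ) X, ∀ w ∈ e.target, (κ.perturb u e w).PosDef}

variable [CompactSpace X] [T2Space X]

/-- The volume `V_α = ∫_X ωⁿ`. -/
def vol : ℝ :=
  integralTop (X := X) fun e w => wedgeDensity fun _ => κ.coeff e w

/-- The Monge-Ampère form `MA(u) = (ω + ddᶜu)ⁿ / V_α`. -/
def MA (u : X → ℝ) (e : OpenPartialHomeomorph X (Fin n → ℂ)) (w : Fin n → ℂ) : ℝ :=
  wedgeDensity (fun _ => κ.perturb u e w) / κ.vol

end KahlerForm

end Kahler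

/-! ## Paths of potentials and the Landau-Hall functional -/

/-- The time derivative of a path defined on `[0,1]` (one-sided at the end points). -/
def dot {Y : Type*} (φ : ℝ → Y → ℝ) (t : ℝ) (y : Y) : ℝ :=
  derivWithin (fun s => φ s y) (Icc 0 1) t

namespace KahlerForm

variable {n : ℕ} {X : Type*} [TopologicalSpace X] [ChartedSpace (Fin n → ℂ) X]
  (κ : KahlerForm n X)

/-- A smooth path `(φ_t)`, `0 ≤ t ≤ 1`, in the space of Kähler potentials. -/
structure IsPath (φ : ℝ → X → ℝ) : Prop where
  smooth : ContMDiffOn (𝓘(ℝ, ℝ).prod 𝓘(ℝ, Fin n → ℂ)) 𝓘(ℝ, ℝ) ∞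
    (fun p : ℝ × X => φ p.1 p.2) (Icc 0 1 ×ˢ univ)
  mem : ∀ t ∈ Icc (0 : ℝ) 1, φ t ∈ κ.potentials

/-- `Φ` is a smooth variation `Φ s t`, `|s| < ε`, `0 ≤ t ≤ 1`, with fixed end points and inside the
space of Kähler potentials, of the path `φ`. -/
structure IsVariation (φ : ℝ → X → ℝ) (ε : ℝ) (Φ : ℝ → ℝ → X → ℝ) : Prop where
  pos : 0 < ε
  smooth : ContMDiffOn (𝓘(ℝ, ℝ).prod (𝓘(ℝ, ℝ).prod 𝓘(ℝ, Fin n → ℂ))) 𝓘(ℝ, ℝ) ∞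
    (fun p : ℝ × ℝ × X => Φ p.1 p.2.1 p.2.2) (Ioo (-ε) ε ×ˢ Icc 0 1 ×ˢ univ)
  mem : ∀ s ∈ Ioo (-ε) ε, ∀ t ∈ Icc (0 : ℝ) 1, Φ s t ∈ κ.potentials
  zero : ∀ t ∈ Icc (0 : ℝ) 1, Φ 0 t = φ t
  left : ∀ s ∈ Ioo (-ε) ε, Φ s 0 = φ 0
  right : ∀ s ∈ Ioo (-ε) ε, Φ s 1 = φ 1

variable [CompactSpace X] [T2Space X]

/-- The generalized Landau-Hall functional
`LH(φ) = ½ ∫₀¹ ∫_X (φ̇_t)² MA(φ_t) dt + ∫₀¹ ∫_X φ̇_t MA(φ̇_t) dt`. -/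
def landauHall (φ : ℝ → X → ℝ) : ℝ :=
  (1 / 2) * (∫ t in (0 : ℝ)..1, integralTop (X := X) fun e w =>
      (dot φ t (e.symm w)) ^ 2 * κ.MA (φ t) e w) +
    ∫ t in (0 : ℝ)..1, integralTop (X := X) fun e w =>
      dot φ t (e.symm w) * κ.MA (dot φ t) e w

/-- A magnetic geodesic: a path in the space of Kähler potentials that is an extremal of the
generalized Landau-Hall functional among the paths with the same end points. -/
def IsMagneticGeodesic (φ : ℝ → X → ℝ) : Prop :=
  κ.IsPath φ ∧ ∀ (ε : ℝ) (Φ : ℝ → ℝ → X → ℝ), κ.IsVariation φ ε Φ →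
    HasDerivAt (fun s => κ.landauHall (Φ s)) 0 0

/-- The magnetic geodesic equation, an equality of forms of top degree on `X`:
`φ̈ MA(φ) = (n/V_α) dφ̇ ∧ dᶜφ̇ ∧ ω_φ^{n-1} - (2n/V_α) ddᶜφ̈ ∧ ω_φ̇^{n-1}
  - (n(n-1)/V_α) ddᶜφ̇ ∧ ddᶜφ̈ ∧ ω_φ̇^{n-2}`. -/
def MagneticGeodesicEq (φ : ℝ → X → ℝ) : Prop :=
  ∀ t ∈ Icc (0 : ℝ) 1, ∀ e ∈ atlas (Fin n → ℂ) X, ∀ w ∈ e.target,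
    dot (dot φ) t (e.symm w) * κ.MA (φ t) e w =
      (n / κ.vol) * wedgeDensity
          (slots₁ (dWedgeDcCoeff (dot φ t) e w) (κ.perturb (φ t) e w)) -
      (2 * n / κ.vol) * wedgeDensity
          (slots₁ (ddcCoeff (dot (dot φ) t) e w) (κ.perturb (dot φ t) e w)) -
      (n * (n - 1) / κ.vol) * wedgeDensity
          (slots₂ (ddcCoeff (dot φ t) e w) (ddcCoeff (dot (dot φ) t) e w)
            (κ.perturb (dot φ t) e w))

end KahlerForm

/-! ## Toric Kähler manifolds -/

/-- The exponential map `ℂⁿ → 𝕋 = (ℂ*)ⁿ`. -/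
def torusExp {n : ℕ} (w : Fin n → ℂ) : Fin n → ℂˣ :=
  fun i => Units.mk0 (Complex.exp (w i)) (Complex.exp_ne_zero _)

/-- `L(z₁, …, zₙ) = (log |z₁|, …, log |zₙ|)`. -/
def torusLog {n : ℕ} (z : Fin n → ℂˣ) : Fin n → ℝ :=
  fun i => Real.log ‖(z i : ℂ)‖

/-- The compact torus `(S¹)ⁿ` inside `(ℂ*)ⁿ`. -/
def compactTorus (n : ℕ) : Set (Fin n → ℂˣ) :=
  {z | ∀ i, ‖(z i : ℂ)‖ = 1}

/-- `X`, with its action of `𝕋 = (ℂ*)ⁿ`, is an equivariant (partial) compactification of `𝕋`: the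
action is holomorphic (it is checked after composition with the covering `exp : ℂⁿ → 𝕋`) and
`z ↦ z • x₀` identifies `𝕋` with an open dense orbit. -/
structure IsToric (n : ℕ) {X : Type*} [TopologicalSpace X] [ChartedSpace (Fin n → ℂ) X]
    [MulAction (Fin n → ℂˣ) X] (x₀ : X) : Prop where
  holomorphic : ContMDiff (𝓘(ℂ, Fin n → ℂ).prod 𝓘(ℂ, Fin n → ℂ)) 𝓘(ℂ, Fin n → ℂ) ω
    (fun p : (Fin n → ℂ) × X => torusExp p.1 • p.2)
  injective : Function.Injective fun z : Fin n → ℂˣ => z • x₀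
  isOpen_orbit : IsOpen (range fun z : Fin n → ℂˣ => z • x₀)
  dense_orbit : Dense (range fun z : Fin n → ℂˣ => z • x₀)

namespace KahlerForm

variable {n : ℕ} {X : Type*} [TopologicalSpace X] [ChartedSpace (Fin n → ℂ) X]
  [MulAction (Fin n → ℂˣ) X] (κ : KahlerForm n X)

/-- The Kähler form is invariant under `(S¹)ⁿ`. -/
def IsTorusInvariant : Prop :=
  ∀ z ∈ compactTorus n, ∀ e ∈ atlas (Fin n → ℂ) X, ∀ e' ∈ atlas (Fin n → ℂ) X,
    ∀ x ∈ e.source, z • x ∈ e'.source →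
      κ.coeff e (e x) = pullCoeff (fun v => e' (z • e.symm v)) (κ.coeff e' (e' (z • x))) (e x)

/-- `ω = ddᶜ(F₀ ∘ L)` on `𝕋 ≅ 𝕋 • x₀ ⊆ X`; the two forms are compared in the logarithmic coordinates
`w` of the point `torusExp w` of `𝕋`, which are local holomorphic coordinates on `𝕋`. -/
def HasTorusPotential (x₀ : X) (F₀ : (Fin n → ℝ) → ℝ) : Prop :=
  ∀ e ∈ atlas (Fin n → ℂ) X, ∀ w : Fin n → ℂ, torusExp w • x₀ ∈ e.source →
    pullCoeff (fun v => e (torusExp v • x₀)) (κ.coeff e (e (torusExp w • x₀))) w =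
      cHess (fun v => F₀ (torusLog (torusExp v))) w

/-- The space `ℋ_tor` of toric Kähler potentials: the `(S¹)ⁿ`-invariant Kähler potentials. -/
def toricPotentials : Set (X → ℝ) :=
  {u | u ∈ κ.potentials ∧ ∀ z ∈ compactTorus n, ∀ x, u (z • x) = u x}

end KahlerForm

/-- The function `F_u` on `ℝⁿ` attached to a toric function `u` on `X`, characterised by
`F_u ∘ L = F₀ ∘ L + u` on `𝕋`: its value at `x` is read off at the point `exp x` of `𝕋`. -/
def toricRep {n : ℕ} {X : Type*} [MulAction (Fin n → ℂˣ) X] (x₀ : X) (F₀ : (Fin n → ℝ) → ℝ)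
    (u : X → ℝ) (x : Fin n → ℝ) : ℝ :=
  F₀ x + u (torusExp (fun i => (x i : ℂ)) • x₀)

/-! ## Real terms -/

/-- The Hessian of a function on `ℝⁿ`. -/
def realHess {n : ℕ} (F : (Fin n → ℝ) → ℝ) (x : Fin n → ℝ) : Matrix (Fin n) (Fin n) ℝ :=
  Matrix.of fun i j => fderiv ℝ (fun y => fderiv ℝ F y (Pi.single j 1)) x (Pi.single i 1)

/-- The matrix `(∂F/∂xᵢ)(∂F/∂xⱼ)`. -/
def realGradSq {n : ℕ} (F : (Fin n → ℝ) → ℝ) (x : Fin n → ℝ) : Matrix (Fin n) (Fin n) ℝ :=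
  Matrix.of fun i j => fderiv ℝ F x (Pi.single i 1) * fderiv ℝ F x (Pi.single j 1)

/-- The density `n! det(∂²F/∂xᵢ∂xⱼ)` of the real Monge-Ampère measure of a smooth function. -/
def realMA {n : ℕ} (F : (Fin n → ℝ) → ℝ) (x : Fin n → ℝ) : ℝ :=
  (n.factorial : ℝ) * (realHess F x).det

/-- The magnetic geodesic equation in real terms for a path `F_t = F_{φ_t}`, `0 ≤ t ≤ 1`, where
`V = ∫ MA_ℝ(F₀)`. The products of (1,1)-forms turn into mixed discriminants, and `ω_φ̇ = ω + ddᶜφ̇`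
into the Hessian of `F_φ̇ = F₀ + Ḟ_φ`. -/
def RealMagneticGeodesicEq {n : ℕ} (F₀ : (Fin n → ℝ) → ℝ) (F : ℝ → (Fin n → ℝ) → ℝ) : Prop :=
  ∀ t ∈ Icc (0 : ℝ) 1, ∀ x : Fin n → ℝ,
    dot (dot F) t x * (realMA (F t) x / ∫ y, realMA F₀ y) =
      (n / ∫ y, realMA F₀ y) * mixedDet
          (slots₁ (realGradSq (dot F t) x) (realHess (F t) x)) -
      (2 * n / ∫ y, realMA F₀ y) * mixedDet
          (slots₁ (realHess (dot (dot F) t) x) (realHess (fun y => F₀ y + dot F t y) x)) -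
      (n * (n - 1) / ∫ y, realMA F₀ y) * mixedDet
          (slots₂ (realHess (dot F t) x) (realHess (dot (dot F) t) x)
            (realHess (fun y => F₀ y + dot F t y) x))

end

/-!
# The toric magnetic geodesic equation

**First variation.** Let `Φ s t` be a variation of the path `φ` with variation field `ψ`. The densities
of all forms in the Landau-Hall functional are polynomials in the coefficients in a chart, so the
functional may be differentiated under the integral sign (`KahlerForm.hasDerivAt_landauHall`). Two
facts bring the derivative into the form `-∫₀¹ ∫_X ψ · E`, where `E` is the difference of the two
sides of the magnetic geodesic equation (`KahlerForm.integral_lagrangianDeriv`): integration by parts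
in time, and Green's formula `∫ v ddᶜu ∧ C^{n-1} = ∫ u ddᶜv ∧ C^{n-1}` for closed `C`
(`integralTop_green`). Green's formula is reduced by a partition of unity to an open subset of `ℂⁿ`,
where the integrands differ by a divergence, because the rows and the columns of the cofactors of a
closed form are divergence free (`sum_wirt_mixedCof`); this in turn is a sign-reversing symmetry of
the mixed discriminant (`sum_mixedDet_update_eq_zero`).

So the equation `E = 0` makes `φ` an extremal. Conversely, if `φ` is an extremal, let
`f = E / MA(φ)`, which is a smooth function on `[0,1] × X`. Since positivity of `ω + ddᶜu` is an open
condition and `X` is compact, `φ_t + s t (1 - t) f_t` is an admissible variation for small `s`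
(`KahlerForm.exists_forall_posDef`), and the first variation formula gives
`∫₀¹ t (1 - t) ∫_X f² MA(φ) = 0`, hence `f = 0`.

**Logarithmic coordinates.** On the open orbit, `w ↦ exp w • x₀` is a local biholomorphism: by
equivariance a vector in the kernel of its derivative would generate a one-parameter group fixing a
point of the orbit (`IsToric.det_cJac_orbit_ne_zero`). In the coordinates `w`, invariant functions
depend only on the real parts, and the complex Hessian of `F ∘ Re` is a quarter of the real Hessian
of `F`. Therefore the Kähler condition gives positive definite real Hessians, hence strict convexity,
and the equation on `X` turns into the real one up to a positive factor
(`eulerLagrange_orbit`). The orbit is dense, so the equation holds on `X` as soon as it holds there.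

**Total mass.** A fundamental domain `-π < Im wᵢ ≤ π` of the exponential map is embedded into the compact
manifold `X`, which is covered by finitely many compact subsets of charts; hence
`MA_ℝ(F₀)(Re w)` is integrable on it, and Fubini's theorem gives the integrability on `ℝⁿ`.
-/

noncomputable section

set_option linter.unusedSectionVars false

/-! ### Mixed discriminants -/

section MixedDet

variable {R : Type*} [CommRing R] {n : ℕ}

/-- Expanding the sum over `σ` turns the mixed discriminant into a signed sum of determinants, the
`k`-th column of the matrix indexed by `τ` being the column `τ k` of `A k`. -/
lemma mixedDet_eq_sum_det (A : Fin n → Matrix (Fin n) (Fin n) R) :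
    mixedDet A = ∑ τ : Equiv.Perm (Fin n), ((Equiv.Perm.sign τ : ℤ) : R) *
      (Matrix.of fun i k => A k i (τ k)).det := by
  unfold mixedDet
  rw [Finset.sum_comm]
  refine Finset.sum_congr rfl fun τ _ => ?_
  rw [Matrix.det_apply', Finset.mul_sum]
  refine Finset.sum_congr rfl fun σ _ => ?_
  simp only [Matrix.of_apply]
  ring

lemma mixedDet_transpose (A : Fin n → Matrix (Fin n) (Fin n) R) :
    mixedDet (fun k => (A k)ᵀ) = mixedDet A := by
  unfold mixedDet
  rw [Finset.sum_comm]
  refine Finset.sum_congr rfl fun σ _ => Finset.sum_congr rfl fun τ _ => ?_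
  simp only [Matrix.transpose_apply]
  ring

lemma mixedDet_mul_left (B : Matrix (Fin n) (Fin n) R) (A : Fin n → Matrix (Fin n) (Fin n) R) :
    mixedDet (fun k => B * A k) = B.det * mixedDet A := by
  rw [mixedDet_eq_sum_det, mixedDet_eq_sum_det, Finset.mul_sum]
  refine Finset.sum_congr rfl fun τ _ => ?_
  have : (Matrix.of fun i k => (B * A k) i (τ k)) = B * Matrix.of fun i k => A k i (τ k) := by
    ext i k
    simp [Matrix.mul_apply]
  rw [this, Matrix.det_mul]
  ring

lemma mixedDet_mul_right (B : Matrix (Fin n) (Fin n) R) (A : Fin n → Matrix (Fin n) (Fin n) R) :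
    mixedDet (fun k => A k * B) = B.det * mixedDet A := by
  rw [← mixedDet_transpose]
  simp only [Matrix.transpose_mul]
  rw [mixedDet_mul_left, mixedDet_transpose, Matrix.det_transpose]

lemma mixedDet_const (B : Matrix (Fin n) (Fin n) R) :
    mixedDet (fun _ => B) = (n.factorial : R) * B.det := by
  have h := mixedDet_mul_left B (fun _ : Fin n => (1 : Matrix (Fin n) (Fin n) R))
  simp only [mul_one] at h
  rw [h, mul_comm]
  congr 1
  rw [mixedDet_eq_sum_det]
  have : ∀ τ : Equiv.Perm (Fin n), ((Equiv.Perm.sign τ : ℤ) : R) *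
      (Matrix.of fun i k => (1 : Matrix (Fin n) (Fin n) R) i (τ k)).det = 1 := by
    intro τ
    have h2 : (Matrix.of fun i k => (1 : Matrix (Fin n) (Fin n) R) i (τ k))
        = (1 : Matrix (Fin n) (Fin n) R).submatrix id τ := rfl
    rw [h2, Matrix.det_permute', Matrix.det_one, mul_one, ← Int.cast_mul, ← Units.val_mul,
      Int.units_mul_self]
    simp
  rw [Finset.sum_congr rfl fun τ _ => this τ]
  simp [Fintype.card_perm]

lemma mixedDet_comp_perm (π : Equiv.Perm (Fin n)) (A : Fin n → Matrix (Fin n) (Fin n) R) :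
    mixedDet (fun k => A (π k)) = mixedDet A := by
  unfold mixedDet
  rw [← Equiv.sum_comp (Equiv.mulRight π)]
  refine Finset.sum_congr rfl fun σ _ => ?_
  rw [← Equiv.sum_comp (Equiv.mulRight π)]
  refine Finset.sum_congr rfl fun τ _ => ?_
  rw [← Equiv.prod_comp π (fun k => A k (σ k) (τ k))]
  simp only [Equiv.coe_mulRight, Equiv.Perm.sign_mul, Units.val_mul, Int.cast_mul,
    Equiv.Perm.mul_apply]
  have hs : ((Equiv.Perm.sign π : ℤ) : R) * ((Equiv.Perm.sign π : ℤ) : R) = 1 := by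
    rw [← Int.cast_mul, ← Units.val_mul, Int.units_mul_self]; simp
  linear_combination ((Equiv.Perm.sign σ : ℤ) : R) * ((Equiv.Perm.sign τ : ℤ) : R) *
    (∏ k, A (π k) (σ (π k)) (τ (π k))) * hs

lemma mixedDet_smul (c : R) (A : Fin n → Matrix (Fin n) (Fin n) R) :
    mixedDet (fun k => c • A k) = c ^ n * mixedDet A := by
  unfold mixedDet
  simp only [Finset.mul_sum]
  refine Finset.sum_congr rfl fun σ _ => Finset.sum_congr rfl fun τ _ => ?_
  simp only [Matrix.smul_apply, smul_eq_mul, Finset.prod_mul_distrib, Finset.prod_const,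
    Finset.card_univ, Fintype.card_fin]
  ring

lemma mixedDet_map {S : Type*} [CommRing S] (f : R →+* S)
    (A : Fin n → Matrix (Fin n) (Fin n) R) :
    mixedDet (fun k => (A k).map f) = f (mixedDet A) := by
  simp [mixedDet, map_sum, map_prod]

lemma slots₁_map {M N : Type*} (f : M → N) (A C : M) (k : Fin n) :
    f (slots₁ A C k) = slots₁ (f A) (f C) k := by
  simp only [slots₁]; split_ifs <;> rfl

lemma slots₂_map {M N : Type*} (f : M → N) (A B C : M) (k : Fin n) :
    f (slots₂ A B C k) = slots₂ (f A) (f B) (f C) k := by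
  simp only [slots₂]; split_ifs <;> rfl

lemma sum_comm₃ {ι κ α M : Type*} [AddCommMonoid M] [Fintype ι] [Fintype κ] [Fintype α]
    (f : ι → κ → α → M) : ∑ i, ∑ j, ∑ s, f i j s = ∑ s, ∑ i, ∑ j, f i j s :=
  (Finset.sum_congr rfl fun _ _ => Finset.sum_comm).trans Finset.sum_comm

/-- The coefficient of `B i j` in the mixed discriminant of `B, C, …, C`. -/
def mixedCof (C : Matrix (Fin n) (Fin n) R) (i j : Fin n) : R :=
  mixedDet (slots₁ (Matrix.single i j 1) C)

lemma prod_slots₁ [NeZero n] (B C : Matrix (Fin n) (Fin n) R) (σ τ : Fin n → Fin n) :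
    ∏ k, slots₁ B C k (σ k) (τ k) =
      B (σ 0) (τ 0) * ∏ k ∈ Finset.univ.erase 0, C (σ k) (τ k) := by
  rw [← Finset.mul_prod_erase _ _ (Finset.mem_univ (0 : Fin n))]
  congr 1
  refine Finset.prod_congr rfl fun k hk => ?_
  have : k.val ≠ 0 := fun h => (Finset.ne_of_mem_erase hk) (Fin.ext (by simpa using h))
  simp [slots₁, this]

lemma mixedDet_slots₁ [NeZero n] (B C : Matrix (Fin n) (Fin n) R) :
    mixedDet (slots₁ B C) = ∑ i, ∑ j, B i j * mixedCof C i j := by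
  unfold mixedCof mixedDet
  simp only [prod_slots₁, Finset.mul_sum]
  rw [sum_comm₃]
  refine Finset.sum_congr rfl fun σ _ => ?_
  rw [sum_comm₃]
  refine Finset.sum_congr rfl fun τ _ => ?_
  rw [Finset.sum_eq_single (σ 0), Finset.sum_eq_single (τ 0)]
  · simp; ring
  · intro j _ hj; simp [hj]
  · simp
  · intro i _ hi; simp [hi]
  · simp

/-- The cancellation behind `d(C ∧ ⋯ ∧ C) = 0` for closed `C`: if `dC a i j`, standing for the
derivative `∂ₐ C i j`, is symmetric in `a` and `i`, then exchanging the slots `0` and `k` is a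
sign-reversing symmetry of the sum. -/
lemma sum_mixedDet_update_eq_zero [NeZero n] (C : Matrix (Fin n) (Fin n) R)
    (dC : Fin n → Matrix (Fin n) (Fin n) R) (hsymm : ∀ a i j, dC a i j = dC i a j) (j k : Fin n)
    (hk : k ≠ 0) :
    ∑ a, mixedDet (Function.update (slots₁ (Matrix.single a j 1) C) k (dC a)) = 0 := by
  have hprod : ∀ (a : Fin n) (σ τ : Equiv.Perm (Fin n)),
      ∏ l, Function.update (slots₁ (Matrix.single a j (1 : R)) C) k (dC a) l (σ l) (τ l) =
      Matrix.single a j (1 : R) (σ 0) (τ 0) * (dC a (σ k) (τ k) *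
        ∏ l ∈ (Finset.univ.erase 0).erase k, C (σ l) (τ l)) := by
    intro a σ τ
    rw [← Finset.mul_prod_erase _ _ (Finset.mem_univ (0 : Fin n)),
      ← Finset.mul_prod_erase (Finset.univ.erase 0) _ (Finset.mem_erase.2 ⟨hk, Finset.mem_univ k⟩)]
    rw [Function.update_of_ne hk.symm, Function.update_self]
    congr 1
    congr 1
    refine Finset.prod_congr rfl fun l hl => ?_
    have h1 : l ≠ k := Finset.ne_of_mem_erase hl
    have h0 : l.val ≠ 0 := fun h =>
      (Finset.ne_of_mem_erase (Finset.mem_of_mem_erase hl)) (Fin.ext (by simpa using h))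
    simp [Function.update_of_ne h1, slots₁, h0]
  have hsum : ∀ σ τ : Equiv.Perm (Fin n),
      ∑ a, ∏ l, Function.update (slots₁ (Matrix.single a j (1 : R)) C) k (dC a) l (σ l) (τ l) =
      (if τ 0 = j then 1 else 0) * (dC (σ 0) (σ k) (τ k) *
        ∏ l ∈ (Finset.univ.erase 0).erase k, C (σ l) (τ l)) := by
    intro σ τ
    rw [Finset.sum_congr rfl fun a _ => hprod a σ τ, Finset.sum_eq_single (σ 0)]
    · simp [Matrix.single_apply, eq_comm]
    · intro a _ ha; simp [ha]
    · simp
  have hτ : ∀ τ : Equiv.Perm (Fin n), ∑ σ : Equiv.Perm (Fin n),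
      ((Equiv.Perm.sign σ : ℤ) : R) * ((if τ 0 = j then 1 else 0) * (dC (σ 0) (σ k) (τ k) *
        ∏ l ∈ (Finset.univ.erase 0).erase k, C (σ l) (τ l))) = 0 := by
    intro τ
    refine Finset.sum_involution (fun σ _ => σ * Equiv.swap 0 k) ?_ ?_ ?_ ?_
    · intro σ _
      have hp : ∏ l ∈ (Finset.univ.erase 0).erase k, C ((σ * Equiv.swap 0 k) l) (τ l) =
          ∏ l ∈ (Finset.univ.erase 0).erase k, C (σ l) (τ l) := by
        refine Finset.prod_congr rfl fun l hl => ?_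
        rw [Equiv.Perm.mul_apply, Equiv.swap_apply_of_ne_of_ne
          (Finset.ne_of_mem_erase (Finset.mem_of_mem_erase hl)) (Finset.ne_of_mem_erase hl)]
      rw [hp]
      simp only [Equiv.Perm.mul_apply, Equiv.swap_apply_left, Equiv.swap_apply_right,
        Equiv.Perm.sign_mul, Equiv.Perm.sign_swap hk.symm, hsymm (σ k) (σ 0)]
      split_ifs <;> simp
    · intro σ _ _ h
      exact hk.symm (Equiv.swap_eq_one_iff.1 (by simpa using h))
    · intro σ _; exact Finset.mem_univ _
    · intro σ _; simp [mul_assoc]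
  unfold mixedDet
  rw [← sum_comm₃ fun σ τ a => ((Equiv.Perm.sign σ : ℤ) : R) * ((Equiv.Perm.sign τ : ℤ) : R) *
    ∏ l, Function.update (slots₁ (Matrix.single a j (1 : R)) C) k (dC a) l (σ l) (τ l),
    Finset.sum_comm]
  refine Finset.sum_eq_zero fun τ _ => ?_
  simp only [← Finset.mul_sum, hsum]
  rw [Finset.sum_congr rfl fun σ _ => by rw [mul_comm ((Equiv.Perm.sign σ : ℤ) : R), mul_assoc],
    ← Finset.mul_sum, hτ τ, mul_zero]

lemma mixedCof_transpose (C : Matrix (Fin n) (Fin n) R) (i j : Fin n) :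
    mixedCof Cᵀ i j = mixedCof C j i := by
  unfold mixedCof
  rw [← mixedDet_transpose]
  congr 1
  funext k
  rw [slots₁_map Matrix.transpose]
  simp

/-- As the mixed discriminant is symmetric, a single matrix may be moved to the slot `0`. -/
lemma mixedDet_update_const [NeZero n] (A B : Matrix (Fin n) (Fin n) R) (k : Fin n) :
    mixedDet (Function.update (fun _ => A) k B) = mixedDet (slots₁ B A) := by
  rw [← mixedDet_comp_perm (Equiv.swap 0 k)]
  congr 1
  funext l
  by_cases hl : l = 0
  · subst hl; simp [slots₁]
  · have h0 : l.val ≠ 0 := fun h => hl (Fin.ext (by simpa using h))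
    have : Equiv.swap 0 k l ≠ k := by
      intro h
      exact hl ((Equiv.swap 0 k).injective (by simpa using h))
    simp [slots₁, h0, Function.update_of_ne this]

lemma mixedDet_update_slots₁_zero [NeZero n] (A B C : Matrix (Fin n) (Fin n) R) :
    mixedDet (Function.update (slots₁ B C) 0 A) = mixedDet (slots₁ A C) := by
  congr 1
  funext l
  by_cases hl : l = 0
  · subst hl; simp [slots₁]
  · have h0 : l.val ≠ 0 := fun h => hl (Fin.ext (by simpa using h))
    simp [slots₁, h0, hl]

/-- As the mixed discriminant is symmetric, the second special matrix may be moved to the slot `1`. -/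
lemma mixedDet_update_slots₁ [NeZero n] (A B C : Matrix (Fin n) (Fin n) R) (k : Fin n)
    (hk : k ≠ 0) :
    mixedDet (Function.update (slots₁ B C) k A) = mixedDet (slots₂ B A C) := by
  have hk0 : k.val ≠ 0 := fun h => hk (Fin.ext (by simpa using h))
  have hlt : 1 < n := by omega
  set o : Fin n := ⟨1, hlt⟩
  have ho : o ≠ 0 := by intro h; have := congrArg Fin.val h; simp [o] at this
  rw [← mixedDet_comp_perm (Equiv.swap o k)]
  congr 1
  funext l
  by_cases hl : l = 0
  · subst hl
    rw [Equiv.swap_apply_of_ne_of_ne ho.symm hk.symm, Function.update_of_ne hk.symm]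
    simp [slots₁, slots₂]
  · have h0 : l.val ≠ 0 := fun h => hl (Fin.ext (by simpa using h))
    by_cases h1 : l = o
    · subst h1
      rw [Equiv.swap_apply_left, Function.update_self]
      simp [slots₂, o]
    · have h1' : l.val ≠ 1 := fun h => h1 (Fin.ext h)
      have hne : Equiv.swap o k l ≠ k := by
        intro h; exact h1 ((Equiv.swap o k).injective (by simpa using h))
      have hne0 : (Equiv.swap o k l).val ≠ 0 := by
        intro h
        have : Equiv.swap o k l = 0 := Fin.ext (by simpa using h)
        have h2 : Equiv.swap o k 0 = 0 := Equiv.swap_apply_of_ne_of_ne ho.symm hk.symm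
        exact hl ((Equiv.swap o k).injective (this.trans h2.symm))
      simp [Function.update_of_ne hne, slots₁, slots₂, h0, h1', hne0]

lemma mixedDet_update_lin (A : Fin n → Matrix (Fin n) (Fin n) R) (k : Fin n) (c d : R)
    (B B' : Matrix (Fin n) (Fin n) R) :
    mixedDet (Function.update A k (c • B + d • B')) =
      c * mixedDet (Function.update A k B) + d * mixedDet (Function.update A k B') := by
  have hp : ∀ (D : Matrix (Fin n) (Fin n) R) (σ τ : Equiv.Perm (Fin n)),
      ∏ l, Function.update A k D l (σ l) (τ l) =
        D (σ k) (τ k) * ∏ l ∈ Finset.univ.erase k, A l (σ l) (τ l) := by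
    intro D σ τ
    rw [← Finset.mul_prod_erase _ _ (Finset.mem_univ k), Function.update_self]
    congr 1
    exact Finset.prod_congr rfl fun l hl => by
      rw [Function.update_of_ne (Finset.ne_of_mem_erase hl)]
  unfold mixedDet
  simp only [hp, Finset.mul_sum, ← Finset.sum_add_distrib]
  refine Finset.sum_congr rfl fun σ _ => Finset.sum_congr rfl fun τ _ => ?_
  simp only [Matrix.add_apply, Matrix.smul_apply, smul_eq_mul]
  ring

lemma mixedDet_slots₁_lin [NeZero n] (c d : R) (B B' C : Matrix (Fin n) (Fin n) R) :
    mixedDet (slots₁ (c • B + d • B') C) =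
      c * mixedDet (slots₁ B C) + d * mixedDet (slots₁ B' C) := by
  simp only [← mixedDet_update_slots₁_zero _ C C, mixedDet_update_lin]

end MixedDet

/-! ### Differentiating mixed discriminants -/

section MixedDetDeriv

variable {n : ℕ}

lemma hasDerivAt_mixedDet {A : ℝ → Fin n → Matrix (Fin n) (Fin n) ℂ}
    {A' : Fin n → Matrix (Fin n) (Fin n) ℂ} {r : ℝ}
    (h : ∀ k i j, HasDerivAt (fun s => A s k i j) (A' k i j) r) :
    HasDerivAt (fun s => mixedDet (A s))
      (∑ k, mixedDet (Function.update (A r) k (A' k))) r := by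
  unfold mixedDet
  have hp : ∀ σ τ : Equiv.Perm (Fin n), HasDerivAt (fun s => ∏ k, A s k (σ k) (τ k))
      (∑ k, ∏ l, Function.update (A r) k (A' k) l (σ l) (τ l)) r := by
    intro σ τ
    refine (HasDerivAt.fun_finsetProd (u := Finset.univ) (f := fun k s => A s k (σ k) (τ k))
      (f' := fun k => A' k (σ k) (τ k)) (x := r) (fun k _ => h k _ _)).congr_deriv ?_
    refine Finset.sum_congr rfl fun k _ => ?_
    rw [eq_comm, ← Finset.mul_prod_erase _ _ (Finset.mem_univ k), Function.update_self, smul_eq_mul,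
      mul_comm]
    congr 1
    refine Finset.prod_congr rfl fun l hl => ?_
    rw [Function.update_of_ne (Finset.ne_of_mem_erase hl)]
  have hs : HasDerivAt (fun s => ∑ σ : Equiv.Perm (Fin n), ∑ τ : Equiv.Perm (Fin n),
      ((Equiv.Perm.sign σ : ℤ) : ℂ) * ((Equiv.Perm.sign τ : ℤ) : ℂ) * ∏ k, A s k (σ k) (τ k))
      (∑ σ : Equiv.Perm (Fin n), ∑ τ : Equiv.Perm (Fin n),
        ((Equiv.Perm.sign σ : ℤ) : ℂ) * ((Equiv.Perm.sign τ : ℤ) : ℂ) *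
          ∑ k, ∏ l, Function.update (A r) k (A' k) l (σ l) (τ l)) r :=
    HasDerivAt.fun_sum fun σ _ => HasDerivAt.fun_sum fun τ _ => (hp σ τ).const_mul _
  refine hs.congr_deriv ?_
  simp only [Finset.mul_sum]
  exact sum_comm₃ _

lemma hasDerivAt_mixedDet_const {A : ℝ → Matrix (Fin n) (Fin n) ℂ}
    {A' : Matrix (Fin n) (Fin n) ℂ} {r : ℝ}
    (h : ∀ i j, HasDerivAt (fun s => A s i j) (A' i j) r) :
    HasDerivAt (fun s => mixedDet (fun _ => A s)) (n * mixedDet (slots₁ A' (A r))) r := by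
  convert hasDerivAt_mixedDet (A := fun s _ => A s) (A' := fun _ => A') (fun _ i j => h i j) using 1
  rcases Nat.eq_zero_or_pos n with rfl | hn
  · simp
  · have : NeZero n := ⟨hn.ne'⟩
    simp [mixedDet_update_const]

/-- The slots occupied by `C` contribute equal terms to the derivative, by symmetry. -/
lemma hasDerivAt_mixedDet_slots₁ [NeZero n] {B C : ℝ → Matrix (Fin n) (Fin n) ℂ}
    {B' C' : Matrix (Fin n) (Fin n) ℂ} {r : ℝ}
    (hB : ∀ i j, HasDerivAt (fun s => B s i j) (B' i j) r)
    (hC : ∀ i j, HasDerivAt (fun s => C s i j) (C' i j) r) :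
    HasDerivAt (fun s => mixedDet (slots₁ (B s) (C s)))
      (mixedDet (slots₁ B' (C r)) + (n - 1) * mixedDet (slots₂ (B r) C' (C r))) r := by
  convert hasDerivAt_mixedDet (A := fun s => slots₁ (B s) (C s)) (A' := slots₁ B' C') (r := r)
    (by intro k i j; simp only [slots₁]; split_ifs; exacts [hB i j, hC i j]) using 1
  rw [← Finset.add_sum_erase _ _ (Finset.mem_univ (0 : Fin n)), mixedDet_update_slots₁_zero]
  congr 1
  rw [Finset.sum_congr rfl (g := fun _ => mixedDet (slots₂ (B r) C' (C r)))]
  · simp [Finset.card_erase_of_mem, Nat.cast_sub (NeZero.one_le (n := n))]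
  · intro k hk
    have hk0 : k ≠ 0 := Finset.ne_of_mem_erase hk
    have : k.val ≠ 0 := fun h => hk0 (Fin.ext (by simpa using h))
    rw [show slots₁ B' C' k = C' by simp [slots₁, this], mixedDet_update_slots₁ _ _ _ _ hk0]

lemma ContDiffOn.mixedDet {E : Type*} [NormedAddCommGroup E] [NormedSpace ℝ E] {S : Set E}
    {m : WithTop ℕ∞} {A : E → Fin n → Matrix (Fin n) (Fin n) ℂ}
    (h : ∀ k i j, ContDiffOn ℝ m (fun p => A p k i j) S) :
    ContDiffOn ℝ m (fun p => _root_.mixedDet (A p)) S := by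
  unfold _root_.mixedDet
  exact ContDiffOn.sum fun σ _ => ContDiffOn.sum fun τ _ =>
    contDiffOn_const.mul (contDiffOn_prod fun k _ => h k _ _)

end MixedDetDeriv

/-! ### Wirtinger calculus -/

section Wirtinger

variable {n : ℕ}

lemma two_le_infty : (2 : WithTop ℕ∞) ≤ ∞ := by
  rw [show (2 : WithTop ℕ∞) = ((2 : ℕ∞) : WithTop ℕ∞) from rfl]
  exact WithTop.coe_le_coe.2 le_top

lemma wirt_congr {g h : (Fin n → ℂ) → ℂ} {w : Fin n → ℂ} (hgh : g =ᶠ[𝓝 w] h) (k : Fin n) :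
    wirt k g w = wirt k h w := by
  simp [wirt, hgh.fderiv_eq]

lemma wirtBar_congr {g h : (Fin n → ℂ) → ℂ} {w : Fin n → ℂ} (hgh : g =ᶠ[𝓝 w] h) (k : Fin n) :
    wirtBar k g w = wirtBar k h w := by
  simp [wirtBar, hgh.fderiv_eq]

lemma wirt_mul {g h : (Fin n → ℂ) → ℂ} {w : Fin n → ℂ} (hg : DifferentiableAt ℝ g w)
    (hh : DifferentiableAt ℝ h w) (k : Fin n) :
    wirt k (fun v => g v * h v) w = wirt k g w * h w + g w * wirt k h w := by
  simp only [wirt, fderiv_fun_mul hg hh, _root_.add_apply,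
    _root_.smul_apply, smul_eq_mul]
  ring

lemma wirtBar_mul {g h : (Fin n → ℂ) → ℂ} {w : Fin n → ℂ} (hg : DifferentiableAt ℝ g w)
    (hh : DifferentiableAt ℝ h w) (k : Fin n) :
    wirtBar k (fun v => g v * h v) w = wirtBar k g w * h w + g w * wirtBar k h w := by
  simp only [wirtBar, fderiv_fun_mul hg hh, _root_.add_apply,
    _root_.smul_apply, smul_eq_mul]
  ring

lemma wirt_sum {ι : Type*} {s : Finset ι} {g : ι → (Fin n → ℂ) → ℂ} {w : Fin n → ℂ}
    (hg : ∀ i ∈ s, DifferentiableAt ℝ (g i) w) (k : Fin n) :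
    wirt k (fun v => ∑ i ∈ s, g i v) w = ∑ i ∈ s, wirt k (g i) w := by
  simp only [wirt, fderiv_fun_sum hg, _root_.sum_apply, Finset.mul_sum,
    Finset.sum_div, ← Finset.sum_sub_distrib]

lemma wirtBar_sum {ι : Type*} {s : Finset ι} {g : ι → (Fin n → ℂ) → ℂ} {w : Fin n → ℂ}
    (hg : ∀ i ∈ s, DifferentiableAt ℝ (g i) w) (k : Fin n) :
    wirtBar k (fun v => ∑ i ∈ s, g i v) w = ∑ i ∈ s, wirtBar k (g i) w := by
  simp only [wirtBar, fderiv_fun_sum hg, _root_.sum_apply, Finset.mul_sum,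
    Finset.sum_div, ← Finset.sum_add_distrib]

/-- The real differential in terms of the Wirtinger derivatives: `dg = ∂g + ∂̄g`. -/
lemma fderiv_eq_sum_wirt (g : (Fin n → ℂ) → ℂ) (w v : Fin n → ℂ) :
    fderiv ℝ g w v = ∑ a, (v a * wirt a g w + star (v a) * wirtBar a g w) := by
  have hv : v = ∑ a, ((v a).re • (Pi.single a 1 : Fin n → ℂ) +
      (v a).im • (Pi.single a Complex.I : Fin n → ℂ)) := by
    funext b
    simp only [Finset.sum_apply, Pi.add_apply, Pi.smul_apply, Complex.real_smul]
    rw [Finset.sum_eq_single b]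
    · simp
    · intro a _ ha; simp [Pi.single_eq_of_ne ha.symm]
    · simp
  conv_lhs => rw [hv]
  rw [map_sum]
  refine Finset.sum_congr rfl fun a _ => ?_
  rw [map_add, map_smul, map_smul, Complex.real_smul, Complex.real_smul]
  have h1 : v a = (v a).re + (v a).im * Complex.I := (Complex.re_add_im _).symm
  have h2 : star (v a) = (v a).re - (v a).im * Complex.I := by
    apply Complex.ext <;> simp
  rw [h2]
  conv_rhs => enter [1, 1]; rw [h1]
  simp only [wirt, wirtBar]
  linear_combination (((v a).im : ℂ) * fderiv ℝ g w (Pi.single a Complex.I)) * Complex.I_mul_I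

/-- The chain rule for holomorphic `f`: the types of derivatives are not mixed. -/
lemma wirt_comp_holo {g : (Fin n → ℂ) → ℂ} {f : (Fin n → ℂ) → (Fin n → ℂ)} {w : Fin n → ℂ}
    (hg : DifferentiableAt ℝ g (f w)) (hf : DifferentiableAt ℂ f w) (k : Fin n) :
    wirt k (fun v => g (f v)) w = ∑ a, cJac f w a k * wirt a g (f w) ∧
    wirtBar k (fun v => g (f v)) w = ∑ a, star (cJac f w a k) * wirtBar a g (f w) := by
  have hfR : HasFDerivAt f ((fderiv ℂ f w).restrictScalars ℝ) w :=
    hf.hasFDerivAt.restrictScalars ℝ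
  have hc : fderiv ℝ (fun v => g (f v)) w =
      (fderiv ℝ g (f w)).comp ((fderiv ℂ f w).restrictScalars ℝ) :=
    (hg.hasFDerivAt.comp w hfR).fderiv
  have hI : ∀ a, fderiv ℂ f w (Pi.single k Complex.I) a = Complex.I * cJac f w a k := by
    intro a
    have : (Pi.single k Complex.I : Fin n → ℂ) = Complex.I • (Pi.single k 1 : Fin n → ℂ) := by
      rw [← Pi.single_smul]; simp
    rw [this, map_smul]; simp [cJac]
  have h1 : ∀ a, fderiv ℂ f w (Pi.single k 1) a = cJac f w a k := fun a => rfl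
  constructor
  · simp only [wirt, hc, ContinuousLinearMap.comp_apply, ContinuousLinearMap.coe_restrictScalars']
    rw [fderiv_eq_sum_wirt, fderiv_eq_sum_wirt, Finset.mul_sum, ← Finset.sum_sub_distrib,
      Finset.sum_div]
    refine Finset.sum_congr rfl fun a _ => ?_
    rw [hI, h1, star_mul', show star Complex.I = -Complex.I from Complex.conj_I]
    simp only [wirt, wirtBar]
    ring_nf
    simp only [Complex.I_sq, Complex.I_pow_three]
    ring
  · simp only [wirtBar, hc, ContinuousLinearMap.comp_apply,
      ContinuousLinearMap.coe_restrictScalars']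
    rw [fderiv_eq_sum_wirt, fderiv_eq_sum_wirt, Finset.mul_sum, ← Finset.sum_add_distrib,
      Finset.sum_div]
    refine Finset.sum_congr rfl fun a _ => ?_
    rw [hI, h1, star_mul', show star Complex.I = -Complex.I from Complex.conj_I]
    simp only [wirt, wirtBar]
    ring_nf
    simp only [Complex.I_sq, Complex.I_pow_three]
    ring

/-- Conjugation exchanges the two Wirtinger derivatives. -/
lemma wirt_star {g : (Fin n → ℂ) → ℂ} {w : Fin n → ℂ} (k : Fin n) :
    wirt k (fun v => star (g v)) w = star (wirtBar k g w) ∧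
    wirtBar k (fun v => star (g v)) w = star (wirt k g w) := by
  have h : ∀ v, fderiv ℝ (fun v => star (g v)) w v = star (fderiv ℝ g w v) := by
    intro v
    have : fderiv ℝ (fun v => star (g v)) w =
        (Complex.conjCLE : ℂ →L[ℝ] ℂ).comp (fderiv ℝ g w) :=
      Complex.conjCLE.comp_fderiv
    rw [this]; rfl
  constructor
  · simp only [wirt, wirtBar, h]
    simp [Complex.conj_I, sub_eq_add_neg]
  · simp only [wirt, wirtBar, h]
    simp [Complex.conj_I, sub_eq_add_neg]

lemma wirtBar_holo {h : (Fin n → ℂ) → ℂ} {w : Fin n → ℂ} (hh : DifferentiableAt ℂ h w)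
    (k : Fin n) : wirtBar k h w = 0 := by
  have hc : fderiv ℝ h w = (fderiv ℂ h w).restrictScalars ℝ :=
    (hh.hasFDerivAt.restrictScalars ℝ).fderiv
  have : (Pi.single k Complex.I : Fin n → ℂ) = Complex.I • (Pi.single k 1 : Fin n → ℂ) := by
    rw [← Pi.single_smul]; simp
  simp only [wirtBar, hc, ContinuousLinearMap.coe_restrictScalars', this, map_smul, smul_eq_mul]
  linear_combination (fderiv ℂ h w (Pi.single k 1) / 2) * Complex.I_mul_I

lemma contDiffOn_fderiv_apply {F : Type*} [NormedAddCommGroup F] [NormedSpace ℝ F]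
    {g : (Fin n → ℂ) → F} {U : Set (Fin n → ℂ)}
    (hU : IsOpen U) (hg : ContDiffOn ℝ ∞ g U) (v : Fin n → ℂ) :
    ContDiffOn ℝ ∞ (fun w => fderiv ℝ g w v) U :=
  (hg.fderiv_of_isOpen hU (by simp)).clm_apply contDiffOn_const

lemma contDiffOn_wirt {g : (Fin n → ℂ) → ℂ} {U : Set (Fin n → ℂ)}
    (hU : IsOpen U) (hg : ContDiffOn ℝ ∞ g U) (k : Fin n) :
    ContDiffOn ℝ ∞ (wirt k g) U :=
  ((contDiffOn_fderiv_apply hU hg _).sub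
    (contDiffOn_const.mul (contDiffOn_fderiv_apply hU hg _))).div_const 2

lemma contDiffOn_wirtBar {g : (Fin n → ℂ) → ℂ} {U : Set (Fin n → ℂ)}
    (hU : IsOpen U) (hg : ContDiffOn ℝ ∞ g U) (k : Fin n) :
    ContDiffOn ℝ ∞ (wirtBar k g) U :=
  ((contDiffOn_fderiv_apply hU hg _).add
    (contDiffOn_const.mul (contDiffOn_fderiv_apply hU hg _))).div_const 2

lemma contDiffOn_ofReal {E : Type*} [NormedAddCommGroup E] [NormedSpace ℝ E] {m : WithTop ℕ∞}
    {u : E → ℝ} {S : Set E} (hu : ContDiffOn ℝ m u S) :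
    ContDiffOn ℝ m (fun v => (u v : ℂ)) S :=
  Complex.ofRealCLM.contDiff.comp_contDiffOn hu

lemma contDiffAt_ofReal {E : Type*} [NormedAddCommGroup E] [NormedSpace ℝ E] {m : WithTop ℕ∞}
    {u : E → ℝ} {w : E} (hu : ContDiffAt ℝ m u w) :
    ContDiffAt ℝ m (fun v => (u v : ℂ)) w :=
  Complex.ofRealCLM.contDiff.contDiffAt.comp w hu

lemma contDiffOn_cHess {u : (Fin n → ℂ) → ℝ} {U : Set (Fin n → ℂ)}
    (hU : IsOpen U) (hu : ContDiffOn ℝ ∞ u U) (i j : Fin n) :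
    ContDiffOn ℝ ∞ (fun w => cHess u w i j) U :=
  contDiffOn_wirt hU (contDiffOn_wirtBar hU (contDiffOn_ofReal hu) j) i

lemma differentiableAt_fderiv_apply {g : (Fin n → ℂ) → ℂ} {w : Fin n → ℂ}
    (hg : ContDiffAt ℝ 2 g w) (v : Fin n → ℂ) :
    DifferentiableAt ℝ (fun w => fderiv ℝ g w v) w :=
  ((hg.fderiv_right (m := 1) (by norm_num)).differentiableAt (by norm_num)).clm_apply
    (differentiableAt_const v)

lemma differentiableAt_wirtBar {g : (Fin n → ℂ) → ℂ} {w : Fin n → ℂ}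
    (hg : ContDiffAt ℝ 2 g w) (k : Fin n) : DifferentiableAt ℝ (wirtBar k g) w :=
  ((differentiableAt_fderiv_apply hg _).add
    ((differentiableAt_const _).mul (differentiableAt_fderiv_apply hg _))).mul_const (2⁻¹ : ℂ)

lemma fderiv_fderiv_comm {g : (Fin n → ℂ) → ℂ} {w : Fin n → ℂ}
    (hg : ContDiffAt ℝ 2 g w) (u v : Fin n → ℂ) :
    fderiv ℝ (fun w => fderiv ℝ g w v) w u = fderiv ℝ (fun w => fderiv ℝ g w u) w v := by
  have hd : DifferentiableAt ℝ (fderiv ℝ g) w :=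
    (hg.fderiv_right (m := 1) (by norm_num)).differentiableAt (by norm_num)
  have h : ∀ a b, fderiv ℝ (fun w => fderiv ℝ g w a) w b = fderiv ℝ (fderiv ℝ g) w b a := by
    intro a b
    rw [fderiv_clm_apply hd (differentiableAt_const a)]
    simp
  rw [h, h]
  exact (hg.isSymmSndFDerivAt (by simp)).eq u v

/-- Derivative of a Wirtinger derivative, expanded in real directions. -/
lemma fderiv_wirt {g : (Fin n → ℂ) → ℂ} {w : Fin n → ℂ} (hg : ContDiffAt ℝ 2 g w) (k : Fin n)
    (v : Fin n → ℂ) :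
    fderiv ℝ (wirt k g) w v = wirt k (fun w => fderiv ℝ g w v) w ∧
    fderiv ℝ (wirtBar k g) w v = wirtBar k (fun w => fderiv ℝ g w v) w := by
  have h1 := (differentiableAt_fderiv_apply hg (Pi.single k 1)).hasFDerivAt
  have h2 := (differentiableAt_fderiv_apply hg (Pi.single k Complex.I)).hasFDerivAt
  constructor
  · have : HasFDerivAt (wirt k g) _ w := (h1.sub (h2.const_mul Complex.I)).mul_const (2⁻¹ : ℂ)
    rw [this.fderiv]
    simp only [_root_.smul_apply, _root_.sub_apply, smul_eq_mul, wirt]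
    rw [fderiv_fderiv_comm hg v, fderiv_fderiv_comm hg v]
    ring
  · have : HasFDerivAt (wirtBar k g) _ w := (h1.add (h2.const_mul Complex.I)).mul_const (2⁻¹ : ℂ)
    rw [this.fderiv]
    simp only [_root_.smul_apply, _root_.add_apply, smul_eq_mul, wirtBar]
    rw [fderiv_fderiv_comm hg v, fderiv_fderiv_comm hg v]
    ring

lemma wirt_lin {g h : (Fin n → ℂ) → ℂ} {w : Fin n → ℂ} (hg : DifferentiableAt ℝ g w)
    (hh : DifferentiableAt ℝ h w) (k : Fin n) (c : ℂ) :
    wirt k (fun v => (g v + c * h v) / 2) w = (wirt k g w + c * wirt k h w) / 2 ∧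
    wirtBar k (fun v => (g v + c * h v) / 2) w = (wirtBar k g w + c * wirtBar k h w) / 2 := by
  have : HasFDerivAt (fun v => (g v + c * h v) / 2) _ w :=
    (hg.hasFDerivAt.add (hh.hasFDerivAt.const_mul c)).mul_const (2⁻¹ : ℂ)
  simp only [wirt, wirtBar, this.fderiv, _root_.smul_apply,
    _root_.add_apply, smul_eq_mul]
  constructor <;> ring

lemma wirt_wirt_comm {g : (Fin n → ℂ) → ℂ} {w : Fin n → ℂ} (hg : ContDiffAt ℝ 2 g w)
    (i j : Fin n) : wirt i (wirt j g) w = wirt j (wirt i g) w := by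
  have h1 := differentiableAt_fderiv_apply hg (Pi.single i 1)
  have h2 := differentiableAt_fderiv_apply hg (Pi.single i Complex.I)
  conv_lhs => rw [wirt, (fderiv_wirt hg j _).1, (fderiv_wirt hg j _).1]
  have h3 := (wirt_lin h1 h2 j (-Complex.I)).1
  simp only [neg_mul, ← sub_eq_add_neg] at h3
  exact h3.symm

lemma wirtBar_wirtBar_comm {g : (Fin n → ℂ) → ℂ} {w : Fin n → ℂ} (hg : ContDiffAt ℝ 2 g w)
    (i j : Fin n) : wirtBar i (wirtBar j g) w = wirtBar j (wirtBar i g) w := by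
  have h1 := differentiableAt_fderiv_apply hg (Pi.single i 1)
  have h2 := differentiableAt_fderiv_apply hg (Pi.single i Complex.I)
  conv_lhs => rw [wirtBar, (fderiv_wirt hg j _).2, (fderiv_wirt hg j _).2]
  exact (wirt_lin h1 h2 j Complex.I).2.symm

lemma wirt_wirtBar_comm {g : (Fin n → ℂ) → ℂ} {w : Fin n → ℂ} (hg : ContDiffAt ℝ 2 g w)
    (i j : Fin n) : wirt i (wirtBar j g) w = wirtBar j (wirt i g) w := by
  have h1 := differentiableAt_fderiv_apply hg (Pi.single i 1)
  have h2 := differentiableAt_fderiv_apply hg (Pi.single i Complex.I)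
  conv_lhs => rw [wirt, (fderiv_wirt hg j _).2, (fderiv_wirt hg j _).2]
  have h3 := (wirt_lin h1 h2 j (-Complex.I)).2
  simp only [neg_mul, ← sub_eq_add_neg] at h3
  exact h3.symm

/-- Holomorphic maps pull back the complex Hessian as a form of type `(1,1)`. -/
lemma cHess_comp {u : (Fin n → ℂ) → ℝ} {f : (Fin n → ℂ) → (Fin n → ℂ)} {w : Fin n → ℂ}
    (hu : ContDiffAt ℝ 2 u (f w)) (hf : ContDiffAt ℂ 2 f w) :
    cHess (fun v => u (f v)) w = pullCoeff f (cHess u (f w)) w := by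
  set g : (Fin n → ℂ) → ℂ := fun v => (u v : ℂ)
  have hg : ContDiffAt ℝ 2 g (f w) := contDiffAt_ofReal hu
  have hfd : ∀ᶠ v in 𝓝 w, DifferentiableAt ℂ f v :=
    (hf.eventually (by simp)).mono fun v hv => hv.differentiableAt (by norm_num)
  have hgd : ∀ᶠ v in 𝓝 w, DifferentiableAt ℝ g (f v) :=
    hf.continuousAt.eventually
      ((hg.eventually (by simp)).mono fun v hv => hv.differentiableAt (by norm_num))
  have hJ : ∀ b j, DifferentiableAt ℂ (fun v => cJac f v b j) w := by
    intro b j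
    have h1 : DifferentiableAt ℂ (fun v => fderiv ℂ f v (Pi.single j 1)) w :=
      ((hf.fderiv_right (m := 1) (by norm_num)).differentiableAt (by norm_num)).clm_apply
        (differentiableAt_const _)
    exact differentiableAt_pi.1 h1 b
  have hJR : ∀ b j, DifferentiableAt ℝ (fun v => star (cJac f v b j)) w := fun b j =>
    (Complex.conjCLE.differentiableAt).comp w ((hJ b j).restrictScalars ℝ)
  have hfR : DifferentiableAt ℝ f w := hfd.self_of_nhds.restrictScalars ℝ
  have hB : ∀ b, DifferentiableAt ℝ (fun v => wirtBar b g (f v)) w := fun b =>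
    (differentiableAt_wirtBar hg b).comp w hfR
  ext i j
  have h1 : cHess (fun v => u (f v)) w i j = wirt i (wirtBar j (fun v => g (f v))) w := rfl
  have h2 : wirtBar j (fun v => g (f v)) =ᶠ[𝓝 w]
      fun v => ∑ b, star (cJac f v b j) * wirtBar b g (f v) := by
    filter_upwards [hfd, hgd] with v h3 h4 using (wirt_comp_holo h4 h3 j).2
  rw [h1, wirt_congr h2, wirt_sum fun b _ => (hJR b j).fun_mul (hB b)]
  simp only [pullCoeff, Matrix.mul_apply, Matrix.transpose_apply, Matrix.map_apply]
  refine Finset.sum_congr rfl fun b _ => ?_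
  rw [wirt_mul (hJR b j) (hB b), (wirt_star i).1, wirtBar_holo (hJ b j), star_zero, zero_mul,
    zero_add, (wirt_comp_holo (differentiableAt_wirtBar hg b) hfd.self_of_nhds i).1, mul_comm]
  rfl

lemma cGradSq_comp {u : (Fin n → ℂ) → ℝ} {f : (Fin n → ℂ) → (Fin n → ℂ)} {w : Fin n → ℂ}
    (hu : DifferentiableAt ℝ u (f w)) (hf : DifferentiableAt ℂ f w) :
    cGradSq (fun v => u (f v)) w = pullCoeff f (cGradSq u (f w)) w := by
  have hg : DifferentiableAt ℝ (fun v => (u v : ℂ)) (f w) :=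
    Complex.ofRealCLM.differentiableAt.comp _ hu
  ext i j
  simp only [cGradSq, pullCoeff, Matrix.mul_apply, Matrix.transpose_apply, Matrix.map_apply,
    Matrix.of_apply]
  rw [(wirt_comp_holo hg hf i).1, (wirt_comp_holo hg hf j).2, Finset.mul_sum]
  refine Finset.sum_congr rfl fun b _ => ?_
  rw [Finset.sum_mul, Finset.sum_mul]
  refine Finset.sum_congr rfl fun a _ => ?_
  ring

/-- The coefficients of `ddᶜ(u²) = 2u ddᶜu + 2 du ∧ dᶜu`. -/
lemma cHess_sq {u : (Fin n → ℂ) → ℝ} {w : Fin n → ℂ} (hu : ContDiffAt ℝ 2 u w) :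
    cHess (fun v => u v ^ 2) w = (2 * (u w : ℂ)) • cHess u w + (2 : ℂ) • cGradSq u w := by
  set g : (Fin n → ℂ) → ℂ := fun v => (u v : ℂ)
  have hg : ContDiffAt ℝ 2 g w := contDiffAt_ofReal hu
  ext i j
  have h1 : cHess (fun v => u v ^ 2) w i j = wirt i (wirtBar j (fun v => g v * g v)) w := by
    simp [cHess, g, sq]
  have h2 : wirtBar j (fun v => g v * g v) =ᶠ[𝓝 w] fun v => (2 * g v) * wirtBar j g v := by
    filter_upwards [hg.eventually (by simp)] with v hv
    have := hv.differentiableAt (by norm_num)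
    rw [wirtBar_mul this this]; ring
  have hd := hg.differentiableAt (by norm_num)
  rw [h1, wirt_congr h2, wirt_mul (hd.const_mul 2) (differentiableAt_wirtBar hg j),
    show (fun v => 2 * g v) = fun v => g v + g v by funext v; ring]
  have : wirt i (fun v => g v + g v) w = 2 * wirt i g w := by
    have h := wirt_sum (s := Finset.range 2) (g := fun _ => g) (w := w) (fun _ _ => hd) i
    simp only [Finset.sum_range_succ, Finset.sum_range_zero, zero_add] at h
    rw [h]; ring
  rw [this]
  simp only [Matrix.add_apply, Matrix.smul_apply, smul_eq_mul, cHess, cGradSq, Matrix.of_apply]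
  ring

/-- The form `ddᶜu` is closed. -/
lemma cHess_closed {u : (Fin n → ℂ) → ℝ} {U : Set (Fin n → ℂ)} (hU : IsOpen U)
    (hu : ContDiffOn ℝ ∞ u U) {w : Fin n → ℂ} (hw : w ∈ U) (i j k : Fin n) :
    wirt k (fun v => cHess u v i j) w = wirt i (fun v => cHess u v k j) w ∧
    wirtBar k (fun v => cHess u v i j) w = wirtBar j (fun v => cHess u v i k) w := by
  have hg : ContDiffOn ℝ ∞ (fun v => (u v : ℂ)) U := contDiffOn_ofReal hu
  have h2 : ∀ {h : (Fin n → ℂ) → ℂ}, ContDiffOn ℝ ∞ h U → ∀ v ∈ U, ContDiffAt ℝ 2 h v :=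
    fun hh v hv => (hh.contDiffAt (hU.mem_nhds hv)).of_le two_le_infty
  refine ⟨wirt_wirt_comm (h2 (contDiffOn_wirtBar hU hg j) w hw) k i, ?_⟩
  have hc : ∀ j, (fun v => cHess u v i j) =ᶠ[𝓝 w] wirtBar j (wirt i fun v => (u v : ℂ)) := by
    intro j
    filter_upwards [hU.mem_nhds hw] with v hv using wirt_wirtBar_comm (h2 hg v hv) i j
  rw [wirtBar_congr (hc j), wirtBar_congr (hc k)]
  exact wirtBar_wirtBar_comm (h2 (contDiffOn_wirt hU hg i) w hw) k j

/-- The product `C ∧ ⋯ ∧ C` of closed forms is closed: the rows and the columns of its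
coefficients are divergence free. -/
lemma sum_wirt_mixedCof [NeZero n] {C : (Fin n → ℂ) → Matrix (Fin n) (Fin n) ℂ} {w : Fin n → ℂ}
    (hC : ∀ i j, DifferentiableAt ℝ (fun v => C v i j) w)
    (hcl : ∀ i j k, wirt k (fun v => C v i j) w = wirt i (fun v => C v k j) w) (j : Fin n) :
    ∑ a, wirt a (fun v => mixedCof (C v) a j) w = 0 := by
  -- along each real direction, only the slots different from `0` are differentiated
  have hdir : ∀ (a : Fin n) (v : Fin n → ℂ),
      fderiv ℝ (fun v => mixedCof (C v) a j) w v = ∑ k ∈ Finset.univ.erase (0 : Fin n),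
        mixedDet (Function.update (slots₁ (Matrix.single a j 1) (C w)) k
          (Matrix.of fun i j => fderiv ℝ (fun v => C v i j) w v)) := by
    intro a v
    have hline : HasDerivAt (fun s : ℝ => w + s • v) v 0 := by
      simpa using ((hasDerivAt_id (0 : ℝ)).smul_const v).const_add w
    have hCs : ∀ i j, HasDerivAt (fun s : ℝ => C (w + s • v) i j)
        (fderiv ℝ (fun v => C v i j) w v) 0 := by
      intro i j
      exact HasFDerivAt.comp_hasDerivAt (l := fun v => C v i j) (0 : ℝ)
        (by simpa using (hC i j).hasFDerivAt) hline
    have hdiff : DifferentiableAt ℝ (fun v => mixedCof (C v) a j) w := by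
      unfold mixedCof mixedDet
      refine DifferentiableAt.fun_sum fun σ _ => DifferentiableAt.fun_sum fun τ _ =>
        (differentiableAt_const _).fun_mul ?_
      have hs : ∀ k, DifferentiableAt ℝ
          (fun v => slots₁ (Matrix.single a j 1) (C v) k (σ k) (τ k)) w := by
        intro k
        simp only [slots₁]
        split_ifs
        · exact differentiableAt_const _
        · exact hC _ _
      exact (HasFDerivAt.finsetProd fun k _ => (hs k).hasFDerivAt).differentiableAt
    have h1 : HasDerivAt (fun s : ℝ => mixedCof (C (w + s • v)) a j)
        (fderiv ℝ (fun v => mixedCof (C v) a j) w v) 0 :=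
      HasFDerivAt.comp_hasDerivAt (l := fun v => mixedCof (C v) a j) (0 : ℝ)
        (by simpa using hdiff.hasFDerivAt) hline
    have h2 := hasDerivAt_mixedDet (r := 0)
      (A := fun s : ℝ => slots₁ (Matrix.single a j (1 : ℂ)) (C (w + s • v)))
      (A' := slots₁ 0 (Matrix.of fun i j => fderiv ℝ (fun v => C v i j) w v))
      (by
        intro k i j'
        simp only [slots₁]
        split_ifs
        · exact hasDerivAt_const _ _
        · exact hCs i j')
    rw [h1.unique h2, ← Finset.add_sum_erase _ _ (Finset.mem_univ (0 : Fin n))]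
    have h0 := mixedDet_update_lin (slots₁ (Matrix.single a j (1 : ℂ)) (C w)) 0 0 0 0 0
    simp only [zero_smul, add_zero, zero_mul] at h0
    rw [show slots₁ (0 : Matrix (Fin n) (Fin n) ℂ)
      (Matrix.of fun i j => fderiv ℝ (fun v => C v i j) w v) 0 = 0 by simp [slots₁]]
    simp only [zero_smul, add_zero, h0, zero_add]
    refine Finset.sum_congr rfl fun k hk => ?_
    have : k.val ≠ 0 := fun h => (Finset.ne_of_mem_erase hk) (Fin.ext (by simpa using h))
    simp [slots₁, this]
  have hw : ∀ a, wirt a (fun v => mixedCof (C v) a j) w = ∑ k ∈ Finset.univ.erase (0 : Fin n),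
      mixedDet (Function.update (slots₁ (Matrix.single a j 1) (C w)) k
        (Matrix.of fun i j => wirt a (fun v => C v i j) w)) := by
    intro a
    rw [wirt, hdir, hdir, Finset.mul_sum, ← Finset.sum_sub_distrib, Finset.sum_div]
    refine Finset.sum_congr rfl fun k _ => ?_
    have : (Matrix.of fun i j => wirt a (fun v => C v i j) w) =
        (2⁻¹ : ℂ) • (Matrix.of fun i j => fderiv ℝ (fun v => C v i j) w (Pi.single a 1)) +
        (-Complex.I / 2) •
          (Matrix.of fun i j => fderiv ℝ (fun v => C v i j) w (Pi.single a Complex.I)) := by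
      ext i j
      simp [wirt]; ring
    rw [this, mixedDet_update_lin]
    ring
  rw [Finset.sum_congr rfl fun a _ => hw a, Finset.sum_comm]
  refine Finset.sum_eq_zero fun k hk => ?_
  exact sum_mixedDet_update_eq_zero (C w) _ (fun a i j => hcl i j a) j k
    (Finset.ne_of_mem_erase hk)

/-- The counterpart of `sum_wirt_mixedCof` for the derivatives `∂/∂z̄ₐ`. -/
lemma sum_wirtBar_mixedCof [NeZero n] {C : (Fin n → ℂ) → Matrix (Fin n) (Fin n) ℂ}
    {w : Fin n → ℂ} (hC : ∀ i j, DifferentiableAt ℝ (fun v => C v i j) w)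
    (hcl : ∀ i j k, wirtBar k (fun v => C v i j) w = wirtBar j (fun v => C v i k) w)
    (i : Fin n) :
    ∑ a, wirtBar a (fun v => mixedCof (C v) i a) w = 0 := by
  -- conjugation and transposition exchange the two types of derivatives
  have h := sum_wirt_mixedCof (C := fun v => ((C v)ᵀ).map star) (w := w)
    (fun i j => Complex.conjCLE.differentiableAt.comp w (hC j i))
    (fun i j k => by
      simp only [Matrix.map_apply, Matrix.transpose_apply]
      rw [(wirt_star k).1, (wirt_star i).1, hcl]) i
  have hm : ∀ v a, mixedCof (((C v)ᵀ).map star) a i = star (mixedCof (C v) i a) := by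
    intro v a
    rw [← mixedCof_transpose (C v) a i]
    unfold mixedCof
    have := mixedDet_map (starRingEnd ℂ) (slots₁ (Matrix.single a i 1) (C v)ᵀ)
    rw [show star (mixedDet (slots₁ (Matrix.single a i 1) (C v)ᵀ)) =
      (starRingEnd ℂ) (mixedDet (slots₁ (Matrix.single a i 1) (C v)ᵀ)) from rfl, ← this]
    congr 1
    funext k
    rw [slots₁_map (fun M : Matrix (Fin n) (Fin n) ℂ => M.map (starRingEnd ℂ))]
    congr 1
    ext p q
    simp [Matrix.single_apply, apply_ite (starRingEnd ℂ)]
  simp only [hm] at h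
  rw [Finset.sum_congr rfl fun a _ => (wirt_star a).1, ← star_sum] at h
  exact star_eq_zero.1 h

end Wirtinger

/-! ### Green's formula on an open subset of `ℂⁿ` -/

section LocalGreen

open MeasureTheory

variable {n : ℕ}

/-- Extension by zero of a function which vanishes outside a compact subset of its domain. -/
lemma contDiff_indicator {F : Type*} [NormedAddCommGroup F] [NormedSpace ℝ F]
    {E : Type*} [NormedAddCommGroup E] [NormedSpace ℝ E] {m : WithTop ℕ∞}
    {g : E → F} {U K : Set E} (hU : IsOpen U) (hK : IsClosed K)
    (hKU : K ⊆ U) (hg : ContDiffOn ℝ m g U) (h0 : ∀ w ∈ U, w ∉ K → g w = 0) :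
    ContDiff ℝ m (U.indicator g) := by
  rw [contDiff_iff_contDiffAt]
  intro w
  by_cases hw : w ∈ U
  · refine (hg.contDiffAt (hU.mem_nhds hw)).congr_of_eventuallyEq ?_
    filter_upwards [hU.mem_nhds hw] with v hv
    simp [hv]
  · refine (contDiffAt_const (c := (0 : F))).congr_of_eventuallyEq ?_
    filter_upwards [hK.isOpen_compl.mem_nhds fun h => hw (hKU h)] with v hv
    by_cases hvU : v ∈ U
    · simp [hvU, h0 v hvU hv]
    · simp [hvU]

lemma continuous_indicator_of_compact {F : Type*} [NormedAddCommGroup F]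
    {E : Type*} [TopologicalSpace E]
    {g : E → F} {U K : Set E} (hU : IsOpen U) (hK : IsClosed K)
    (hKU : K ⊆ U) (hg : ContinuousOn g U) (h0 : ∀ w ∈ U, w ∉ K → g w = 0) :
    Continuous (U.indicator g) := by
  rw [continuous_iff_continuousAt]
  intro w
  by_cases hw : w ∈ U
  · refine (hg.continuousAt (hU.mem_nhds hw)).congr ?_
    filter_upwards [hU.mem_nhds hw] with v hv
    simp [hv]
  · refine (continuousAt_const (y := (0 : F))).congr ?_
    filter_upwards [hK.isOpen_compl.mem_nhds fun h => hw (hKU h)] with v hv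
    by_cases hvU : v ∈ U
    · simp [hvU, h0 v hvU hv]
    · simp [hvU]

lemma hasCompactSupport_indicator {F : Type*} [NormedAddCommGroup F]
    {E : Type*} [TopologicalSpace E] [T2Space E] {g : E → F}
    {U K : Set E} (hK : IsCompact K) (h0 : ∀ w ∈ U, w ∉ K → g w = 0) :
    HasCompactSupport (U.indicator g) := by
  refine HasCompactSupport.intro hK fun w hw => ?_
  by_cases hwU : w ∈ U
  · simp [hwU, h0 w hwU hw]
  · simp [hwU]

lemma integrableOn_of_compact {F : Type*} [NormedAddCommGroup F] {g : (Fin n → ℂ) → F}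
    {U K : Set (Fin n → ℂ)} (hU : IsOpen U) (hK : IsCompact K)
    (hKU : K ⊆ U) (hg : ContinuousOn g U) (h0 : ∀ w ∈ U, w ∉ K → g w = 0) :
    IntegrableOn g U :=
  (integrable_indicator_iff hU.measurableSet).1
    ((continuous_indicator_of_compact hU hK.isClosed hKU hg h0).integrable_of_hasCompactSupport
      (hasCompactSupport_indicator hK h0))

lemma integral_fderiv_eq_zero {g : (Fin n → ℂ) → ℂ} {U K : Set (Fin n → ℂ)} (hU : IsOpen U)
    (hK : IsCompact K) (hKU : K ⊆ U) (hg : ContDiffOn ℝ ∞ g U)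
    (h0 : ∀ w ∈ U, w ∉ K → g w = 0) (v : Fin n → ℂ) :
    IntegrableOn (fun w => fderiv ℝ g w v) U ∧ ∫ w in U, fderiv ℝ g w v = 0 := by
  set G := U.indicator g
  have hG : ContDiff ℝ ∞ G := contDiff_indicator hU hK.isClosed hKU hg h0
  have hGc : HasCompactSupport G := hasCompactSupport_indicator hK h0
  have hG' : Continuous fun w => fderiv ℝ G w v :=
    (hG.continuous_fderiv (by simp)).clm_apply continuous_const
  have hGc' : HasCompactSupport fun w => fderiv ℝ G w v := hGc.fderiv_apply ℝ v
  have hGU : EqOn (fun w => fderiv ℝ G w v) (fun w => fderiv ℝ g w v) U := by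
    intro w hw
    have : G =ᶠ[𝓝 w] g := by
      filter_upwards [hU.mem_nhds hw] with z hz
      simp [G, hz]
    simp only [this.fderiv_eq]
  have hout : ∀ w ∉ U, fderiv ℝ G w v = 0 := by
    intro w hw
    have : G =ᶠ[𝓝 w] fun _ => 0 := by
      filter_upwards [hK.isClosed.isOpen_compl.mem_nhds fun h => hw (hKU h)] with z hz
      by_cases hzU : z ∈ U
      · simp [G, hzU, h0 z hzU hz]
      · simp [G, hzU]
    rw [this.fderiv_eq]; simp
  have hint : Integrable fun w => fderiv ℝ G w v := hG'.integrable_of_hasCompactSupport hGc'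
  refine ⟨hint.integrableOn.congr_fun hGU hU.measurableSet, ?_⟩
  rw [← setIntegral_congr_fun hU.measurableSet hGU, setIntegral_eq_integral_of_forall_compl_eq_zero
    fun w hw => hout w hw]
  have := integral_mul_fderiv_eq_neg_fderiv_mul_of_integrable (μ := volume)
    (f := fun _ : Fin n → ℂ => (1 : ℂ)) (g := G) (v := v) (by simp) (by simpa using hint)
    (by simpa using hG.continuous.integrable_of_hasCompactSupport hGc)
    (fun _ _ => differentiableAt_const _) (fun _ _ => (hG.differentiable (by simp)) _)
  simpa using this

lemma integral_wirt_eq_zero {g : (Fin n → ℂ) → ℂ} {U K : Set (Fin n → ℂ)} (hU : IsOpen U)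
    (hK : IsCompact K) (hKU : K ⊆ U) (hg : ContDiffOn ℝ ∞ g U)
    (h0 : ∀ w ∈ U, w ∉ K → g w = 0) (k : Fin n) :
    (IntegrableOn (wirt k g) U ∧ ∫ w in U, wirt k g w = 0) ∧
    (IntegrableOn (wirtBar k g) U ∧ ∫ w in U, wirtBar k g w = 0) := by
  obtain ⟨i1, e1⟩ := integral_fderiv_eq_zero hU hK hKU hg h0 (Pi.single k 1)
  obtain ⟨i2, e2⟩ := integral_fderiv_eq_zero hU hK hKU hg h0 (Pi.single k Complex.I)
  have i2' := i2.const_mul Complex.I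
  refine ⟨⟨(i1.sub i2').div_const 2, ?_⟩, ⟨(i1.add i2').div_const 2, ?_⟩⟩
  · simp only [wirt]
    rw [integral_div, integral_sub i1 i2', integral_const_mul, e1, e2]; simp
  · simp only [wirtBar]
    rw [integral_div, integral_add i1 i2', integral_const_mul, e1, e2]; simp

/-- Green's formula `∫ v ddᶜu ∧ C^{n-1} = ∫ u ddᶜv ∧ C^{n-1}` for a closed form `C` and a function
`v` with compact support: the two integrands differ by the divergence of
`v ∂̄u ∧ C^{n-1}` and of `u ∂v ∧ C^{n-1}`. -/
lemma integral_mul_mixedDet_cHess [NeZero n] {U K : Set (Fin n → ℂ)} (hU : IsOpen U)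
    (hK : IsCompact K) (hKU : K ⊆ U) {u v : (Fin n → ℂ) → ℝ}
    (hu : ContDiffOn ℝ ∞ u U) (hv : ContDiffOn ℝ ∞ v U) (h0 : ∀ w ∈ U, w ∉ K → v w = 0)
    {C : (Fin n → ℂ) → Matrix (Fin n) (Fin n) ℂ}
    (hC : ∀ i j, ContDiffOn ℝ ∞ (fun w => C w i j) U)
    (hcl : ∀ w ∈ U, ∀ i j k, wirt k (fun v => C v i j) w = wirt i (fun v => C v k j) w)
    (hcl' : ∀ w ∈ U, ∀ i j k, wirtBar k (fun v => C v i j) w = wirtBar j (fun v => C v i k) w) :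
    ∫ w in U, (v w : ℂ) * mixedDet (slots₁ (cHess u w) (C w)) =
      ∫ w in U, (u w : ℂ) * mixedDet (slots₁ (cHess v w) (C w)) := by
  have hu' : ContDiffOn ℝ ∞ (fun w => (u w : ℂ)) U := contDiffOn_ofReal hu
  have hv' : ContDiffOn ℝ ∞ (fun w => (v w : ℂ)) U := contDiffOn_ofReal hv
  have hcof : ∀ i j, ContDiffOn ℝ ∞ (fun w => mixedCof (C w) i j) U := by
    intro i j
    refine ContDiffOn.mixedDet fun k a b => ?_
    simp only [slots₁]
    split_ifs
    · exact contDiffOn_const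
    · exact hC a b
  have hloc : ∀ w ∈ U, w ∉ K → (fun w => (v w : ℂ)) =ᶠ[𝓝 w] fun _ => 0 := by
    intro w hw hwK
    filter_upwards [hU.mem_nhds hw, hK.isClosed.isOpen_compl.mem_nhds hwK] with z hz hzK
    simp [h0 z hz hzK]
  -- the two vector fields whose divergences are the difference of the integrands
  set P : Fin n → (Fin n → ℂ) → ℂ := fun i w =>
    (v w : ℂ) * ∑ j, wirtBar j (fun w => (u w : ℂ)) w * mixedCof (C w) i j
  set Q : Fin n → (Fin n → ℂ) → ℂ := fun j w =>
    (u w : ℂ) * ∑ i, wirt i (fun w => (v w : ℂ)) w * mixedCof (C w) i j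
  have hPs : ∀ i, ContDiffOn ℝ ∞ (P i) U := fun i =>
    hv'.mul (ContDiffOn.sum fun j _ => (contDiffOn_wirtBar hU hu' j).mul (hcof i j))
  have hQs : ∀ j, ContDiffOn ℝ ∞ (Q j) U := fun j =>
    hu'.mul (ContDiffOn.sum fun i _ => (contDiffOn_wirt hU hv' i).mul (hcof i j))
  have hP0 : ∀ i, ∀ w ∈ U, w ∉ K → P i w = 0 := fun i w hw hwK => by simp [P, h0 w hw hwK]
  have hQ0 : ∀ i, ∀ w ∈ U, w ∉ K → Q i w = 0 := by
    intro j w hw hwK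
    have : ∀ i, wirt i (fun w => (v w : ℂ)) w = 0 := fun i => by
      rw [wirt_congr (hloc w hw hwK)]; simp [wirt]
    simp [Q, this]
  have hIP := fun i => (integral_wirt_eq_zero hU hK hKU (hPs i) (hP0 i) i).1
  have hIQ := fun j => (integral_wirt_eq_zero hU hK hKU (hQs j) (hQ0 j) j).2
  have d : ∀ {h : (Fin n → ℂ) → ℂ}, ContDiffOn ℝ ∞ h U → ∀ w ∈ U, DifferentiableAt ℝ h w :=
    fun hh w hw => (hh.contDiffAt (hU.mem_nhds hw)).differentiableAt (by simp)
  have hdivP : ∀ w ∈ U, ∑ i, wirt i (P i) w =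
      (v w : ℂ) * mixedDet (slots₁ (cHess u w) (C w)) + ∑ i, ∑ j,
        wirt i (fun w => (v w : ℂ)) w * wirtBar j (fun w => (u w : ℂ)) w * mixedCof (C w) i j := by
    intro w hw
    have h1 : ∀ i, wirt i (P i) w = (∑ j, wirt i (fun w => (v w : ℂ)) w *
        wirtBar j (fun w => (u w : ℂ)) w * mixedCof (C w) i j) +
        (v w : ℂ) * ((∑ j, cHess u w i j * mixedCof (C w) i j) +
          ∑ j, wirtBar j (fun w => (u w : ℂ)) w * wirt i (fun w => mixedCof (C w) i j) w) := by
      intro i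
      have hd : ∀ j, DifferentiableAt ℝ
          (fun w => wirtBar j (fun w => (u w : ℂ)) w * mixedCof (C w) i j) w := fun j =>
        d ((contDiffOn_wirtBar hU hu' j).mul (hcof i j)) w hw
      rw [wirt_mul (d hv' w hw) (DifferentiableAt.fun_sum fun j _ => hd j),
        wirt_sum fun j _ => hd j, Finset.mul_sum, ← Finset.sum_add_distrib]
      congr 1
      · exact Finset.sum_congr rfl fun j _ => by ring
      · congr 1
        refine Finset.sum_congr rfl fun j _ => ?_
        rw [wirt_mul (d (contDiffOn_wirtBar hU hu' j) w hw) (d (hcof i j) w hw)]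
        rfl
    rw [Finset.sum_congr rfl fun i _ => h1 i, Finset.sum_add_distrib, add_comm,
      ← Finset.mul_sum, Finset.sum_add_distrib, ← mixedDet_slots₁, Finset.sum_comm (γ := Fin n)
        (f := fun i j => wirtBar j (fun w => (u w : ℂ)) w * wirt i (fun w => mixedCof (C w) i j) w)]
    have h2 : ∑ j, ∑ i, wirtBar j (fun w => (u w : ℂ)) w *
        wirt i (fun w => mixedCof (C w) i j) w = 0 := by
      refine Finset.sum_eq_zero fun j _ => ?_
      rw [← Finset.mul_sum, sum_wirt_mixedCof (fun i j => d (hC i j) w hw) (hcl w hw), mul_zero]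
    rw [h2, add_zero]
  have hdivQ : ∀ w ∈ U, ∑ j, wirtBar j (Q j) w =
      (u w : ℂ) * mixedDet (slots₁ (cHess v w) (C w)) + ∑ i, ∑ j,
        wirt i (fun w => (v w : ℂ)) w * wirtBar j (fun w => (u w : ℂ)) w * mixedCof (C w) i j := by
    intro w hw
    have h1 : ∀ j, wirtBar j (Q j) w = (∑ i, wirt i (fun w => (v w : ℂ)) w *
        wirtBar j (fun w => (u w : ℂ)) w * mixedCof (C w) i j) +
        (u w : ℂ) * ((∑ i, cHess v w i j * mixedCof (C w) i j) +
          ∑ i, wirt i (fun w => (v w : ℂ)) w * wirtBar j (fun w => mixedCof (C w) i j) w) := by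
      intro j
      have hd : ∀ i, DifferentiableAt ℝ
          (fun w => wirt i (fun w => (v w : ℂ)) w * mixedCof (C w) i j) w := fun i =>
        d ((contDiffOn_wirt hU hv' i).mul (hcof i j)) w hw
      rw [wirtBar_mul (d hu' w hw) (DifferentiableAt.fun_sum fun j _ => hd j),
        wirtBar_sum fun j _ => hd j, Finset.mul_sum, ← Finset.sum_add_distrib]
      congr 1
      · exact Finset.sum_congr rfl fun j _ => by ring
      · congr 1
        refine Finset.sum_congr rfl fun i _ => ?_
        rw [wirtBar_mul (d (contDiffOn_wirt hU hv' i) w hw) (d (hcof i j) w hw),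
          ← wirt_wirtBar_comm ((hv'.contDiffAt (hU.mem_nhds hw)).of_le two_le_infty)]
        rfl
    rw [Finset.sum_congr rfl fun i _ => h1 i, Finset.sum_add_distrib, add_comm,
      ← Finset.mul_sum, Finset.sum_add_distrib, Finset.sum_comm (γ := Fin n)
        (f := fun j i => cHess v w i j * mixedCof (C w) i j), ← mixedDet_slots₁,
      Finset.sum_comm (γ := Fin n) (f := fun j i => wirt i (fun w => (v w : ℂ)) w *
        wirtBar j (fun w => mixedCof (C w) i j) w),
      Finset.sum_comm (γ := Fin n) (f := fun j i => wirt i (fun w => (v w : ℂ)) w *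
        wirtBar j (fun w => (u w : ℂ)) w * mixedCof (C w) i j)]
    have h2 : ∑ i, ∑ j, wirt i (fun w => (v w : ℂ)) w *
        wirtBar j (fun w => mixedCof (C w) i j) w = 0 := by
      refine Finset.sum_eq_zero fun j _ => ?_
      rw [← Finset.mul_sum, sum_wirtBar_mixedCof (fun i j => d (hC i j) w hw) (hcl' w hw),
        mul_zero]
    rw [h2, add_zero]
  have hmv : ∀ {a : (Fin n → ℂ) → ℝ}, ContDiffOn ℝ ∞ a U →
      ContDiffOn ℝ ∞ (fun w => mixedDet (slots₁ (cHess a w) (C w))) U := by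
    intro a ha
    refine ContDiffOn.mixedDet fun k i j => ?_
    simp only [slots₁]
    split_ifs
    · exact contDiffOn_cHess hU ha i j
    · exact hC i j
  have hi1 : IntegrableOn (fun w => (v w : ℂ) * mixedDet (slots₁ (cHess u w) (C w))) U :=
    integrableOn_of_compact hU hK hKU (hv'.mul (hmv hu)).continuousOn
      fun w hw hwK => by simp [h0 w hw hwK]
  have hi2 : IntegrableOn (fun w => (u w : ℂ) * mixedDet (slots₁ (cHess v w) (C w))) U := by
    refine integrableOn_of_compact hU hK hKU (hu'.mul (hmv hv)).continuousOn fun w hw hwK => ?_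
    have : cHess v w = 0 := by
      ext i j
      have h1 : wirtBar j (fun v' => (v v' : ℂ)) =ᶠ[𝓝 w] fun _ => 0 := by
        filter_upwards [(hloc w hw hwK).eventuallyEq_nhds] with z hz
        rw [wirtBar_congr hz]; simp [wirtBar]
      simp only [cHess, Matrix.of_apply]
      rw [wirt_congr h1]; simp [wirt]
    rw [this, mixedDet_slots₁]; simp
  rw [← sub_eq_zero, ← integral_sub hi1 hi2]
  have heq : EqOn (fun w => (v w : ℂ) * mixedDet (slots₁ (cHess u w) (C w)) -
      (u w : ℂ) * mixedDet (slots₁ (cHess v w) (C w)))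
      (fun w => ∑ i, wirt i (P i) w - ∑ j, wirtBar j (Q j) w) U := by
    intro w hw
    simp only [hdivP w hw, hdivQ w hw]
    ring
  rw [setIntegral_congr_fun hU.measurableSet heq,
    integral_sub (integrable_finsetSum _ fun i _ => (hIP i).1)
      (integrable_finsetSum _ fun i _ => (hIQ i).1),
    integral_finsetSum _ fun i _ => (hIP i).1, integral_finsetSum _ fun i _ => (hIQ i).1]
  simp [(hIP _).2, (hIQ _).2]

end LocalGreen

/-! ### Forms and densities on a complex manifold -/

section Forms

variable {n : ℕ}

lemma cJac_comp {f g : (Fin n → ℂ) → (Fin n → ℂ)} {w : Fin n → ℂ}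
    (hf : DifferentiableAt ℂ f (g w)) (hg : DifferentiableAt ℂ g w) :
    cJac (fun v => f (g v)) w = cJac f (g w) * cJac g w := by
  have hc : fderiv ℂ (fun v => f (g v)) w = (fderiv ℂ f (g w)).comp (fderiv ℂ g w) :=
    (hf.hasFDerivAt.comp w hg.hasFDerivAt).fderiv
  have h : ∀ (h : (Fin n → ℂ) → (Fin n → ℂ)) w,
      cJac h w = LinearMap.toMatrix' (fderiv ℂ h w : (Fin n → ℂ) →ₗ[ℂ] (Fin n → ℂ)) := by
    intro h w
    ext i j
    simp [cJac, LinearMap.toMatrix'_apply]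
  rw [h, h, h, hc, ← LinearMap.toMatrix'_comp]
  rfl

lemma cJac_congr {f g : (Fin n → ℂ) → (Fin n → ℂ)} {w : Fin n → ℂ} (h : f =ᶠ[𝓝 w] g) :
    cJac f w = cJac g w := by
  simp [cJac, h.fderiv_eq]

lemma cJac_id (w : Fin n → ℂ) : cJac (fun v => v) w = 1 := by
  ext i j
  simp [cJac, Matrix.one_apply, Pi.single_apply]

/-- The real Jacobian determinant of a holomorphic map is `|det_ℂ|²`. -/
lemma abs_det_restrictScalars_fderiv (f : (Fin n → ℂ) → (Fin n → ℂ)) (w : Fin n → ℂ) :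
    |((fderiv ℂ f w).restrictScalars ℝ).det| = ‖(cJac f w).det‖ ^ 2 := by
  have h : (cJac f w).det = LinearMap.det (fderiv ℂ f w : (Fin n → ℂ) →ₗ[ℂ] (Fin n → ℂ)) := by
    rw [← LinearMap.det_toMatrix']
    congr 1
  have h2 : ((fderiv ℂ f w).restrictScalars ℝ).det =
      LinearMap.det ((fderiv ℂ f w : (Fin n → ℂ) →ₗ[ℂ] (Fin n → ℂ)).restrictScalars ℝ) := rfl
  rw [h2, LinearMap.det_restrictScalars, Algebra.norm_complex_apply, h, Complex.normSq_eq_norm_sq,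
    abs_of_nonneg (by positivity)]

lemma mixedDet_pullCoeff (f : (Fin n → ℂ) → (Fin n → ℂ)) (w : Fin n → ℂ)
    (A : Fin n → Matrix (Fin n) (Fin n) ℂ) :
    mixedDet (fun k => pullCoeff f (A k) w) = (‖(cJac f w).det‖ ^ 2 : ℝ) * mixedDet A := by
  unfold pullCoeff
  rw [mixedDet_mul_right, mixedDet_mul_left, Matrix.det_transpose]
  have : ((cJac f w).map star).det = star (cJac f w).det := by
    have := (RingHom.map_det (starRingEnd ℂ) (cJac f w)).symm
    simpa using this
  rw [this, ← mul_assoc, mul_comm (star _)]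
  congr 1
  exact_mod_cast Complex.mul_conj' _

lemma wedgeDensity_pullCoeff (f : (Fin n → ℂ) → (Fin n → ℂ)) (w : Fin n → ℂ)
    (A : Fin n → Matrix (Fin n) (Fin n) ℂ) :
    wedgeDensity (fun k => pullCoeff f (A k) w) = ‖(cJac f w).det‖ ^ 2 * wedgeDensity A := by
  unfold wedgeDensity
  rw [mixedDet_pullCoeff, Complex.re_ofReal_mul]
  ring

lemma pullCoeff_add (f : (Fin n → ℂ) → (Fin n → ℂ)) (w : Fin n → ℂ)
    (A B : Matrix (Fin n) (Fin n) ℂ) :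
    pullCoeff f (A + B) w = pullCoeff f A w + pullCoeff f B w := by
  simp [pullCoeff, mul_add, add_mul]

lemma posDef_pullCoeff_iff {f : (Fin n → ℂ) → (Fin n → ℂ)} {w : Fin n → ℂ}
    (hf : (cJac f w).det ≠ 0) (A : Matrix (Fin n) (Fin n) ℂ) :
    (pullCoeff f A w).PosDef ↔ A.PosDef := by
  have h1 : IsUnit ((cJac f w).map star) := by
    rw [Matrix.isUnit_iff_isUnit_det]
    have : ((cJac f w).map star).det = star (cJac f w).det := by
      have := (RingHom.map_det (starRingEnd ℂ) (cJac f w)).symm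
      simpa using this
    rw [this]
    simpa using hf
  have h2 : pullCoeff f A w = ((cJac f w).map star)ᴴ * A * (cJac f w).map star := by
    unfold pullCoeff
    congr 2
    ext i j
    simp
  rw [h2]
  exact Matrix.IsUnit.posDef_star_left_conjugate_iff h1

variable {X : Type*} [TopologicalSpace X] [ChartedSpace (Fin n → ℂ) X]

/-- Smoothness of a real function on `X`, read off in the charts of the atlas. -/
def SmoothFn (n : ℕ) {X : Type*} [TopologicalSpace X] [ChartedSpace (Fin n → ℂ) X]
    (u : X → ℝ) : Prop :=
  ∀ e ∈ atlas (Fin n → ℂ) X, ContDiffOn ℝ ∞ (fun v => u (e.symm v)) e.target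

/-- The coefficients `A e`, in the charts `e`, of a form of type `(1,1)` on `X`: they are compatible
with changes of charts. -/
def IsForm (A : OpenPartialHomeomorph X (Fin n → ℂ) → (Fin n → ℂ) →
    Matrix (Fin n) (Fin n) ℂ) : Prop :=
  ∀ e ∈ atlas (Fin n → ℂ) X, ∀ e' ∈ atlas (Fin n → ℂ) X, ∀ x ∈ e.source ∩ e'.source,
    A e (e x) = pullCoeff (fun v => e' (e.symm v)) (A e' (e' x)) (e x)

/-- The densities `η e`, in the charts `e`, of a form of top degree on `X`: a holomorphic change of
charts with Jacobian matrix `J` multiplies them by the real Jacobian determinant `|det J|²`. -/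
def IsDensity (η : OpenPartialHomeomorph X (Fin n → ℂ) → (Fin n → ℂ) → ℝ) : Prop :=
  ∀ e ∈ atlas (Fin n → ℂ) X, ∀ e' ∈ atlas (Fin n → ℂ) X, ∀ x ∈ e.source ∩ e'.source,
    η e (e x) = ‖(cJac (fun v => e' (e.symm v)) (e x)).det‖ ^ 2 * η e' (e' x)

lemma IsDensity.wedgeDensity {A : Fin n → OpenPartialHomeomorph X (Fin n → ℂ) → (Fin n → ℂ) →
    Matrix (Fin n) (Fin n) ℂ} (hA : ∀ k, IsForm (A k)) :
    IsDensity fun e w => _root_.wedgeDensity fun k => A k e w := by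
  intro e he e' he' x hx
  simp only
  rw [← wedgeDensity_pullCoeff]
  congr 1
  funext k
  exact hA k e he e' he' x hx

lemma IsDensity.fun_mul {η : OpenPartialHomeomorph X (Fin n → ℂ) → (Fin n → ℂ) → ℝ}
    (h : IsDensity η) (u : X → ℝ) : IsDensity fun e w => u (e.symm w) * η e w := by
  intro e he e' he' x hx
  simp only
  rw [e.left_inv hx.1, e'.left_inv hx.2, h e he e' he' x hx]
  ring

lemma IsDensity.const_mul {η : OpenPartialHomeomorph X (Fin n → ℂ) → (Fin n → ℂ) → ℝ}
    (h : IsDensity η) (c : ℝ) : IsDensity fun e w => c * η e w :=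
  h.fun_mul fun _ => c

lemma IsDensity.sub {η η' : OpenPartialHomeomorph X (Fin n → ℂ) → (Fin n → ℂ) → ℝ}
    (h : IsDensity η) (h' : IsDensity η') : IsDensity fun e w => η e w - η' e w := by
  intro e he e' he' x hx
  simp only
  rw [h e he e' he' x hx, h' e he e' he' x hx]
  ring

lemma IsForm.add {A B : OpenPartialHomeomorph X (Fin n → ℂ) → (Fin n → ℂ) →
    Matrix (Fin n) (Fin n) ℂ} (hA : IsForm A) (hB : IsForm B) :
    IsForm fun e w => A e w + B e w := by
  intro e he e' he' x hx
  simp only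
  rw [hA e he e' he' x hx, hB e he e' he' x hx, pullCoeff_add]

section Complex

variable [IsManifold 𝓘(ℂ, Fin n → ℂ) ω X]

lemma contDiffAt_transition {e e' : OpenPartialHomeomorph X (Fin n → ℂ)}
    (he : e ∈ atlas (Fin n → ℂ) X) (he' : e' ∈ atlas (Fin n → ℂ) X) {x : X}
    (hx : x ∈ e.source ∩ e'.source) :
    ContDiffAt ℂ ω (fun v => e' (e.symm v)) (e x) := by
  have h1 : ContMDiffOn 𝓘(ℂ, Fin n → ℂ) 𝓘(ℂ, Fin n → ℂ) ω (e.symm.trans e')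
      (e.symm.trans e').source :=
    contMDiffOn_of_mem_contDiffGroupoid (HasGroupoid.compatible he he')
  have h2 := contMDiffOn_iff_contDiffOn.1 h1
  have hm : e x ∈ (e.symm.trans e').source := by
    simp [e.map_source hx.1, e.left_inv hx.1, hx.2]
  exact h2.contDiffAt ((e.symm.trans e').open_source.mem_nhds hm)

lemma eventually_left_inv {e : OpenPartialHomeomorph X (Fin n → ℂ)} {x : X} (hx : x ∈ e.source)
    {e' : OpenPartialHomeomorph X (Fin n → ℂ)} (hx' : x ∈ e'.source) :
    ∀ᶠ v in 𝓝 (e x), e'.symm (e' (e.symm v)) = e.symm v := by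
  have hc : ContinuousAt e.symm (e x) := e.continuousAt_symm (e.map_source hx)
  have : ∀ᶠ v in 𝓝 (e x), e.symm v ∈ e'.source :=
    hc.eventually (by rw [e.left_inv hx]; exact e'.open_source.mem_nhds hx')
  exact this.mono fun v hv => e'.left_inv hv

lemma det_transition_ne_zero {e e' : OpenPartialHomeomorph X (Fin n → ℂ)}
    (he : e ∈ atlas (Fin n → ℂ) X) (he' : e' ∈ atlas (Fin n → ℂ) X) {x : X}
    (hx : x ∈ e.source ∩ e'.source) :
    (cJac (fun v => e' (e.symm v)) (e x)).det ≠ 0 := by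
  have h1 := (contDiffAt_transition he he' hx).differentiableAt (by simp)
  have h2 := (contDiffAt_transition he' he hx.symm).differentiableAt (by simp)
  have h3 : (fun v => e (e'.symm (e' (e.symm v)))) =ᶠ[𝓝 (e x)] fun v => v := by
    filter_upwards [eventually_left_inv hx.1 hx.2, e.open_target.mem_nhds (e.map_source hx.1)]
      with v hv hvt
    rw [hv, e.right_inv hvt]
  have h4 : DifferentiableAt ℂ (fun v => e (e'.symm v)) (e' (e.symm (e x))) := by
    rw [e.left_inv hx.1]; exact h2
  have h5 := cJac_comp (f := fun v => e (e'.symm v)) (g := fun v => e' (e.symm v)) h4 h1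
  rw [cJac_congr h3, cJac_id] at h5
  intro h0
  have := congrArg Matrix.det h5
  rw [Matrix.det_mul, h0, mul_zero, Matrix.det_one] at this
  exact one_ne_zero this

/-- A function on `X` in one chart, in terms of another chart. -/
lemma eventuallyEq_transition (u : X → ℝ) {e e' : OpenPartialHomeomorph X (Fin n → ℂ)} {x : X}
    (hx : x ∈ e.source ∩ e'.source) :
    (fun v => u (e.symm v)) =ᶠ[𝓝 (e x)] fun v => u (e'.symm (e' (e.symm v))) :=
  (eventually_left_inv hx.1 hx.2).mono fun v hv => by simp only [hv]

lemma cHess_congr {u v : (Fin n → ℂ) → ℝ} {w : Fin n → ℂ} (h : u =ᶠ[𝓝 w] v) :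
    cHess u w = cHess v w := by
  ext i j
  simp only [cHess, Matrix.of_apply]
  refine wirt_congr ?_ i
  filter_upwards [h.eventuallyEq_nhds] with z hz
  exact wirtBar_congr (hz.mono fun y hy => by simp only [hy]) j

lemma cGradSq_congr {u v : (Fin n → ℂ) → ℝ} {w : Fin n → ℂ} (h : u =ᶠ[𝓝 w] v) :
    cGradSq u w = cGradSq v w := by
  have h' : (fun v => (u v : ℂ)) =ᶠ[𝓝 w] fun z => (v z : ℂ) := h.mono fun y hy => by simp only [hy]
  ext i j
  simp only [cGradSq, Matrix.of_apply, wirt_congr h', wirtBar_congr h']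

lemma SmoothFn.contDiffAt {u : X → ℝ} (hu : SmoothFn n u)
    {e : OpenPartialHomeomorph X (Fin n → ℂ)} (he : e ∈ atlas (Fin n → ℂ) X) {w : Fin n → ℂ}
    (hw : w ∈ e.target) : ContDiffAt ℝ ∞ (fun v => u (e.symm v)) w :=
  (hu e he).contDiffAt (e.open_target.mem_nhds hw)

lemma IsForm.ddcCoeff {u : X → ℝ} (hu : SmoothFn n u) : IsForm (_root_.ddcCoeff (n := n) u) := by
  intro e he e' he' x hx
  have hu' := (hu.contDiffAt he' (e'.map_source hx.2)).of_le two_le_infty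
  have hf := (contDiffAt_transition he he' hx).of_le (m := 2) le_top
  have h3 : e' (e.symm (e x)) = e' x := by rw [e.left_inv hx.1]
  unfold _root_.ddcCoeff
  rw [cHess_congr (eventuallyEq_transition u hx),
    cHess_comp (u := fun v => u (e'.symm v)) (f := fun v => e' (e.symm v))
      (by rw [h3]; exact hu') hf, h3]

lemma IsForm.dWedgeDcCoeff {u : X → ℝ} (hu : SmoothFn n u) :
    IsForm (_root_.dWedgeDcCoeff (n := n) u) := by
  intro e he e' he' x hx
  have hu' := (hu.contDiffAt he' (e'.map_source hx.2)).of_le two_le_infty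
  have hf := (contDiffAt_transition he he' hx).of_le (m := 2) le_top
  have h3 : e' (e.symm (e x)) = e' x := by rw [e.left_inv hx.1]
  unfold _root_.dWedgeDcCoeff
  rw [cGradSq_congr (eventuallyEq_transition u hx),
    cGradSq_comp (u := fun v => u (e'.symm v)) (f := fun v => e' (e.symm v))
      (by rw [h3]; exact hu'.differentiableAt (by simp)) (hf.differentiableAt (by simp)), h3]

/-- A closed form of type `(1,1)` with smooth coefficients; `closed` and `closedBar` say that its
images under `∂` and `∂̄` vanish. -/
structure IsClosedForm (A : OpenPartialHomeomorph X (Fin n → ℂ) → (Fin n → ℂ) →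
    Matrix (Fin n) (Fin n) ℂ) : Prop where
  form : IsForm A
  smooth : ∀ e ∈ atlas (Fin n → ℂ) X, ∀ i j, ContDiffOn ℝ ∞ (fun w => A e w i j) e.target
  closed : ∀ e ∈ atlas (Fin n → ℂ) X, ∀ w ∈ e.target, ∀ i j k,
    wirt k (fun v => A e v i j) w = wirt i (fun v => A e v k j) w
  closedBar : ∀ e ∈ atlas (Fin n → ℂ) X, ∀ w ∈ e.target, ∀ i j k,
    wirtBar k (fun v => A e v i j) w = wirtBar j (fun v => A e v i k) w

/-- A Kähler form is hermitian, so that `∂̄ω = 0` is the conjugate of `∂ω = 0`. -/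
lemma KahlerForm.isClosedForm (κ : KahlerForm n X) : IsClosedForm κ.coeff where
  form := κ.compatible
  smooth := κ.smooth
  closed := κ.closed
  closedBar := by
    intro e he w hw i j k
    have h : ∀ i j, (fun v => κ.coeff e v i j) =ᶠ[𝓝 w] fun v => star (κ.coeff e v j i) := by
      intro i j
      filter_upwards [e.open_target.mem_nhds hw] with v hv
      exact ((κ.posDef e he v hv).isHermitian.apply i j).symm
    rw [wirtBar_congr (h i j), wirtBar_congr (h i k), (wirt_star k).2, (wirt_star j).2,
      κ.closed e he w hw]

lemma IsClosedForm.perturb {κ : KahlerForm n X} {u : X → ℝ} (hu : SmoothFn n u) :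
    IsClosedForm (κ.perturb u) := by
  have hd : ∀ e ∈ atlas (Fin n → ℂ) X, ∀ w ∈ e.target, ∀ i j,
      DifferentiableAt ℝ (fun v => κ.coeff e v i j) w ∧
      DifferentiableAt ℝ (fun v => _root_.ddcCoeff u e v i j) w := fun e he w hw i j =>
    ⟨((κ.smooth e he i j).contDiffAt (e.open_target.mem_nhds hw)).differentiableAt (by simp),
      ((contDiffOn_cHess e.open_target (hu e he) i j).contDiffAt
        (e.open_target.mem_nhds hw)).differentiableAt (by simp)⟩
  refine ⟨IsForm.add κ.compatible (IsForm.ddcCoeff hu), fun e he i j =>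
    (κ.smooth e he i j).add (contDiffOn_cHess e.open_target (hu e he) i j), ?_, ?_⟩
  · intro e he w hw i j k
    have h1 : ∀ k i j, wirt k (fun v => κ.perturb u e v i j) w =
        wirt k (fun v => κ.coeff e v i j) w + wirt k (fun v => _root_.ddcCoeff u e v i j) w := by
      intro k i j
      obtain ⟨d1, d2⟩ := hd e he w hw i j
      simp only [KahlerForm.perturb, Matrix.add_apply, wirt, fderiv_fun_add d1 d2,
        _root_.add_apply]
      ring
    rw [h1, h1, κ.closed e he w hw]
    congr 1
    exact (cHess_closed e.open_target (hu e he) hw i j k).1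
  · intro e he w hw i j k
    have h1 : ∀ k i j, wirtBar k (fun v => κ.perturb u e v i j) w =
        wirtBar k (fun v => κ.coeff e v i j) w +
          wirtBar k (fun v => _root_.ddcCoeff u e v i j) w := by
      intro k i j
      obtain ⟨d1, d2⟩ := hd e he w hw i j
      simp only [KahlerForm.perturb, Matrix.add_apply, wirtBar, fderiv_fun_add d1 d2,
        _root_.add_apply]
      ring
    rw [h1, h1, κ.isClosedForm.closedBar e he w hw]
    congr 1
    exact (cHess_closed e.open_target (hu e he) hw i j k).2

end Complex

end Forms

/-! ### Integration of densities -/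

section ParametricIntegrals

open MeasureTheory

/-- A continuous function is locally bounded, uniformly along a compact set. -/
lemma eventually_norm_le_of_compact {P Y F : Type*} [TopologicalSpace P] [TopologicalSpace Y]
    [NormedAddCommGroup F] {A : Set P} {K : Set Y} (hK : IsCompact K) {G : P → Y → F}
    (hG : ContinuousOn (fun q : P × Y => G q.1 q.2) (A ×ˢ K)) {p : P} (hp : p ∈ A) :
    ∃ C, ∀ᶠ q in 𝓝[A] p, ∀ y ∈ K, ‖G q y‖ ≤ C := by
  have h0 : ContinuousOn (fun y => G p y) K :=
    hG.comp (f := fun y => (p, y)) (by fun_prop) fun y hy => ⟨hp, hy⟩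
  obtain ⟨C, hC⟩ := hK.exists_bound_of_continuousOn h0
  refine ⟨C + 1, ?_⟩
  have h1 : ∀ᶠ q in 𝓝 p, ∀ y ∈ K, q ∈ A → y ∈ K → ‖G q y‖ ≤ C + 1 := by
    refine hK.eventually_forall_of_forall_eventually fun y hy => ?_
    have h2 : ContinuousWithinAt (fun q : P × Y => ‖G q.1 q.2‖) (A ×ˢ K) (p, y) :=
      (hG (p, y) ⟨hp, hy⟩).norm
    have h3 : ∀ᶠ q in 𝓝[A ×ˢ K] (p, y), ‖G q.1 q.2‖ < C + 1 :=
      h2.eventually (eventually_lt_nhds (by have := hC y hy; simp only; linarith))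
    rw [eventually_nhdsWithin_iff] at h3
    filter_upwards [h3] with q hq h4 h5 using (hq ⟨h4, h5⟩).le
  rw [eventually_nhdsWithin_iff]
  filter_upwards [h1] with q hq hqA y hy using hq y hy hqA hy

lemma continuousOn_integral_compact {P Y : Type*} [TopologicalSpace P] [FirstCountableTopology P]
    [TopologicalSpace Y] [T2Space Y] [MeasurableSpace Y] [OpensMeasurableSpace Y]
    {μ : Measure Y} [IsFiniteMeasureOnCompacts μ] {A : Set P} {K : Set Y} (hK : IsCompact K)
    {G : P → Y → ℝ} (hG : ContinuousOn (fun q : P × Y => G q.1 q.2) (A ×ˢ K)) :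
    ContinuousOn (fun p => ∫ y in K, G p y ∂μ) A := by
  intro p hp
  obtain ⟨C, hC⟩ := eventually_norm_le_of_compact hK hG hp
  have hfin : IsFiniteMeasure (μ.restrict K) := ⟨by simpa using hK.measure_lt_top⟩
  refine continuousWithinAt_of_dominated (bound := fun _ => C) ?_ ?_ (integrable_const C) ?_
  · filter_upwards [self_mem_nhdsWithin] with q hq
    have : ContinuousOn (fun y => G q y) K :=
      hG.comp (f := fun y => (q, y)) (by fun_prop) fun y hy => ⟨hq, hy⟩
    exact this.aestronglyMeasurable_of_isCompact hK hK.measurableSet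
  · filter_upwards [hC] with q hq
    exact (ae_restrict_iff' hK.measurableSet).2 (Filter.Eventually.of_forall fun y hy => hq y hy)
  · refine (ae_restrict_iff' hK.measurableSet).2 (Filter.Eventually.of_forall fun y hy => ?_)
    exact (hG (p, y) ⟨hp, hy⟩).comp (f := fun q => (q, y)) (by fun_prop) fun q hq => ⟨hq, hy⟩

lemma hasDerivAt_integral_compact {Y : Type*}
    [TopologicalSpace Y] [T2Space Y] [MeasurableSpace Y] [OpensMeasurableSpace Y]
    {μ : Measure Y} [IsFiniteMeasureOnCompacts μ] {a b : ℝ} {K : Set Y} (hK : IsCompact K)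
    {G G' : ℝ → Y → ℝ} (hG : ContinuousOn (fun q : ℝ × Y => G q.1 q.2) (Ioo a b ×ˢ K))
    (hG' : ContinuousOn (fun q : ℝ × Y => G' q.1 q.2) (Ioo a b ×ˢ K))
    (hd : ∀ r ∈ Ioo a b, ∀ y ∈ K, HasDerivAt (fun r => G r y) (G' r y) r)
    {r : ℝ} (hr : r ∈ Ioo a b) :
    HasDerivAt (fun r => ∫ y in K, G r y ∂μ) (∫ y in K, G' r y ∂μ) r := by
  obtain ⟨C, hC⟩ := eventually_norm_le_of_compact hK hG' hr
  rw [isOpen_Ioo.nhdsWithin_eq hr] at hC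
  have hfin : IsFiniteMeasure (μ.restrict K) := ⟨by simpa using hK.measure_lt_top⟩
  have hm : ∀ {H : ℝ → Y → ℝ}, ContinuousOn (fun q : ℝ × Y => H q.1 q.2) (Ioo a b ×ˢ K) →
      ∀ q ∈ Ioo a b, ContinuousOn (fun y => H q y) K := fun hH q hq =>
    hH.comp (f := fun y => (q, y)) (by fun_prop) fun y hy => ⟨hq, hy⟩
  refine (hasDerivAt_integral_of_dominated_loc_of_deriv_le (bound := fun _ => C)
    (hC.and (isOpen_Ioo.mem_nhds hr)) ?_ ?_ ?_ ?_ (integrable_const C) ?_).2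
  · filter_upwards [isOpen_Ioo.mem_nhds hr] with q hq
    exact (hm hG q hq).aestronglyMeasurable_of_isCompact hK hK.measurableSet
  · exact (hm hG r hr).integrableOn_compact hK
  · exact (hm hG' r hr).aestronglyMeasurable_of_isCompact hK hK.measurableSet
  · exact (ae_restrict_iff' hK.measurableSet).2
      (Filter.Eventually.of_forall fun y hy q hq => hq.1 y hy)
  · exact (ae_restrict_iff' hK.measurableSet).2
      (Filter.Eventually.of_forall fun y hy q hq => hd q hq.2 y hy)

end ParametricIntegrals

section IntegralTop

open MeasureTheory

variable {n : ℕ} {X : Type*} [TopologicalSpace X] [ChartedSpace (Fin n → ℂ) X]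
  [CompactSpace X] [T2Space X]

variable (n X) in
/-- The partition of unity used in the definition of `integralTop`. -/
def chartPartition : PartitionOfUnity X X univ := (exists_chartPartition n X).choose

lemma chartPartition_subordinate :
    (chartPartition n X).IsSubordinate fun p => (chartAt (Fin n → ℂ) p).source :=
  (exists_chartPartition n X).choose_spec

lemma chartPartition_finite : {p | (Function.support (chartPartition n X p)).Nonempty}.Finite :=
  (chartPartition n X).locallyFinite.finite_nonempty_of_compact

variable (n X) in
/-- The finitely many indices whose functions in the partition of unity are not zero. -/
def chartIndices : Finset X := (chartPartition_finite (n := n) (X := X)).toFinset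

lemma chartPartition_eq_zero {p : X} (hp : p ∉ chartIndices n X) (x : X) :
    chartPartition n X p x = 0 := by
  by_contra h
  exact hp ((Set.Finite.mem_toFinset _).2 ⟨x, h⟩)

lemma sum_chartPartition (x : X) : ∑ p ∈ chartIndices n X, chartPartition n X p x = 1 := by
  rw [← (chartPartition n X).sum_eq_one (mem_univ x)]
  refine (finsum_eq_sum_of_support_subset _ fun p hp => ?_).symm
  by_contra h
  exact hp (chartPartition_eq_zero h x)

variable (n) in
/-- The compact support of a function of the partition of unity, in its chart. -/
def chartSupport (p : X) : Set (Fin n → ℂ) :=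
  chartAt (Fin n → ℂ) p '' tsupport (chartPartition n X p)

lemma isCompact_chartSupport (p : X) : IsCompact (chartSupport n p) :=
  ((isClosed_tsupport _).isCompact).image_of_continuousOn
    ((chartAt (Fin n → ℂ) p).continuousOn.mono (chartPartition_subordinate p))

lemma chartSupport_subset (p : X) : chartSupport n p ⊆ (chartAt (Fin n → ℂ) p).target := by
  rintro _ ⟨x, hx, rfl⟩
  exact (chartAt (Fin n → ℂ) p).map_source (chartPartition_subordinate p hx)

lemma chartPartition_symm_eq_zero {p : X} {w : Fin n → ℂ}
    (hw : w ∈ (chartAt (Fin n → ℂ) p).target) (h : w ∉ chartSupport n p) :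
    chartPartition n X p ((chartAt (Fin n → ℂ) p).symm w) = 0 := by
  by_contra h0
  exact h ⟨_, subset_tsupport _ h0, (chartAt (Fin n → ℂ) p).right_inv hw⟩

lemma continuousOn_chartPartition_symm (p : X) (e : OpenPartialHomeomorph X (Fin n → ℂ)) :
    ContinuousOn (fun w => chartPartition n X p (e.symm w)) e.target :=
  (chartPartition n X p).continuous.comp_continuousOn e.continuousOn_symm

lemma integralTop_eq_sum (η : OpenPartialHomeomorph X (Fin n → ℂ) → (Fin n → ℂ) → ℝ) :
    integralTop (X := X) η = ∑ p ∈ chartIndices n X, ∫ w in chartSupport n p,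
      chartPartition n X p ((chartAt (Fin n → ℂ) p).symm w) * η (chartAt (Fin n → ℂ) p) w := by
  have h1 : integralTop (X := X) η = ∑ᶠ p : X, ∫ w in (chartAt (Fin n → ℂ) p).target,
    chartPartition n X p ((chartAt (Fin n → ℂ) p).symm w) * η (chartAt (Fin n → ℂ) p) w := rfl
  rw [h1, finsum_eq_sum_of_support_subset (s := chartIndices n X)]
  · refine Finset.sum_congr rfl fun p _ => ?_
    refine setIntegral_eq_of_subset_of_forall_sdiff_eq_zero
      (chartAt (Fin n → ℂ) p).open_target.measurableSet (chartSupport_subset p) fun w hw => ?_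
    rw [chartPartition_symm_eq_zero hw.1 hw.2, zero_mul]
  · intro p hp
    by_contra h
    exact hp (by simp [chartPartition_eq_zero h])

/-- Continuity of the densities in the charts. -/
def IsContDensity (η : OpenPartialHomeomorph X (Fin n → ℂ) → (Fin n → ℂ) → ℝ) : Prop :=
  ∀ e ∈ atlas (Fin n → ℂ) X, ContinuousOn (η e) e.target

lemma IsContDensity.integrableOn {η : OpenPartialHomeomorph X (Fin n → ℂ) → (Fin n → ℂ) → ℝ}
    (h : IsContDensity η) (p : X) : IntegrableOn (fun w =>
      chartPartition n X p ((chartAt (Fin n → ℂ) p).symm w) * η (chartAt (Fin n → ℂ) p) w)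
      (chartSupport n p) :=
  (((continuousOn_chartPartition_symm p _).mul (h _ (chart_mem_atlas _ p))).mono
    (chartSupport_subset p)).integrableOn_compact (isCompact_chartSupport p)

lemma integralTop_add {η η' : OpenPartialHomeomorph X (Fin n → ℂ) → (Fin n → ℂ) → ℝ}
    (h : IsContDensity η) (h' : IsContDensity η') :
    integralTop (X := X) (fun e w => η e w + η' e w) =
      integralTop (X := X) η + integralTop (X := X) η' := by
  simp only [integralTop_eq_sum, ← Finset.sum_add_distrib]
  refine Finset.sum_congr rfl fun p _ => ?_
  rw [← integral_add (h.integrableOn p) (h'.integrableOn p)]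
  simp only [mul_add]

lemma integralTop_const_mul (c : ℝ)
    (η : OpenPartialHomeomorph X (Fin n → ℂ) → (Fin n → ℂ) → ℝ) :
    integralTop (X := X) (fun e w => c * η e w) = c * integralTop (X := X) η := by
  simp only [integralTop_eq_sum, Finset.mul_sum, ← integral_const_mul]
  refine Finset.sum_congr rfl fun p _ => ?_
  congr 1
  funext w
  ring

lemma integralTop_congr {η η' : OpenPartialHomeomorph X (Fin n → ℂ) → (Fin n → ℂ) → ℝ}
    (h : ∀ e ∈ atlas (Fin n → ℂ) X, ∀ w ∈ e.target, η e w = η' e w) :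
    integralTop (X := X) η = integralTop (X := X) η' := by
  simp only [integralTop_eq_sum]
  refine Finset.sum_congr rfl fun p _ => ?_
  refine setIntegral_congr_fun (isCompact_chartSupport p).measurableSet fun w hw => ?_
  simp only [h _ (chart_mem_atlas _ p) w (chartSupport_subset p hw)]

lemma integralTop_sum {ι : Type*} (s : Finset ι)
    {η : ι → OpenPartialHomeomorph X (Fin n → ℂ) → (Fin n → ℂ) → ℝ}
    (h : ∀ i, IsContDensity (η i)) :
    integralTop (X := X) (fun e w => ∑ i ∈ s, η i e w) =
      ∑ i ∈ s, integralTop (X := X) (η i) := by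
  simp only [integralTop_eq_sum]
  rw [Finset.sum_comm]
  refine Finset.sum_congr rfl fun p _ => ?_
  rw [← integral_finsetSum _ fun i _ => (h i).integrableOn p]
  simp only [Finset.mul_sum]

lemma integralTop_nonneg {η : OpenPartialHomeomorph X (Fin n → ℂ) → (Fin n → ℂ) → ℝ}
    (h0 : ∀ e ∈ atlas (Fin n → ℂ) X, ∀ w ∈ e.target, 0 ≤ η e w) :
    0 ≤ integralTop (X := X) η := by
  rw [integralTop_eq_sum]
  exact Finset.sum_nonneg fun p _ => setIntegral_nonneg (isCompact_chartSupport p).measurableSet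
    fun w hw => mul_nonneg ((chartPartition n X).nonneg p _)
      (h0 _ (chart_mem_atlas _ p) w (chartSupport_subset p hw))

/-- A nonnegative continuous density which is positive at some point has a positive integral. -/
lemma integralTop_pos {η : OpenPartialHomeomorph X (Fin n → ℂ) → (Fin n → ℂ) → ℝ}
    (h : IsContDensity η) (h0 : ∀ e ∈ atlas (Fin n → ℂ) X, ∀ w ∈ e.target, 0 ≤ η e w)
    (x : X) (hx : ∀ e ∈ atlas (Fin n → ℂ) X, x ∈ e.source → 0 < η e (e x)) :
    0 < integralTop (X := X) η := by
  have hnn : ∀ p, ∀ w ∈ (chartAt (Fin n → ℂ) p).target,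
      0 ≤ chartPartition n X p ((chartAt (Fin n → ℂ) p).symm w) * η (chartAt (Fin n → ℂ) p) w :=
    fun p w hw => mul_nonneg ((chartPartition n X).nonneg p _)
      (h0 _ (chart_mem_atlas _ p) w hw)
  obtain ⟨p, hp, hpx⟩ : ∃ p ∈ chartIndices n X, 0 < chartPartition n X p x := by
    by_contra! hcon
    have := sum_chartPartition (n := n) x
    have h2 : ∑ p ∈ chartIndices n X, chartPartition n X p x ≤ 0 := Finset.sum_nonpos hcon
    linarith
  have hxs : x ∈ (chartAt (Fin n → ℂ) p).source :=
    chartPartition_subordinate p (subset_tsupport _ hpx.ne')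
  rw [integralTop_eq_sum]
  refine Finset.sum_pos' (fun p _ => setIntegral_nonneg (isCompact_chartSupport p).measurableSet
    fun w hw => hnn p w (chartSupport_subset p hw)) ⟨p, hp, ?_⟩
  set e := chartAt (Fin n → ℂ) p
  set g := fun w => chartPartition n X p (e.symm w) * η e w
  have hgc : ContinuousOn g e.target :=
    (continuousOn_chartPartition_symm p _).mul (h _ (chart_mem_atlas _ p))
  have hex : e x ∈ e.target := e.map_source hxs
  have hgx : 0 < g (e x) := by
    simp only [g, e.left_inv hxs]
    exact mul_pos hpx (hx _ (chart_mem_atlas _ p) hxs)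
  have hind : Continuous (e.target.indicator g) :=
    continuous_indicator_of_compact e.open_target (isCompact_chartSupport p).isClosed
      (chartSupport_subset p) hgc fun w hw hw' => by
        simp only [g]; rw [chartPartition_symm_eq_zero hw hw', zero_mul]
  have heq : ∫ w in chartSupport n p, g w = ∫ w, e.target.indicator g w := by
    rw [integral_indicator e.open_target.measurableSet]
    refine (setIntegral_eq_of_subset_of_forall_sdiff_eq_zero e.open_target.measurableSet
      (chartSupport_subset p) fun w hw => ?_).symm
    simp only [g]; rw [chartPartition_symm_eq_zero hw.1 hw.2, zero_mul]
  rw [heq]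
  refine hind.integral_pos_of_hasCompactSupport_nonneg_nonzero
    (hasCompactSupport_indicator (isCompact_chartSupport p) fun w hw hw' => by
      simp only [g]; rw [chartPartition_symm_eq_zero hw hw', zero_mul])
    (fun w => ?_) (x := e x) ?_
  · by_cases hw : w ∈ e.target
    · simp only [hw, indicator_of_mem]; exact hnn p w hw
    · simp [hw]
  · simp only [hex, indicator_of_mem]; exact hgx.ne'

lemma continuousOn_integralTop {P : Type*} [TopologicalSpace P] [FirstCountableTopology P]
    {A : Set P} {η : P → OpenPartialHomeomorph X (Fin n → ℂ) → (Fin n → ℂ) → ℝ}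
    (h : ∀ e ∈ atlas (Fin n → ℂ) X,
      ContinuousOn (fun q : P × (Fin n → ℂ) => η q.1 e q.2) (A ×ˢ e.target)) :
    ContinuousOn (fun p => integralTop (X := X) (η p)) A := by
  simp only [integralTop_eq_sum]
  refine continuousOn_finsetSum _ fun p _ => ?_
  refine continuousOn_integral_compact (isCompact_chartSupport p) ?_
  refine ContinuousOn.mul ?_ ((h _ (chart_mem_atlas _ p)).mono
    (prod_mono_right (chartSupport_subset p)))
  exact (continuousOn_chartPartition_symm p _).comp continuous_snd.continuousOn
    fun q hq => chartSupport_subset p hq.2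

lemma hasDerivAt_integralTop {a b : ℝ}
    {η η' : ℝ → OpenPartialHomeomorph X (Fin n → ℂ) → (Fin n → ℂ) → ℝ}
    (h : ∀ e ∈ atlas (Fin n → ℂ) X,
      ContinuousOn (fun q : ℝ × (Fin n → ℂ) => η q.1 e q.2) (Ioo a b ×ˢ e.target))
    (h' : ∀ e ∈ atlas (Fin n → ℂ) X,
      ContinuousOn (fun q : ℝ × (Fin n → ℂ) => η' q.1 e q.2) (Ioo a b ×ˢ e.target))
    (hd : ∀ e ∈ atlas (Fin n → ℂ) X, ∀ r ∈ Ioo a b, ∀ w ∈ e.target,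
      HasDerivAt (fun r => η r e w) (η' r e w) r) {r : ℝ} (hr : r ∈ Ioo a b) :
    HasDerivAt (fun r => integralTop (X := X) (η r)) (integralTop (X := X) (η' r)) r := by
  simp only [integralTop_eq_sum]
  refine HasDerivAt.fun_sum fun p _ => ?_
  have hρ : ContinuousOn (fun q : ℝ × (Fin n → ℂ) =>
      chartPartition n X p ((chartAt (Fin n → ℂ) p).symm q.2)) (Ioo a b ×ˢ chartSupport n p) :=
    (continuousOn_chartPartition_symm p _).comp continuous_snd.continuousOn
      fun q hq => chartSupport_subset p hq.2
  refine hasDerivAt_integral_compact (isCompact_chartSupport p)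
    (hρ.mul ((h _ (chart_mem_atlas _ p)).mono (prod_mono_right (chartSupport_subset p))))
    (hρ.mul ((h' _ (chart_mem_atlas _ p)).mono (prod_mono_right (chartSupport_subset p))))
    (fun r hr w hw => (hd _ (chart_mem_atlas _ p) r hr w (chartSupport_subset p hw)).const_mul _)
    hr

section Localization

variable [IsManifold 𝓘(ℂ, Fin n → ℂ) ω X]

lemma setIntegral_transition {e e' : OpenPartialHomeomorph X (Fin n → ℂ)}
    (he : e ∈ atlas (Fin n → ℂ) X) (he' : e' ∈ atlas (Fin n → ℂ) X)
    {η : OpenPartialHomeomorph X (Fin n → ℂ) → (Fin n → ℂ) → ℝ} (hη : IsDensity η) :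
    ∫ w in (e'.symm.trans e).source, η e' w = ∫ w in (e.symm.trans e').source, η e w := by
  set s := (e.symm.trans e').source
  have hs : ∀ w ∈ s, w ∈ e.target ∧ e.symm w ∈ e'.source := fun w hw => by
    simpa [s] using hw
  have himg : (fun v => e' (e.symm v)) '' s = (e'.symm.trans e).source := by
    ext z
    constructor
    · rintro ⟨w, hw, rfl⟩
      obtain ⟨h1, h2⟩ := hs w hw
      simp [e'.left_inv h2, e'.map_source h2, e.map_target h1]
    · intro hz
      have hz' : z ∈ e'.target ∧ e'.symm z ∈ e.source := by simpa using hz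
      refine ⟨e (e'.symm z), ?_, ?_⟩
      · simp [s, e.map_source hz'.2, e.left_inv hz'.2, e'.map_target hz'.1]
      · simp [e.left_inv hz'.2, e'.right_inv hz'.1]
  have hinj : InjOn (fun v => e' (e.symm v)) s := by
    intro v hv w hw hvw
    obtain ⟨h1, h2⟩ := hs v hv
    obtain ⟨h3, h4⟩ := hs w hw
    have := e'.injOn h2 h4 hvw
    exact e.symm.injOn h1 h3 this
  have hder : ∀ w ∈ s, HasFDerivWithinAt (fun v => e' (e.symm v))
      ((fderiv ℂ (fun v => e' (e.symm v)) w).restrictScalars ℝ) s w := by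
    intro w hw
    obtain ⟨h1, h2⟩ := hs w hw
    have h3 := contDiffAt_transition he he' ⟨e.map_target h1, h2⟩
    rw [e.right_inv h1] at h3
    exact ((h3.differentiableAt (by simp)).hasFDerivAt.restrictScalars ℝ).hasFDerivWithinAt
  rw [← himg, integral_image_eq_integral_abs_det_fderiv_smul volume
    (e.symm.trans e').open_source.measurableSet hder hinj]
  refine setIntegral_congr_fun (e.symm.trans e').open_source.measurableSet fun w hw => ?_
  obtain ⟨h1, h2⟩ := hs w hw
  have := hη e he e' he' (e.symm w) ⟨e.map_target h1, h2⟩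
  rw [e.right_inv h1] at this
  simp only [this, abs_det_restrictScalars_fderiv, smul_eq_mul]

/-- The integral of a density supported in a chart is computed in this chart. -/
lemma integralTop_eq_setIntegral {e : OpenPartialHomeomorph X (Fin n → ℂ)}
    (he : e ∈ atlas (Fin n → ℂ) X) {K : Set X} (hK : IsCompact K) (hKe : K ⊆ e.source)
    {η : OpenPartialHomeomorph X (Fin n → ℂ) → (Fin n → ℂ) → ℝ} (hη : IsDensity η)
    (hc : IsContDensity η)
    (h0 : ∀ e' ∈ atlas (Fin n → ℂ) X, ∀ w ∈ e'.target, e'.symm w ∉ K → η e' w = 0) :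
    integralTop (X := X) η = ∫ w in e.target, η e w := by
  have hloc : ∀ p : X, ∫ w in chartSupport n p,
      chartPartition n X p ((chartAt (Fin n → ℂ) p).symm w) * η (chartAt (Fin n → ℂ) p) w =
      ∫ w in e.target, chartPartition n X p (e.symm w) * η e w := by
    intro p
    set e' := chartAt (Fin n → ℂ) p
    have he' : e' ∈ atlas (Fin n → ℂ) X := chart_mem_atlas _ p
    have hd : IsDensity fun e w => chartPartition n X p (e.symm w) * η e w := hη.fun_mul _
    have h1 : ∫ w in chartSupport n p, chartPartition n X p (e'.symm w) * η e' w =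
        ∫ w in e'.target, chartPartition n X p (e'.symm w) * η e' w := by
      refine (setIntegral_eq_of_subset_of_forall_sdiff_eq_zero e'.open_target.measurableSet
        (chartSupport_subset p) fun w hw => ?_).symm
      rw [chartPartition_symm_eq_zero hw.1 hw.2, zero_mul]
    have h2 : ∫ w in e'.target, chartPartition n X p (e'.symm w) * η e' w =
        ∫ w in (e'.symm.trans e).source, chartPartition n X p (e'.symm w) * η e' w := by
      refine setIntegral_eq_of_subset_of_forall_sdiff_eq_zero e'.open_target.measurableSet
        (fun w hw => ?_) fun w hw => ?_
      · exact (by simpa using hw : w ∈ e'.target ∧ _).1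
      · rw [h0 e' he' w hw.1 fun hwK => hw.2 (by simpa using ⟨hw.1, hKe hwK⟩), mul_zero]
    have h3 : ∫ w in e.target, chartPartition n X p (e.symm w) * η e w =
        ∫ w in (e.symm.trans e').source, chartPartition n X p (e.symm w) * η e w := by
      refine setIntegral_eq_of_subset_of_forall_sdiff_eq_zero e.open_target.measurableSet
        (fun w hw => ?_) fun w hw => ?_
      · exact (by simpa using hw : w ∈ e.target ∧ _).1
      · have : chartPartition n X p (e.symm w) = 0 := by
          by_contra h
          exact hw.2 (by simpa using ⟨hw.1, chartPartition_subordinate p (subset_tsupport _ h)⟩)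
        rw [this, zero_mul]
    rw [h1, h2, h3]
    exact setIntegral_transition he he' hd
  have hKc : IsCompact (e '' K) := hK.image_of_continuousOn (e.continuousOn.mono hKe)
  have hKt : e '' K ⊆ e.target := by
    rintro _ ⟨x, hx, rfl⟩; exact e.map_source (hKe hx)
  have hz : ∀ w ∈ e.target, w ∉ e '' K → η e w = 0 := fun w hw hwK =>
    h0 e he w hw fun h => hwK ⟨_, h, e.right_inv hw⟩
  rw [integralTop_eq_sum, Finset.sum_congr rfl fun p _ => hloc p, ← integral_finsetSum]
  · refine setIntegral_congr_fun e.open_target.measurableSet fun w _ => ?_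
    simp only [← Finset.sum_mul, sum_chartPartition, one_mul]
  · intro p _
    exact integrableOn_of_compact e.open_target hKc hKt
      ((continuousOn_chartPartition_symm p e).mul (hc e he)) fun w hw hwK => by
        rw [hz w hw hwK, mul_zero]

end Localization

end IntegralTop

/-! ### Green's formula on a compact complex manifold -/

section GlobalGreen

open MeasureTheory

lemma ContDiffOn.wedgeDensity {E : Type*} [NormedAddCommGroup E] [NormedSpace ℝ E] {S : Set E}
    {n : ℕ} {m : WithTop ℕ∞} {A : E → Fin n → Matrix (Fin n) (Fin n) ℂ}
    (h : ∀ k i j, ContDiffOn ℝ m (fun p => A p k i j) S) :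
    ContDiffOn ℝ m (fun p => _root_.wedgeDensity (A p)) S :=
  contDiffOn_const.mul (Complex.reCLM.contDiff.comp_contDiffOn (ContDiffOn.mixedDet h))

lemma ContDiffOn.wedgeDensity_slots₁ {E : Type*} [NormedAddCommGroup E] [NormedSpace ℝ E]
    {S : Set E} {n : ℕ} {m : WithTop ℕ∞} {A C : E → Matrix (Fin n) (Fin n) ℂ}
    (hA : ∀ i j, ContDiffOn ℝ m (fun p => A p i j) S)
    (hC : ∀ i j, ContDiffOn ℝ m (fun p => C p i j) S) :
    ContDiffOn ℝ m (fun p => _root_.wedgeDensity (slots₁ (A p) (C p))) S := by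
  refine ContDiffOn.wedgeDensity fun k i j => ?_
  simp only [slots₁]
  split_ifs
  exacts [hA i j, hC i j]

lemma ContDiffOn.wedgeDensity_slots₂ {E : Type*} [NormedAddCommGroup E] [NormedSpace ℝ E]
    {S : Set E} {n : ℕ} {m : WithTop ℕ∞} {A B C : E → Matrix (Fin n) (Fin n) ℂ}
    (hA : ∀ i j, ContDiffOn ℝ m (fun p => A p i j) S)
    (hB : ∀ i j, ContDiffOn ℝ m (fun p => B p i j) S)
    (hC : ∀ i j, ContDiffOn ℝ m (fun p => C p i j) S) :
    ContDiffOn ℝ m (fun p => _root_.wedgeDensity (slots₂ (A p) (B p) (C p))) S := by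
  refine ContDiffOn.wedgeDensity fun k i j => ?_
  simp only [slots₂]
  split_ifs
  exacts [hA i j, hB i j, hC i j]

variable {n : ℕ} {X : Type*} [TopologicalSpace X] [ChartedSpace (Fin n → ℂ) X]

lemma IsDensity.wedgeDensity_slots₁ {A C : OpenPartialHomeomorph X (Fin n → ℂ) → (Fin n → ℂ) →
    Matrix (Fin n) (Fin n) ℂ} (hA : IsForm A) (hC : IsForm C) :
    IsDensity fun e w => _root_.wedgeDensity (slots₁ (A e w) (C e w)) := by
  have h := IsDensity.wedgeDensity (A := slots₁ A C) fun k => by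
    simp only [slots₁]; split_ifs; exacts [hA, hC]
  convert h using 4
  funext k
  exact (slots₁_map (fun A : OpenPartialHomeomorph X (Fin n → ℂ) → (Fin n → ℂ) →
    Matrix (Fin n) (Fin n) ℂ => A _ _) A C k).symm

lemma IsDensity.wedgeDensity_slots₂ {A B C : OpenPartialHomeomorph X (Fin n → ℂ) →
    (Fin n → ℂ) → Matrix (Fin n) (Fin n) ℂ} (hA : IsForm A) (hB : IsForm B) (hC : IsForm C) :
    IsDensity fun e w => _root_.wedgeDensity (slots₂ (A e w) (B e w) (C e w)) := by
  have h := IsDensity.wedgeDensity (A := slots₂ A B C) fun k => by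
    simp only [slots₂]; split_ifs; exacts [hA, hB, hC]
  convert h using 4
  funext k
  exact (slots₂_map (fun A : OpenPartialHomeomorph X (Fin n → ℂ) → (Fin n → ℂ) →
    Matrix (Fin n) (Fin n) ℂ => A _ _) A B C k).symm

lemma mixedDet_slots₁_sum [NeZero n] {ι : Type*} (s : Finset ι)
    (B : ι → Matrix (Fin n) (Fin n) ℂ) (C : Matrix (Fin n) (Fin n) ℂ) :
    mixedDet (slots₁ (∑ p ∈ s, B p) C) = ∑ p ∈ s, mixedDet (slots₁ (B p) C) := by
  simp only [mixedDet_slots₁, Matrix.sum_apply, Finset.sum_mul]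
  exact (Finset.sum_congr rfl fun _ _ => Finset.sum_comm).trans Finset.sum_comm

lemma cHess_sum {ι : Type*} (s : Finset ι) {f : ι → (Fin n → ℂ) → ℝ} {w : Fin n → ℂ}
    (hf : ∀ i ∈ s, ContDiffAt ℝ 2 (f i) w) :
    cHess (fun v => ∑ i ∈ s, f i v) w = ∑ i ∈ s, cHess (f i) w := by
  ext a b
  have h1 : wirtBar b (fun v => ((∑ i ∈ s, f i v : ℝ) : ℂ)) =ᶠ[𝓝 w]
      fun v => ∑ i ∈ s, wirtBar b (fun v => (f i v : ℂ)) v := by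
    have : ∀ᶠ v in 𝓝 w, ∀ i ∈ s, ContDiffAt ℝ 2 (f i) v :=
      (Filter.eventually_all_finset s).2 fun i hi => (hf i hi).eventually (by simp)
    filter_upwards [this] with v hv
    simp only [Complex.ofReal_sum]
    exact wirtBar_sum (fun i hi =>
      (contDiffAt_ofReal (hv i hi)).differentiableAt (by norm_num)) b
  simp only [cHess, Matrix.of_apply, Matrix.sum_apply]
  rw [wirt_congr h1, wirt_sum fun i hi => differentiableAt_wirtBar (contDiffAt_ofReal (hf i hi)) b]

variable [IsManifold 𝓘(ℂ, Fin n → ℂ) ω X]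

variable (n X) in
lemma isManifold_real : IsManifold 𝓘(ℝ, Fin n → ℂ) ∞ X := by
  refine isManifold_of_contDiffOn _ _ _ fun e e' he he' => ?_
  have h1 : ContMDiffOn 𝓘(ℂ, Fin n → ℂ) 𝓘(ℂ, Fin n → ℂ) ω (e.symm.trans e')
      (e.symm.trans e').source :=
    contMDiffOn_of_mem_contDiffGroupoid (HasGroupoid.compatible he he')
  have h2 := ((contMDiffOn_iff_contDiffOn.1 h1).restrict_scalars ℝ).of_le (m := ∞) le_top
  simpa using h2

lemma smoothFn_of_contMDiff {u : X → ℝ} (hu : ContMDiff 𝓘(ℝ, Fin n → ℂ) 𝓘(ℝ, ℝ) ∞ u) :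
    SmoothFn n u := by
  have := isManifold_real n X
  intro e he
  have h1 := contMDiffOn_symm_of_mem_maximalAtlas (I := 𝓘(ℝ, Fin n → ℂ)) (n := ∞)
    (IsManifold.subset_maximalAtlas he)
  exact contMDiffOn_iff_contDiffOn.1 (hu.comp_contMDiffOn h1)

lemma SmoothFn.contMDiff {u : X → ℝ} (hu : SmoothFn n u) :
    ContMDiff 𝓘(ℝ, Fin n → ℂ) 𝓘(ℝ, ℝ) ∞ u := by
  have := isManifold_real n X
  intro x
  set e := chartAt (Fin n → ℂ) x
  have he : e ∈ atlas (Fin n → ℂ) X := chart_mem_atlas _ x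
  have h1 : ContMDiffAt 𝓘(ℝ, Fin n → ℂ) 𝓘(ℝ, Fin n → ℂ) ∞ e x :=
    contMDiffAt_of_mem_maximalAtlas (IsManifold.subset_maximalAtlas he) (mem_chart_source _ x)
  have h2 : ContMDiffAt 𝓘(ℝ, Fin n → ℂ) 𝓘(ℝ, ℝ) ∞ (fun v => u (e.symm v)) (e x) :=
    (hu.contDiffAt he (e.map_source (mem_chart_source _ x))).contMDiffAt
  refine (h2.comp x h1).congr_of_eventuallyEq ?_
  filter_upwards [e.open_source.mem_nhds (mem_chart_source _ x)] with y hy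
  simp [e.left_inv hy]

variable [CompactSpace X] [T2Space X]

lemma isContDensity_green {u v : X → ℝ} (hu : SmoothFn n u) (hv : SmoothFn n v)
    {C : OpenPartialHomeomorph X (Fin n → ℂ) → (Fin n → ℂ) → Matrix (Fin n) (Fin n) ℂ}
    (hC : ∀ e ∈ atlas (Fin n → ℂ) X, ∀ i j, ContDiffOn ℝ ∞ (fun w => C e w i j) e.target) :
    IsContDensity (X := X) fun e w =>
      v (e.symm w) * wedgeDensity (slots₁ (ddcCoeff u e w) (C e w)) := fun e he =>
  ((hv e he).mul (ContDiffOn.wedgeDensity_slots₁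
    (contDiffOn_cHess e.open_target (hu e he)) (hC e he))).continuousOn

/-- Green's formula when one of the functions has its support in a chart. -/
lemma integralTop_green_of_support [NeZero n] {u v : X → ℝ} (hu : SmoothFn n u)
    (hv : SmoothFn n v)
    {C : OpenPartialHomeomorph X (Fin n → ℂ) → (Fin n → ℂ) → Matrix (Fin n) (Fin n) ℂ}
    (hC : IsClosedForm C) {e : OpenPartialHomeomorph X (Fin n → ℂ)}
    (he : e ∈ atlas (Fin n → ℂ) X) {K : Set X} (hK : IsCompact K) (hKe : K ⊆ e.source)
    (h0 : ∀ x ∉ K, v x = 0) :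
    integralTop (X := X) (fun e w =>
        v (e.symm w) * wedgeDensity (slots₁ (ddcCoeff u e w) (C e w))) =
      integralTop (X := X) fun e w =>
        u (e.symm w) * wedgeDensity (slots₁ (ddcCoeff v e w) (C e w)) := by
  have hvan : ∀ e' ∈ atlas (Fin n → ℂ) X, ∀ w ∈ e'.target, e'.symm w ∉ K →
      ddcCoeff v e' w = 0 := by
    intro e' he' w hw hwK
    have : (fun z => v (e'.symm z)) =ᶠ[𝓝 w] fun _ => 0 := by
      have hc : ContinuousAt e'.symm w := e'.continuousAt_symm hw
      filter_upwards [hc.eventually (hK.isClosed.isOpen_compl.mem_nhds hwK)] with z hz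
      exact h0 _ hz
    rw [ddcCoeff, cHess_congr this]
    ext i j
    have h1 : wirtBar j (fun _ : Fin n → ℂ => ((0 : ℝ) : ℂ)) = fun _ => 0 := by
      funext z; simp [wirtBar]
    simp only [cHess, Matrix.of_apply, h1]
    simp [wirt]
  have hKc : IsCompact (e '' K) := hK.image_of_continuousOn (e.continuousOn.mono hKe)
  have hKt : e '' K ⊆ e.target := by
    rintro _ ⟨x, hx, rfl⟩; exact e.map_source (hKe hx)
  rw [integralTop_eq_setIntegral he hK hKe
      ((IsDensity.wedgeDensity_slots₁ (IsForm.ddcCoeff hu) hC.form).fun_mul v)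
      (isContDensity_green hu hv hC.smooth)
      fun e' he' w hw hwK => by rw [h0 _ hwK, zero_mul],
    integralTop_eq_setIntegral he hK hKe
      ((IsDensity.wedgeDensity_slots₁ (IsForm.ddcCoeff hv) hC.form).fun_mul u)
      (isContDensity_green hv hu hC.smooth)
      fun e' he' w hw hwK => by
        rw [hvan e' he' w hw hwK, wedgeDensity, mixedDet_slots₁]; simp]
  have hg := integral_mul_mixedDet_cHess e.open_target hKc hKt (hu e he) (hv e he)
    (fun w hw hwK => h0 _ fun h => hwK ⟨_, h, e.right_inv hw⟩) (hC.smooth e he)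
    (hC.closed e he) (hC.closedBar e he)
  have hre : ∀ {a b : X → ℝ}, SmoothFn n a → SmoothFn n b → (∀ w ∈ e.target, w ∉ e '' K →
        (a (e.symm w) : ℂ) * mixedDet (slots₁ (ddcCoeff b e w) (C e w)) = 0) →
      ∫ w in e.target, a (e.symm w) * wedgeDensity (slots₁ (ddcCoeff b e w) (C e w)) =
      (2 / Real.pi) ^ n * (∫ w in e.target,
        (a (e.symm w) : ℂ) * mixedDet (slots₁ (ddcCoeff b e w) (C e w))).re := by
    intro a b ha hb hz
    have hi : IntegrableOn (fun w =>
        (a (e.symm w) : ℂ) * mixedDet (slots₁ (ddcCoeff b e w) (C e w))) e.target := by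
      refine integrableOn_of_compact e.open_target hKc hKt ?_ hz
      refine ((contDiffOn_ofReal (ha e he)).mul (ContDiffOn.mixedDet fun k i j => ?_)).continuousOn
      simp only [slots₁]
      split_ifs
      exacts [contDiffOn_cHess e.open_target (hb e he) i j, hC.smooth e he i j]
    have h1 := integral_re hi
    simp only [RCLike.re_eq_complex_re] at h1
    rw [← h1, ← integral_const_mul]
    congr 1
    funext w
    simp only [wedgeDensity, Complex.re_ofReal_mul]
    ring
  rw [hre hv hu fun w hw hwK => by
      rw [h0 _ fun h => hwK ⟨_, h, e.right_inv hw⟩]; simp,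
    hre hu hv fun w hw hwK => by
      rw [hvan e he w hw fun h => hwK ⟨_, h, e.right_inv hw⟩, mixedDet_slots₁]; simp]
  congr 2

/-- Green's formula `∫ v ddᶜu ∧ C^{n-1} = ∫ u ddᶜv ∧ C^{n-1}` for a closed form `C`. -/
lemma integralTop_green [NeZero n] {u v : X → ℝ} (hu : SmoothFn n u) (hv : SmoothFn n v)
    {C : OpenPartialHomeomorph X (Fin n → ℂ) → (Fin n → ℂ) → Matrix (Fin n) (Fin n) ℂ}
    (hC : IsClosedForm C) :
    integralTop (X := X) (fun e w =>
        v (e.symm w) * wedgeDensity (slots₁ (ddcCoeff u e w) (C e w))) =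
      integralTop (X := X) fun e w =>
        u (e.symm w) * wedgeDensity (slots₁ (ddcCoeff v e w) (C e w)) := by
  have := isManifold_real n X
  obtain ⟨χ, hχ⟩ := SmoothPartitionOfUnity.exists_isSubordinate_chartAt_source
    (M := X) 𝓘(ℝ, Fin n → ℂ)
  have hfin : {p | (Function.support (χ p)).Nonempty}.Finite :=
    χ.locallyFinite.finite_nonempty_of_compact
  set T := hfin.toFinset
  have hsum : ∀ x, ∑ p ∈ T, χ p x = 1 := by
    intro x
    rw [← χ.sum_eq_one (mem_univ x)]
    refine (finsum_eq_sum_of_support_subset _ fun p hp => ?_).symm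
    exact (Set.Finite.mem_toFinset _).2 ⟨x, hp⟩
  have hs : ∀ p, SmoothFn n fun x => χ p x * v x := fun p e he =>
    (smoothFn_of_contMDiff (χ p).contMDiff e he).mul (hv e he)
  have hv' : ∀ x, v x = ∑ p ∈ T, χ p x * v x := fun x => by
    rw [← Finset.sum_mul, hsum, one_mul]
  have h1 : integralTop (X := X) (fun e w =>
        v (e.symm w) * wedgeDensity (slots₁ (ddcCoeff u e w) (C e w))) =
      ∑ p ∈ T, integralTop (X := X) fun e w =>
        (χ p (e.symm w) * v (e.symm w)) * wedgeDensity (slots₁ (ddcCoeff u e w) (C e w)) := by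
    rw [← integralTop_sum T fun p => isContDensity_green hu (hs p) hC.smooth]
    refine integralTop_congr fun e _ w _ => ?_
    rw [← Finset.sum_mul, ← hv']
  have h2 : integralTop (X := X) (fun e w =>
        u (e.symm w) * wedgeDensity (slots₁ (ddcCoeff v e w) (C e w))) =
      ∑ p ∈ T, integralTop (X := X) fun e w =>
        u (e.symm w) * wedgeDensity (slots₁ (ddcCoeff (fun x => χ p x * v x) e w) (C e w)) := by
    rw [← integralTop_sum T fun p => isContDensity_green (hs p) hu hC.smooth]
    refine integralTop_congr fun e he w hw => ?_
    have hd : ddcCoeff v e w = ∑ p ∈ T, ddcCoeff (fun x => χ p x * v x) e w := by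
      have := cHess_sum T (f := fun p z => χ p (e.symm z) * v (e.symm z)) (w := w)
        fun p _ => ((hs p).contDiffAt he hw).of_le two_le_infty
      unfold ddcCoeff
      rw [← this]
      congr 1
      funext z
      exact hv' _
    rw [← Finset.mul_sum, hd]
    congr 1
    simp only [wedgeDensity, ← Finset.mul_sum, ← Complex.re_sum, mixedDet_slots₁_sum]
  rw [h1, h2]
  refine Finset.sum_congr rfl fun p _ => ?_
  refine integralTop_green_of_support hu (hs p) hC (chart_mem_atlas _ p)
    (isClosed_tsupport (χ p)).isCompact (hχ p) fun x hx => ?_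
  rw [image_eq_zero_of_notMem_tsupport hx, zero_mul]

end GlobalGreen

/-! ### Smooth families of functions -/

section PartialDerivatives

variable {P E G : Type*} [NormedAddCommGroup P] [NormedSpace ℝ P] [NormedAddCommGroup E]
  [NormedSpace ℝ E] [NormedAddCommGroup G] [NormedSpace ℝ G] {A : Set P} {U : Set E}
  {g : P × E → G}

lemma hasFDerivAt_slice (hU : IsOpen U) {q : P × E}
    (hg : DifferentiableWithinAt ℝ g (A ×ˢ U) q) (hq : q ∈ A ×ˢ U) :
    HasFDerivAt (fun w => g (q.1, w))
      ((fderivWithin ℝ g (A ×ˢ U) q).comp (ContinuousLinearMap.inr ℝ P E)) q.2 := by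
  have h1 : HasFDerivWithinAt (fun w => (q.1, w)) (ContinuousLinearMap.inr ℝ P E) U q.2 :=
    (hasFDerivAt_prodMk_right q.1 q.2).hasFDerivWithinAt
  have h2 : MapsTo (fun w => (q.1, w)) U (A ×ˢ U) := fun w hw => ⟨hq.1, hw⟩
  exact (HasFDerivWithinAt.comp q.2 hg.hasFDerivWithinAt h1 h2).hasFDerivAt (hU.mem_nhds hq.2)

lemma hasFDerivWithinAt_slice {q : P × E}
    (hg : DifferentiableWithinAt ℝ g (A ×ˢ U) q) (hq : q ∈ A ×ˢ U) :
    HasFDerivWithinAt (fun p => g (p, q.2))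
      ((fderivWithin ℝ g (A ×ˢ U) q).comp (ContinuousLinearMap.inl ℝ P E)) A q.1 := by
  have h1 : HasFDerivWithinAt (fun p => (p, q.2)) (ContinuousLinearMap.inl ℝ P E) A q.1 :=
    (hasFDerivAt_prodMk_left q.1 q.2).hasFDerivWithinAt
  have h2 : MapsTo (fun p => (p, q.2)) A (A ×ˢ U) := fun p hp => ⟨hp, hq.2⟩
  exact HasFDerivWithinAt.comp q.1 hg.hasFDerivWithinAt h1 h2

/-- A convex set of parameters with interior points: derivatives within it are unique, and second
derivatives within it are symmetric. -/
structure IsParamSet (A : Set P) : Prop where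
  convex : Convex ℝ A
  nonempty : (interior A).Nonempty

lemma IsParamSet.uniqueDiffOn (hA : IsParamSet A) : UniqueDiffOn ℝ A :=
  uniqueDiffOn_convex hA.convex hA.nonempty

lemma IsParamSet.uniqueDiffOn_prod (hA : IsParamSet A) (hU : IsOpen U) :
    UniqueDiffOn ℝ (A ×ˢ U) :=
  hA.uniqueDiffOn.prod hU.uniqueDiffOn

lemma IsParamSet.mem_closure_interior (hA : IsParamSet A) (hU : IsOpen U) {q : P × E}
    (hq : q ∈ A ×ˢ U) : q ∈ closure (interior (A ×ˢ U)) := by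
  rw [interior_prod_eq, closure_prod_eq, hU.interior_eq,
    hA.convex.closure_interior_eq_closure_of_nonempty_interior hA.nonempty]
  exact ⟨subset_closure hq.1, subset_closure hq.2⟩

lemma contDiffOn_fderivWithin_const_apply (hA : IsParamSet A) (hU : IsOpen U)
    (hg : ContDiffOn ℝ ∞ g (A ×ˢ U)) (v : P × E) :
    ContDiffOn ℝ ∞ (fun q => fderivWithin ℝ g (A ×ˢ U) q v) (A ×ˢ U) :=
  (hg.fderivWithin (hA.uniqueDiffOn_prod hU) (by simp)).clm_apply contDiffOn_const

lemma ContDiffOn.diffWithin {g : E → G} {S : Set E} (hg : ContDiffOn ℝ ∞ g S) {q : E}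
    (hq : q ∈ S) : DifferentiableWithinAt ℝ g S q :=
  hg.differentiableOn (by simp) q hq

lemma fderiv_slice_eq (hU : IsOpen U) (hg : ContDiffOn ℝ ∞ g (A ×ˢ U)) {q : P × E}
    (hq : q ∈ A ×ˢ U) (v : E) :
    fderiv ℝ (fun w => g (q.1, w)) q.2 v = fderivWithin ℝ g (A ×ˢ U) q (0, v) := by
  rw [(hasFDerivAt_slice hU (hg.diffWithin hq) hq).fderiv]; rfl

lemma fderivWithin_slice_eq (hA : IsParamSet A) (hg : ContDiffOn ℝ ∞ g (A ×ˢ U)) {q : P × E}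
    (hq : q ∈ A ×ˢ U) (a : P) :
    fderivWithin ℝ (fun p => g (p, q.2)) A q.1 a = fderivWithin ℝ g (A ×ˢ U) q (a, 0) := by
  rw [(hasFDerivWithinAt_slice (hg.diffWithin hq) hq).fderivWithin (hA.uniqueDiffOn q.1 hq.1)]
  rfl

lemma contDiffOn_fderiv_slice (hA : IsParamSet A) (hU : IsOpen U)
    (hg : ContDiffOn ℝ ∞ g (A ×ˢ U)) (v : E) :
    ContDiffOn ℝ ∞ (fun q : P × E => fderiv ℝ (fun w => g (q.1, w)) q.2 v) (A ×ˢ U) :=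
  (contDiffOn_fderivWithin_const_apply hA hU hg (0, v)).congr fun _ hq => fderiv_slice_eq hU hg hq v

lemma contDiffOn_fderivWithin_slice (hA : IsParamSet A) (hU : IsOpen U)
    (hg : ContDiffOn ℝ ∞ g (A ×ˢ U)) (a : P) :
    ContDiffOn ℝ ∞ (fun q : P × E => fderivWithin ℝ (fun p => g (p, q.2)) A q.1 a) (A ×ˢ U) :=
  (contDiffOn_fderivWithin_const_apply hA hU hg (a, 0)).congr
    fun _ hq => fderivWithin_slice_eq hA hg hq a

lemma fderivWithin_apply_comm {f : E → G} {S : Set E} (hS : UniqueDiffOn ℝ S)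
    (hf : ContDiffOn ℝ ∞ f S) {q : E} (hq : q ∈ S) (hq' : q ∈ closure (interior S)) (u v : E) :
    fderivWithin ℝ (fun q => fderivWithin ℝ f S q u) S q v =
      fderivWithin ℝ (fun q => fderivWithin ℝ f S q v) S q u := by
  have hd : DifferentiableWithinAt ℝ (fderivWithin ℝ f S) S q :=
    (hf.fderivWithin (m := ∞) hS (by simp)).diffWithin hq
  have h : ∀ a b, fderivWithin ℝ (fun q => fderivWithin ℝ f S q a) S q b =
      fderivWithin ℝ (fderivWithin ℝ f S) S q b a := by
    intro a b
    rw [fderivWithin_clm_apply (hS q hq) hd (differentiableWithinAt_const a)]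
    simp
  rw [h, h]
  exact (ContDiffWithinAt.isSymmSndFDerivWithinAt (hf q hq)
    (by simpa using two_le_infty) hS hq' hq).eq v u

/-- Derivatives in the parameter and in the variable commute, up to the boundary of the set of
parameters. -/
lemma fderivWithin_fderiv_comm (hA : IsParamSet A) (hU : IsOpen U)
    (hg : ContDiffOn ℝ ∞ g (A ×ˢ U)) {p : P} {w : E} (hp : p ∈ A) (hw : w ∈ U) (a : P) (v : E) :
    fderivWithin ℝ (fun p => fderiv ℝ (fun w => g (p, w)) w v) A p a =
      fderiv ℝ (fun w => fderivWithin ℝ (fun p => g (p, w)) A p a) w v := by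
  have hq : (p, w) ∈ A ×ˢ U := ⟨hp, hw⟩
  rw [fderivWithin_slice_eq (q := (p, w)) (g := fun q : P × E =>
      fderiv ℝ (fun w => g (q.1, w)) q.2 v) hA (contDiffOn_fderiv_slice hA hU hg v) hq,
    fderiv_slice_eq (q := (p, w)) (g := fun q : P × E =>
      fderivWithin ℝ (fun p => g (p, q.2)) A q.1 a) hU (contDiffOn_fderivWithin_slice hA hU hg a)
      hq,
    fderivWithin_congr (fun q hq => fderiv_slice_eq hU hg hq v) (fderiv_slice_eq hU hg hq v),
    fderivWithin_congr (fun q hq => fderivWithin_slice_eq hA hg hq a)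
      (fderivWithin_slice_eq hA hg hq a)]
  exact fderivWithin_apply_comm (hA.uniqueDiffOn_prod hU) hg hq (hA.mem_closure_interior hU hq) _ _

end PartialDerivatives

section WirtingerFamilies

variable {P : Type*} [NormedAddCommGroup P] [NormedSpace ℝ P] {A : Set P} {n : ℕ}
  {U : Set (Fin n → ℂ)} {g : P × (Fin n → ℂ) → ℂ}

lemma contDiffOn_wirt_slice (hA : IsParamSet A) (hU : IsOpen U)
    (hg : ContDiffOn ℝ ∞ g (A ×ˢ U)) (k : Fin n) :
    ContDiffOn ℝ ∞ (fun q : P × (Fin n → ℂ) => wirt k (fun w => g (q.1, w)) q.2) (A ×ˢ U) :=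
  ((contDiffOn_fderiv_slice hA hU hg _).sub
    (contDiffOn_const.mul (contDiffOn_fderiv_slice hA hU hg _))).div_const 2

lemma contDiffOn_wirtBar_slice (hA : IsParamSet A) (hU : IsOpen U)
    (hg : ContDiffOn ℝ ∞ g (A ×ˢ U)) (k : Fin n) :
    ContDiffOn ℝ ∞ (fun q : P × (Fin n → ℂ) => wirtBar k (fun w => g (q.1, w)) q.2) (A ×ˢ U) :=
  ((contDiffOn_fderiv_slice hA hU hg _).add
    (contDiffOn_const.mul (contDiffOn_fderiv_slice hA hU hg _))).div_const 2

lemma fderivWithin_wirt_comm (hA : IsParamSet A) (hU : IsOpen U)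
    (hg : ContDiffOn ℝ ∞ g (A ×ˢ U)) {p : P} {w : Fin n → ℂ} (hp : p ∈ A) (hw : w ∈ U) (a : P)
    (k : Fin n) :
    fderivWithin ℝ (fun p => wirt k (fun w => g (p, w)) w) A p a =
      wirt k (fun w => fderivWithin ℝ (fun p => g (p, w)) A p a) w ∧
    fderivWithin ℝ (fun p => wirtBar k (fun w => g (p, w)) w) A p a =
      wirtBar k (fun w => fderivWithin ℝ (fun p => g (p, w)) A p a) w := by
  have hd : ∀ v, DifferentiableWithinAt ℝ (fun p => fderiv ℝ (fun w => g (p, w)) w v) A p :=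
    fun v => (hasFDerivWithinAt_slice (q := (p, w)) ((contDiffOn_fderiv_slice hA hU hg v).diffWithin
      (q := (p, w)) ⟨hp, hw⟩) ⟨hp, hw⟩).differentiableWithinAt
  have hu := hA.uniqueDiffOn p hp
  constructor
  · have h := (((hd (Pi.single k 1)).hasFDerivWithinAt.sub
      ((hd (Pi.single k Complex.I)).hasFDerivWithinAt.const_mul Complex.I)).mul_const
        (2⁻¹ : ℂ)).fderivWithin hu
    have h2 : (fun p => wirt k (fun w => g (p, w)) w) = fun p =>
        (fderiv ℝ (fun w => g (p, w)) w (Pi.single k 1) -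
          Complex.I * fderiv ℝ (fun w => g (p, w)) w (Pi.single k Complex.I)) * 2⁻¹ := rfl
    rw [h2]
    erw [h]
    simp only [_root_.smul_apply, _root_.sub_apply, smul_eq_mul, wirt,
      fderivWithin_fderiv_comm hA hU hg hp hw]
    ring
  · have h := (((hd (Pi.single k 1)).hasFDerivWithinAt.add
      ((hd (Pi.single k Complex.I)).hasFDerivWithinAt.const_mul Complex.I)).mul_const
        (2⁻¹ : ℂ)).fderivWithin hu
    have h2 : (fun p => wirtBar k (fun w => g (p, w)) w) = fun p =>
        (fderiv ℝ (fun w => g (p, w)) w (Pi.single k 1) +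
          Complex.I * fderiv ℝ (fun w => g (p, w)) w (Pi.single k Complex.I)) * 2⁻¹ := rfl
    rw [h2]
    erw [h]
    simp only [_root_.smul_apply, _root_.add_apply, smul_eq_mul, wirtBar,
      fderivWithin_fderiv_comm hA hU hg hp hw]
    ring

lemma fderivWithin_ofReal {u : P → ℝ} {p : P} (hu : DifferentiableWithinAt ℝ u A p)
    (hp : UniqueDiffWithinAt ℝ A p) (a : P) :
    fderivWithin ℝ (fun q => (u q : ℂ)) A p a = (fderivWithin ℝ u A p a : ℝ) := by
  have : HasFDerivWithinAt (fun q => (u q : ℂ))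
      (Complex.ofRealCLM.comp (fderivWithin ℝ u A p)) A p :=
    Complex.ofRealCLM.hasFDerivAt.comp_hasFDerivWithinAt p hu.hasFDerivWithinAt
  rw [this.fderivWithin hp]; rfl

variable {u : P × (Fin n → ℂ) → ℝ}

lemma contDiffOn_cHess_slice (hA : IsParamSet A) (hU : IsOpen U)
    (hu : ContDiffOn ℝ ∞ u (A ×ˢ U)) (i j : Fin n) :
    ContDiffOn ℝ ∞ (fun q : P × (Fin n → ℂ) => cHess (fun w => u (q.1, w)) q.2 i j) (A ×ˢ U) :=
  contDiffOn_wirt_slice hA hU (contDiffOn_wirtBar_slice hA hU (contDiffOn_ofReal hu) j) i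

/-- Derivatives in the parameter commute with the complex Hessian. -/
lemma fderivWithin_cHess (hA : IsParamSet A) (hU : IsOpen U)
    (hu : ContDiffOn ℝ ∞ u (A ×ˢ U)) {p : P} {w : Fin n → ℂ} (hp : p ∈ A) (hw : w ∈ U) (a : P)
    (i j : Fin n) :
    fderivWithin ℝ (fun p => cHess (fun w => u (p, w)) w i j) A p a =
      cHess (fun w => fderivWithin ℝ (fun p => u (p, w)) A p a) w i j := by
  have hg : ContDiffOn ℝ ∞ (fun q => (u q : ℂ)) (A ×ˢ U) := contDiffOn_ofReal hu
  have hu' := hA.uniqueDiffOn p hp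
  simp only [cHess, Matrix.of_apply]
  rw [(fderivWithin_wirt_comm hA hU (contDiffOn_wirtBar_slice hA hU hg j) hp hw a i).1]
  refine wirt_congr ?_ i
  filter_upwards [hU.mem_nhds hw] with v hv
  rw [(fderivWithin_wirt_comm hA hU hg hp hv a j).2]
  refine wirtBar_congr ?_ j
  filter_upwards [hU.mem_nhds hv] with z hz
  exact fderivWithin_ofReal (hasFDerivWithinAt_slice (q := (p, z)) (hu.diffWithin
      (q := (p, z)) ⟨hp, hz⟩) ⟨hp, hz⟩).differentiableWithinAt hu' a

end WirtingerFamilies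

section Families

variable {P : Type*} [NormedAddCommGroup P] [NormedSpace ℝ P] {A : Set P} {n : ℕ}
  {X : Type*} [TopologicalSpace X] [ChartedSpace (Fin n → ℂ) X]

/-- A family of functions on `X`, smooth in the variable and in the parameter in `A`. -/
def SmoothFamily (n : ℕ) {X : Type*} [TopologicalSpace X] [ChartedSpace (Fin n → ℂ) X]
    (A : Set P) (u : P → X → ℝ) : Prop :=
  ∀ e ∈ atlas (Fin n → ℂ) X,
    ContDiffOn ℝ ∞ (fun q : P × (Fin n → ℂ) => u q.1 (e.symm q.2)) (A ×ˢ e.target)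

/-- The derivative of a family of functions in the direction `a` of the parameters. -/
def paramDeriv (A : Set P) (a : P) (u : P → X → ℝ) : P → X → ℝ :=
  fun p x => fderivWithin ℝ (fun q => u q x) A p a

/-- The time derivative of a path is its derivative in the parameter, in the direction `1`. -/
lemma dot_eq_paramDeriv (φ : ℝ → X → ℝ) : dot φ = paramDeriv (Icc 0 1) 1 φ := rfl

namespace SmoothFamily

variable {u v : P → X → ℝ}

lemma paramDeriv (hA : IsParamSet A) (hu : SmoothFamily n A u) (a : P) :
    SmoothFamily n A (_root_.paramDeriv A a u) := fun e he =>
  contDiffOn_fderivWithin_slice hA e.open_target (hu e he) a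

lemma mul (hu : SmoothFamily n A u) (hv : SmoothFamily n A v) :
    SmoothFamily n A fun p x => u p x * v p x := fun e he => (hu e he).mul (hv e he)

lemma smoothFn (hu : SmoothFamily n A u) {p : P} (hp : p ∈ A) : SmoothFn n (u p) := fun e he =>
  (hu e he).comp (f := fun w => (p, w)) (contDiffOn_const.prodMk contDiffOn_id)
    fun _ hw => ⟨hp, hw⟩

lemma congr (hu : SmoothFamily n A u) (h : ∀ p ∈ A, ∀ x, v p x = u p x) :
    SmoothFamily n A v := fun e he => (hu e he).congr fun q hq => h q.1 hq.1 _

lemma comp {Q : Type*} [NormedAddCommGroup Q] [NormedSpace ℝ Q] {B : Set Q} {f : Q → P}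
    (hu : SmoothFamily n A u) (hf : ContDiffOn ℝ ∞ f B) (hm : MapsTo f B A) :
    SmoothFamily n B fun q x => u (f q) x := fun e he =>
  (hu e he).comp (f := fun q : Q × (Fin n → ℂ) => (f q.1, q.2))
    ((hf.comp contDiffOn_fst fun _ hq => hq.1).prodMk contDiffOn_snd)
    fun _ hq => ⟨hm hq.1, hq.2⟩

lemma contDiffOn_param (hu : SmoothFamily n A u) (x : X) : ContDiffOn ℝ ∞ (fun p => u p x) A := by
  have h := (hu (chartAt (Fin n → ℂ) x) (chart_mem_atlas _ x)).comp
    (f := fun p => (p, chartAt (Fin n → ℂ) x x)) (s := A)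
    (contDiffOn_id.prodMk contDiffOn_const)
    fun _ hp => ⟨hp, (chartAt (Fin n → ℂ) x).map_source (mem_chart_source _ x)⟩
  refine h.congr fun p _ => ?_
  simp only [Function.comp_apply]
  rw [(chartAt (Fin n → ℂ) x).left_inv (mem_chart_source _ x)]

lemma ddcCoeff (hA : IsParamSet A) (hu : SmoothFamily n A u)
    {e : OpenPartialHomeomorph X (Fin n → ℂ)} (he : e ∈ atlas (Fin n → ℂ) X) (i j : Fin n) :
    ContDiffOn ℝ ∞ (fun q : P × (Fin n → ℂ) => _root_.ddcCoeff (u q.1) e q.2 i j)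
      (A ×ˢ e.target) :=
  contDiffOn_cHess_slice hA e.open_target (hu e he) i j

lemma dWedgeDcCoeff (hA : IsParamSet A) (hu : SmoothFamily n A u)
    {e : OpenPartialHomeomorph X (Fin n → ℂ)} (he : e ∈ atlas (Fin n → ℂ) X) (i j : Fin n) :
    ContDiffOn ℝ ∞ (fun q : P × (Fin n → ℂ) => _root_.dWedgeDcCoeff (u q.1) e q.2 i j)
      (A ×ˢ e.target) :=
  (contDiffOn_wirt_slice hA e.open_target (contDiffOn_ofReal (hu e he)) i).mul
    (contDiffOn_wirtBar_slice hA e.open_target (contDiffOn_ofReal (hu e he)) j)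

lemma perturb (κ : KahlerForm n X) (hA : IsParamSet A) (hu : SmoothFamily n A u)
    {e : OpenPartialHomeomorph X (Fin n → ℂ)} (he : e ∈ atlas (Fin n → ℂ) X) (i j : Fin n) :
    ContDiffOn ℝ ∞ (fun q : P × (Fin n → ℂ) => κ.perturb (u q.1) e q.2 i j) (A ×ˢ e.target) :=
  ((κ.smooth e he i j).comp (f := Prod.snd) contDiffOn_snd fun _ hq => hq.2).add
    (hu.ddcCoeff hA he i j)

lemma fderivWithin_ddcCoeff (hA : IsParamSet A) (hu : SmoothFamily n A u)
    {e : OpenPartialHomeomorph X (Fin n → ℂ)} (he : e ∈ atlas (Fin n → ℂ) X) {p : P} (hp : p ∈ A)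
    {w : Fin n → ℂ} (hw : w ∈ e.target) (a : P) (i j : Fin n) :
    fderivWithin ℝ (fun p => _root_.ddcCoeff (u p) e w i j) A p a =
      _root_.ddcCoeff (_root_.paramDeriv A a u p) e w i j :=
  fderivWithin_cHess hA e.open_target (hu e he) hp hw a i j

end SmoothFamily

end Families

/-! ### Derivatives of Monge-Ampère densities along families -/

section Lines

variable {P : Type*} [NormedAddCommGroup P] [NormedSpace ℝ P] {A : Set P}

/-- A curve `c` of parameters, with velocity `a` at the time `r`, which stays in `A` near `r`. -/
structure IsLine (A : Set P) (c : ℝ → P) (a : P) (r : ℝ) : Prop where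
  deriv : HasDerivAt c a r
  mem : ∀ᶠ s in 𝓝 r, c s ∈ A

lemma IsLine.hasDerivAt {G : Type*} [NormedAddCommGroup G] [NormedSpace ℝ G] {f : P → G}
    {c : ℝ → P} {a : P} {r : ℝ} (hc : IsLine A c a r)
    (hf : DifferentiableWithinAt ℝ f A (c r)) :
    HasDerivAt (fun s => f (c s)) (fderivWithin ℝ f A (c r) a) r := by
  have h1 := HasFDerivWithinAt.comp_hasDerivWithinAt (s := c ⁻¹' A) r hf.hasFDerivWithinAt
    hc.deriv.hasDerivWithinAt (fun _ h => h)
  exact h1.hasDerivAt hc.mem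

lemma isParamSet_Icc : IsParamSet (Icc (0 : ℝ) 1) :=
  ⟨convex_Icc 0 1, by rw [interior_Icc]; exact nonempty_Ioo.2 one_pos⟩

lemma isParamSet_Ioo_prod_Icc {ε : ℝ} (hε : 0 < ε) :
    IsParamSet (Ioo (-ε) ε ×ˢ Icc (0 : ℝ) 1) := by
  refine ⟨(convex_Ioo _ _).prod (convex_Icc _ _), ?_⟩
  rw [interior_prod_eq, interior_Icc, interior_Ioo]
  exact (nonempty_Ioo.2 (by linarith)).prod (nonempty_Ioo.2 one_pos)

lemma isLine_id {t : ℝ} (ht : t ∈ Ioo (0 : ℝ) 1) : IsLine (Icc (0 : ℝ) 1) (fun s => s) 1 t :=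
  ⟨hasDerivAt_id t, Icc_mem_nhds ht.1 ht.2⟩

lemma isLine_left {ε s t : ℝ} (hs : s ∈ Ioo (-ε) ε) (ht : t ∈ Icc (0 : ℝ) 1) :
    IsLine (Ioo (-ε) ε ×ˢ Icc (0 : ℝ) 1) (fun s => (s, t)) (1, 0) s :=
  ⟨(hasDerivAt_id s).prodMk (hasDerivAt_const s t),
    Filter.Eventually.mono (isOpen_Ioo.mem_nhds hs) fun _ h => ⟨h, ht⟩⟩

end Lines

section Densities

variable {n : ℕ}

lemma hasDerivAt_wedgeDensity_const {A : ℝ → Matrix (Fin n) (Fin n) ℂ}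
    {A' : Matrix (Fin n) (Fin n) ℂ} {r : ℝ}
    (h : ∀ i j, HasDerivAt (fun s => A s i j) (A' i j) r) :
    HasDerivAt (fun s => wedgeDensity (fun _ => A s)) (n * wedgeDensity (slots₁ A' (A r))) r := by
  have h1 := Complex.reCLM.hasFDerivAt.comp_hasDerivAt r (hasDerivAt_mixedDet_const h)
  refine (h1.const_mul ((2 / Real.pi) ^ n)).congr_deriv ?_
  have : (Complex.reCLM ((n : ℂ) * mixedDet (slots₁ A' (A r)))) =
      n * (mixedDet (slots₁ A' (A r))).re := by
    simp
  rw [this, wedgeDensity]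
  ring

lemma hasDerivAt_wedgeDensity_slots₁ {B C : ℝ → Matrix (Fin n) (Fin n) ℂ}
    {B' C' : Matrix (Fin n) (Fin n) ℂ} {r : ℝ}
    (hB : ∀ i j, HasDerivAt (fun s => B s i j) (B' i j) r)
    (hC : ∀ i j, HasDerivAt (fun s => C s i j) (C' i j) r) :
    HasDerivAt (fun s => n * wedgeDensity (slots₁ (B s) (C s)))
      (n * wedgeDensity (slots₁ B' (C r)) +
        n * (n - 1) * wedgeDensity (slots₂ (B r) C' (C r))) r := by
  rcases Nat.eq_zero_or_pos n with rfl | hn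
  · simpa using hasDerivAt_const r (0 : ℝ)
  have : NeZero n := ⟨hn.ne'⟩
  have h1 := Complex.reCLM.hasFDerivAt.comp_hasDerivAt r (hasDerivAt_mixedDet_slots₁ hB hC)
  refine ((h1.const_mul ((2 / Real.pi) ^ n)).const_mul (n : ℝ)).congr_deriv ?_
  have : Complex.reCLM (mixedDet (slots₁ B' (C r)) +
      ((n : ℂ) - 1) * mixedDet (slots₂ (B r) C' (C r))) =
      (mixedDet (slots₁ B' (C r))).re + (n - 1) * (mixedDet (slots₂ (B r) C' (C r))).re := by
    have : ((n : ℂ) - 1) = ((n - 1 : ℝ) : ℂ) := by push_cast; ring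
    rw [this]
    simp
  rw [this, wedgeDensity, wedgeDensity]
  ring

variable {P : Type*} [NormedAddCommGroup P] [NormedSpace ℝ P] {A : Set P}
  {X : Type*} [TopologicalSpace X] [ChartedSpace (Fin n → ℂ) X]
  {c : ℝ → P} {a : P} {r : ℝ}

namespace SmoothFamily

variable {u v : P → X → ℝ}

lemma hasDerivAt (hu : SmoothFamily n A u) (hc : IsLine A c a r) (x : X) :
    HasDerivAt (fun s => u (c s) x) (_root_.paramDeriv A a u (c r) x) r :=
  hc.hasDerivAt ((hu.contDiffOn_param x).diffWithin hc.mem.self_of_nhds)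

lemma hasDerivAt_ddcCoeff (hA : IsParamSet A) (hu : SmoothFamily n A u) (hc : IsLine A c a r)
    {e : OpenPartialHomeomorph X (Fin n → ℂ)} (he : e ∈ atlas (Fin n → ℂ) X)
    {w : Fin n → ℂ} (hw : w ∈ e.target) (i j : Fin n) :
    HasDerivAt (fun s => _root_.ddcCoeff (u (c s)) e w i j)
      (_root_.ddcCoeff (_root_.paramDeriv A a u (c r)) e w i j) r := by
  rw [← hu.fderivWithin_ddcCoeff hA he hc.mem.self_of_nhds hw a i j]
  exact hc.hasDerivAt (f := fun p => _root_.ddcCoeff (u p) e w i j)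
    (hasFDerivWithinAt_slice (q := (c r, w)) ((hu.ddcCoeff hA he i j).diffWithin
      (q := (c r, w)) ⟨hc.mem.self_of_nhds, hw⟩) ⟨hc.mem.self_of_nhds, hw⟩).differentiableWithinAt

lemma hasDerivAt_perturb (κ : KahlerForm n X) (hA : IsParamSet A) (hu : SmoothFamily n A u)
    (hc : IsLine A c a r)
    {e : OpenPartialHomeomorph X (Fin n → ℂ)} (he : e ∈ atlas (Fin n → ℂ) X)
    {w : Fin n → ℂ} (hw : w ∈ e.target) (i j : Fin n) :
    HasDerivAt (fun s => κ.perturb (u (c s)) e w i j)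
      (_root_.ddcCoeff (_root_.paramDeriv A a u (c r)) e w i j) r :=
  (hu.hasDerivAt_ddcCoeff hA hc he hw i j).const_add _

variable [CompactSpace X] [T2Space X]

lemma hasDerivAt_MA (κ : KahlerForm n X) (hA : IsParamSet A) (hu : SmoothFamily n A u)
    (hc : IsLine A c a r)
    {e : OpenPartialHomeomorph X (Fin n → ℂ)} (he : e ∈ atlas (Fin n → ℂ) X)
    {w : Fin n → ℂ} (hw : w ∈ e.target) :
    HasDerivAt (fun s => κ.MA (u (c s)) e w)
      (n / κ.vol * wedgeDensity
        (slots₁ (_root_.ddcCoeff (_root_.paramDeriv A a u (c r)) e w)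
          (κ.perturb (u (c r)) e w))) r := by
  refine ((hasDerivAt_wedgeDensity_const
    fun i j => hu.hasDerivAt_perturb κ hA hc he hw i j).div_const κ.vol).congr_deriv ?_
  ring

lemma MA (κ : KahlerForm n X) (hA : IsParamSet A) (hu : SmoothFamily n A u)
    {e : OpenPartialHomeomorph X (Fin n → ℂ)} (he : e ∈ atlas (Fin n → ℂ) X) :
    ContDiffOn ℝ ∞ (fun q : P × (Fin n → ℂ) => κ.MA (u q.1) e q.2) (A ×ˢ e.target) :=
  (ContDiffOn.wedgeDensity fun _ i j => hu.perturb κ hA he i j).div_const _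

end SmoothFamily

end Densities

/-! ### Smooth families and smooth maps on products -/

section ProductSmoothness

variable {n : ℕ} {X : Type*} [TopologicalSpace X] [ChartedSpace (Fin n → ℂ) X]
  [IsManifold 𝓘(ℂ, Fin n → ℂ) ω X]

lemma smoothFamily_of_contMDiffOn {A : Set ℝ} {u : ℝ → X → ℝ}
    (hu : ContMDiffOn (𝓘(ℝ, ℝ).prod 𝓘(ℝ, Fin n → ℂ)) 𝓘(ℝ, ℝ) ∞
      (fun p : ℝ × X => u p.1 p.2) (A ×ˢ univ)) : SmoothFamily n A u := by
  have := isManifold_real n X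
  intro e he
  have h1 := contMDiffOn_symm_of_mem_maximalAtlas (I := 𝓘(ℝ, Fin n → ℂ)) (n := ∞)
    (IsManifold.subset_maximalAtlas he)
  have h2 : ContMDiffOn 𝓘(ℝ, ℝ × (Fin n → ℂ)) 𝓘(ℝ, Fin n → ℂ) ∞
      (fun q : ℝ × (Fin n → ℂ) => e.symm q.2) (A ×ˢ e.target) :=
    h1.comp (t := e.target) contDiff_snd.contMDiff.contMDiffOn fun q hq => hq.2
  have h3 : ContMDiffOn 𝓘(ℝ, ℝ × (Fin n → ℂ)) 𝓘(ℝ, ℝ) ∞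
      (fun q : ℝ × (Fin n → ℂ) => q.1) (A ×ˢ e.target) :=
    contDiff_fst.contMDiff.contMDiffOn
  exact contMDiffOn_iff_contDiffOn.1 (hu.comp (h3.prodMk h2) fun q hq => ⟨hq.1, mem_univ _⟩)

lemma smoothFamily_of_contMDiffOn₂ {A B : Set ℝ} {u : ℝ → ℝ → X → ℝ}
    (hu : ContMDiffOn (𝓘(ℝ, ℝ).prod (𝓘(ℝ, ℝ).prod 𝓘(ℝ, Fin n → ℂ))) 𝓘(ℝ, ℝ) ∞
      (fun p : ℝ × ℝ × X => u p.1 p.2.1 p.2.2) (A ×ˢ B ×ˢ univ)) :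
    SmoothFamily n (A ×ˢ B) fun p : ℝ × ℝ => u p.1 p.2 := by
  have := isManifold_real n X
  intro e he
  have h1 := contMDiffOn_symm_of_mem_maximalAtlas (I := 𝓘(ℝ, Fin n → ℂ)) (n := ∞)
    (IsManifold.subset_maximalAtlas he)
  have h2 : ContMDiffOn 𝓘(ℝ, (ℝ × ℝ) × (Fin n → ℂ)) 𝓘(ℝ, Fin n → ℂ) ∞
      (fun q : (ℝ × ℝ) × (Fin n → ℂ) => e.symm q.2) ((A ×ˢ B) ×ˢ e.target) :=
    h1.comp (t := e.target) contDiff_snd.contMDiff.contMDiffOn fun q hq => hq.2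
  have h3 : ContMDiffOn 𝓘(ℝ, (ℝ × ℝ) × (Fin n → ℂ)) 𝓘(ℝ, ℝ) ∞
      (fun q : (ℝ × ℝ) × (Fin n → ℂ) => q.1.1) ((A ×ˢ B) ×ˢ e.target) :=
    (contDiff_fst.comp contDiff_fst).contMDiff.contMDiffOn
  have h4 : ContMDiffOn 𝓘(ℝ, (ℝ × ℝ) × (Fin n → ℂ)) 𝓘(ℝ, ℝ) ∞
      (fun q : (ℝ × ℝ) × (Fin n → ℂ) => q.1.2) ((A ×ˢ B) ×ˢ e.target) :=
    (contDiff_snd.comp contDiff_fst).contMDiff.contMDiffOn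
  exact contMDiffOn_iff_contDiffOn.1
    (hu.comp (h3.prodMk (h4.prodMk h2)) fun q hq => ⟨hq.1.1, hq.1.2, mem_univ _⟩)

lemma SmoothFamily.contMDiffOn₂ {A B : Set ℝ} {u : ℝ → ℝ → X → ℝ}
    (hu : SmoothFamily n (A ×ˢ B) fun p : ℝ × ℝ => u p.1 p.2) :
    ContMDiffOn (𝓘(ℝ, ℝ).prod (𝓘(ℝ, ℝ).prod 𝓘(ℝ, Fin n → ℂ))) 𝓘(ℝ, ℝ) ∞
      (fun p : ℝ × ℝ × X => u p.1 p.2.1 p.2.2) (A ×ˢ B ×ˢ univ) := by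
  have := isManifold_real n X
  rintro ⟨s, t, x⟩ ⟨hs, ht, -⟩
  set e := chartAt (Fin n → ℂ) x
  have he : e ∈ atlas (Fin n → ℂ) X := chart_mem_atlas _ x
  have hx : x ∈ e.source := mem_chart_source _ x
  have h1 : ContMDiffAt 𝓘(ℝ, Fin n → ℂ) 𝓘(ℝ, Fin n → ℂ) ∞ e x :=
    contMDiffAt_of_mem_maximalAtlas (IsManifold.subset_maximalAtlas he) hx
  have h2 : ContMDiffAt (𝓘(ℝ, ℝ).prod (𝓘(ℝ, ℝ).prod 𝓘(ℝ, Fin n → ℂ)))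
      𝓘(ℝ, (ℝ × ℝ) × (Fin n → ℂ)) ∞
      (fun p : ℝ × ℝ × X => ((p.1, p.2.1), e p.2.2)) (s, t, x) :=
    (contMDiffAt_fst.prodMk_space (contMDiffAt_fst.comp _ contMDiffAt_snd)).prodMk_space
      (ContMDiffAt.comp (x := (s, t, x)) (g := e) h1 (contMDiffAt_snd.comp _ contMDiffAt_snd))
  have h3 : ContMDiffWithinAt 𝓘(ℝ, (ℝ × ℝ) × (Fin n → ℂ)) 𝓘(ℝ, ℝ) ∞
      (fun q : (ℝ × ℝ) × (Fin n → ℂ) => u q.1.1 q.1.2 (e.symm q.2)) ((A ×ˢ B) ×ˢ e.target)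
      ((s, t), e x) :=
    ((hu e he) ((s, t), e x) ⟨⟨hs, ht⟩, e.map_source hx⟩).contMDiffWithinAt
  have hopen : IsOpen {p : ℝ × ℝ × X | p.2.2 ∈ e.source} :=
    e.open_source.preimage (continuous_snd.comp continuous_snd)
  have h4 := ContMDiffWithinAt.comp (x := (s, t, x))
    (s := (A ×ˢ B ×ˢ univ) ∩ {p : ℝ × ℝ × X | p.2.2 ∈ e.source})
    (f := fun p : ℝ × ℝ × X => ((p.1, p.2.1), e p.2.2)) h3 h2.contMDiffWithinAt
    (fun p hp => ⟨⟨hp.1.1, hp.1.2.1⟩, e.map_source hp.2⟩)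
  rw [contMDiffWithinAt_inter (hopen.mem_nhds hx)] at h4
  refine h4.congr_of_eventuallyEq ?_ ?_
  · filter_upwards [mem_nhdsWithin_of_mem_nhds (hopen.mem_nhds (x := (s, t, x)) hx)] with p hp
    simp only [Function.comp_apply]
    rw [e.left_inv hp]
  · simp only [Function.comp_apply]
    rw [e.left_inv hx]

end ProductSmoothness

/-! ### The first variation of the Landau-Hall functional -/

section FirstVariation

open MeasureTheory

variable {n : ℕ} {X : Type*} [TopologicalSpace X] [ChartedSpace (Fin n → ℂ) X]

/-- Families of densities which are smooth in the variable and in the parameter. -/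
def SmoothDensities {P : Type*} [NormedAddCommGroup P] [NormedSpace ℝ P] (A : Set P)
    (η : P → OpenPartialHomeomorph X (Fin n → ℂ) → (Fin n → ℂ) → ℝ) : Prop :=
  ∀ e ∈ atlas (Fin n → ℂ) X,
    ContDiffOn ℝ ∞ (fun q : P × (Fin n → ℂ) => η q.1 e q.2) (A ×ˢ e.target)

section

variable {P : Type*} [NormedAddCommGroup P] [NormedSpace ℝ P] {A : Set P}
  {η η' : P → OpenPartialHomeomorph X (Fin n → ℂ) → (Fin n → ℂ) → ℝ}

lemma SmoothDensities.isContDensity (h : SmoothDensities A η) {p : P} (hp : p ∈ A) :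
    IsContDensity (η p) := fun e he =>
  (h e he).continuousOn.comp (f := fun w => (p, w)) (by fun_prop) fun _ hw => ⟨hp, hw⟩

lemma SmoothDensities.add (h : SmoothDensities A η) (h' : SmoothDensities A η') :
    SmoothDensities A fun p e w => η p e w + η' p e w := fun e he => (h e he).add (h' e he)

lemma SmoothDensities.sub (h : SmoothDensities A η) (h' : SmoothDensities A η') :
    SmoothDensities A fun p e w => η p e w - η' p e w := fun e he => (h e he).sub (h' e he)

lemma SmoothDensities.const_mul (h : SmoothDensities A η) (c : ℝ) :
    SmoothDensities A fun p e w => c * η p e w := fun e he => contDiffOn_const.mul (h e he)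

lemma SmoothFamily.fun_mul {u : P → X → ℝ} (hu : SmoothFamily n A u) (h : SmoothDensities A η) :
    SmoothDensities A fun p e w => u p (e.symm w) * η p e w := fun e he =>
  (hu e he).mul (h e he)

lemma SmoothFamily.wedge_ddc (hA : IsParamSet A) (κ : KahlerForm n X) {u v : P → X → ℝ}
    (hu : SmoothFamily n A u) (hv : SmoothFamily n A v) :
    SmoothDensities A fun p e w =>
      wedgeDensity (slots₁ (_root_.ddcCoeff (v p) e w) (κ.perturb (u p) e w)) := fun _ he =>
  ContDiffOn.wedgeDensity_slots₁ (hv.ddcCoeff hA he) (hu.perturb κ hA he)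

lemma SmoothFamily.wedge_grad (hA : IsParamSet A) (κ : KahlerForm n X) {u v : P → X → ℝ}
    (hu : SmoothFamily n A u) (hv : SmoothFamily n A v) :
    SmoothDensities A fun p e w =>
      wedgeDensity (slots₁ (_root_.dWedgeDcCoeff (v p) e w) (κ.perturb (u p) e w)) := fun _ he =>
  ContDiffOn.wedgeDensity_slots₁ (hv.dWedgeDcCoeff hA he) (hu.perturb κ hA he)

lemma SmoothFamily.wedge_ddc₂ (hA : IsParamSet A) (κ : KahlerForm n X) {u v v' : P → X → ℝ}
    (hu : SmoothFamily n A u) (hv : SmoothFamily n A v) (hv' : SmoothFamily n A v') :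
    SmoothDensities A fun p e w => wedgeDensity (slots₂ (_root_.ddcCoeff (v p) e w)
      (_root_.ddcCoeff (v' p) e w) (κ.perturb (u p) e w)) := fun _ he =>
  ContDiffOn.wedgeDensity_slots₂ (hv.ddcCoeff hA he) (hv'.ddcCoeff hA he) (hu.perturb κ hA he)

end

lemma SmoothFamily.dot {φ : ℝ → X → ℝ} (hφ : SmoothFamily n (Icc 0 1) φ) :
    SmoothFamily n (Icc 0 1) (_root_.dot φ) :=
  hφ.paramDeriv isParamSet_Icc 1

/-- The derivative in the second parameter of a family with two parameters. -/
lemma dot_eq_paramDeriv_right {ε s t : ℝ} {u : ℝ × ℝ → X → ℝ}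
    (hu : SmoothFamily n (Ioo (-ε) ε ×ˢ Icc (0 : ℝ) 1) u) (hs : s ∈ Ioo (-ε) ε)
    (ht : t ∈ Icc (0 : ℝ) 1) (x : X) :
    dot (fun t => u (s, t)) t x =
      paramDeriv (Ioo (-ε) ε ×ˢ Icc (0 : ℝ) 1) (0, 1) u (s, t) x := by
  have h1 : HasFDerivWithinAt (fun p => u p x) _ (Ioo (-ε) ε ×ˢ Icc (0 : ℝ) 1) (s, t) :=
    ((hu.contDiffOn_param x).diffWithin (q := (s, t)) ⟨hs, ht⟩).hasFDerivWithinAt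
  have h2 := h1.comp_hasDerivWithinAt (f := fun t => (s, t)) (f' := ((0 : ℝ), (1 : ℝ))) t
    (s := Icc (0 : ℝ) 1) ((hasDerivAt_const t s).prodMk (hasDerivAt_id t)).hasDerivWithinAt
    fun t ht => ⟨hs, ht⟩
  exact h2.derivWithin (isParamSet_Icc.uniqueDiffOn t ht)

variable [CompactSpace X] [T2Space X]

lemma SmoothDensities.continuousOn_integralTop
    {P : Type*} [NormedAddCommGroup P] [NormedSpace ℝ P] {A : Set P}
    {η : P → OpenPartialHomeomorph X (Fin n → ℂ) → (Fin n → ℂ) → ℝ} (h : SmoothDensities A η) :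
    ContinuousOn (fun p => integralTop (X := X) (η p)) A :=
  _root_.continuousOn_integralTop fun e he => (h e he).continuousOn

namespace KahlerForm

variable (κ : KahlerForm n X)

/-- The density whose integral is the integrand of the Landau-Hall functional, for a path with
position `u` and velocity `D`. -/
def lagrangian (u D : X → ℝ) (e : OpenPartialHomeomorph X (Fin n → ℂ)) (w : Fin n → ℂ) : ℝ :=
  (1 / 2) * (D (e.symm w) ^ 2 * κ.MA u e w) + D (e.symm w) * κ.MA D e w

/-- The derivative of the density `lagrangian` in the direction `v` of the positions and `E` of the
velocities. -/
def lagrangianDeriv (u D v E : X → ℝ) (e : OpenPartialHomeomorph X (Fin n → ℂ))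
    (w : Fin n → ℂ) : ℝ :=
  (D (e.symm w) * (E (e.symm w) * κ.MA u e w) +
    (1 / 2 * (n / κ.vol)) * (D (e.symm w) * D (e.symm w) *
      wedgeDensity (slots₁ (ddcCoeff v e w) (κ.perturb u e w)))) +
  (E (e.symm w) * κ.MA D e w +
    (n / κ.vol) * (D (e.symm w) * wedgeDensity (slots₁ (ddcCoeff E e w) (κ.perturb D e w))))

/-- The difference of the two sides of the magnetic geodesic equation. -/
def eulerLagrange (φ : ℝ → X → ℝ) (t : ℝ) (e : OpenPartialHomeomorph X (Fin n → ℂ))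
    (w : Fin n → ℂ) : ℝ :=
  dot (dot φ) t (e.symm w) * κ.MA (φ t) e w -
    ((n / κ.vol) * wedgeDensity
        (slots₁ (dWedgeDcCoeff (dot φ t) e w) (κ.perturb (φ t) e w)) -
    (2 * n / κ.vol) * wedgeDensity
        (slots₁ (ddcCoeff (dot (dot φ) t) e w) (κ.perturb (dot φ t) e w)) -
    (n * (n - 1) / κ.vol) * wedgeDensity
        (slots₂ (ddcCoeff (dot φ t) e w) (ddcCoeff (dot (dot φ) t) e w)
          (κ.perturb (dot φ t) e w)))

lemma magneticGeodesicEq_iff (φ : ℝ → X → ℝ) :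
    κ.MagneticGeodesicEq φ ↔ ∀ t ∈ Icc (0 : ℝ) 1, ∀ e ∈ atlas (Fin n → ℂ) X, ∀ w ∈ e.target,
      κ.eulerLagrange φ t e w = 0 := by
  simp only [MagneticGeodesicEq, eulerLagrange, sub_eq_zero]

section

variable {P : Type*} [NormedAddCommGroup P] [NormedSpace ℝ P] {A : Set P}

lemma smoothDensities_MA (hA : IsParamSet A) {u : P → X → ℝ} (hu : SmoothFamily n A u) :
    SmoothDensities A fun p e w => κ.MA (u p) e w := fun _ he => hu.MA κ hA he

lemma smoothDensities_lagrangian (hA : IsParamSet A) {u D : P → X → ℝ}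
    (hu : SmoothFamily n A u) (hD : SmoothFamily n A D) :
    SmoothDensities A fun p e w => κ.lagrangian (u p) (D p) e w := fun e he =>
  (contDiffOn_const.mul (((hD e he).pow 2).mul (hu.MA κ hA he))).add
    ((hD e he).mul (hD.MA κ hA he))

lemma smoothDensities_lagrangianDeriv (hA : IsParamSet A) {u D v E : P → X → ℝ}
    (hu : SmoothFamily n A u) (hD : SmoothFamily n A D)
    (hv : SmoothFamily n A v) (hE : SmoothFamily n A E) :
    SmoothDensities A fun p e w => κ.lagrangianDeriv (u p) (D p) (v p) (E p) e w :=
  ((hD.fun_mul (hE.fun_mul (κ.smoothDensities_MA hA hu))).add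
    (((hD.mul hD).fun_mul (hu.wedge_ddc hA κ hv)).const_mul _)).add
  ((hE.fun_mul (κ.smoothDensities_MA hA hD)).add ((hD.fun_mul (hD.wedge_ddc hA κ hE)).const_mul _))

lemma hasDerivAt_lagrangian (hA : IsParamSet A) {u D : P → X → ℝ}
    (hu : SmoothFamily n A u) (hD : SmoothFamily n A D) {c : ℝ → P} {a : P} {r : ℝ}
    (hc : IsLine A c a r) {e : OpenPartialHomeomorph X (Fin n → ℂ)}
    (he : e ∈ atlas (Fin n → ℂ) X) {w : Fin n → ℂ} (hw : w ∈ e.target) :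
    HasDerivAt (fun s => κ.lagrangian (u (c s)) (D (c s)) e w)
      (κ.lagrangianDeriv (u (c r)) (D (c r)) (paramDeriv A a u (c r)) (paramDeriv A a D (c r))
        e w) r := by
  have hDd := hD.hasDerivAt hc (e.symm w)
  refine ((((hDd.pow 2).mul (hu.hasDerivAt_MA κ hA hc he hw)).const_mul (1 / 2 : ℝ)).add
    (hDd.mul (hD.hasDerivAt_MA κ hA hc he hw))).congr_deriv ?_
  simp only [lagrangianDeriv, Nat.cast_ofNat, Pi.pow_apply]
  ring

end

lemma landauHall_eq {φ : ℝ → X → ℝ} (hφ : SmoothFamily n (Icc 0 1) φ) :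
    κ.landauHall φ = ∫ t in Icc (0 : ℝ) 1,
      integralTop (X := X) (κ.lagrangian (φ t) (dot φ t)) := by
  have h1 : SmoothDensities (X := X) (n := n) (Icc (0 : ℝ) 1) fun t e w =>
      dot φ t (e.symm w) ^ 2 * κ.MA (φ t) e w := fun e he =>
    ((hφ.dot e he).pow 2).mul (hφ.MA κ isParamSet_Icc he)
  have h2 : SmoothDensities (X := X) (n := n) (Icc (0 : ℝ) 1) fun t e w =>
      dot φ t (e.symm w) * κ.MA (dot φ t) e w :=
    hφ.dot.fun_mul (κ.smoothDensities_MA isParamSet_Icc hφ.dot)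
  have hi1 := h1.continuousOn_integralTop.integrableOn_compact (μ := volume) isCompact_Icc
  have hi2 := h2.continuousOn_integralTop.integrableOn_compact (μ := volume) isCompact_Icc
  rw [landauHall, intervalIntegral.integral_of_le zero_le_one,
    intervalIntegral.integral_of_le zero_le_one, ← integral_Icc_eq_integral_Ioc,
    ← integral_Icc_eq_integral_Ioc, ← integral_const_mul, ← integral_add (hi1.const_mul _) hi2]
  refine setIntegral_congr_fun measurableSet_Icc fun t ht => ?_
  rw [← integralTop_const_mul,
    ← integralTop_add ((h1.const_mul _).isContDensity ht) (h2.isContDensity ht)]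
  rfl

/-- The functional may be differentiated under the integral signs; `ψ` is the variation field. The
derivative of the velocity is the velocity of `ψ`, as mixed derivatives agree. -/
lemma hasDerivAt_landauHall {ε : ℝ} (hε : 0 < ε) {Φ : ℝ → ℝ → X → ℝ} {ψ : ℝ → X → ℝ}
    (hΦ : SmoothFamily n (Ioo (-ε) ε ×ˢ Icc (0 : ℝ) 1) fun p : ℝ × ℝ => Φ p.1 p.2)
    (hψ : ∀ t, ψ t = paramDeriv (Ioo (-ε) ε ×ˢ Icc (0 : ℝ) 1) (1, 0)
      (fun p : ℝ × ℝ => Φ p.1 p.2) (0, t)) :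
    SmoothFamily n (Icc 0 1) ψ ∧
    HasDerivAt (fun s => κ.landauHall (Φ s)) (∫ t in Icc (0 : ℝ) 1, integralTop (X := X)
      (κ.lagrangianDeriv (Φ 0 t) (dot (Φ 0) t) (ψ t) (dot ψ t))) 0 := by
  set A := Ioo (-ε) ε ×ˢ Icc (0 : ℝ) 1
  have hA : IsParamSet A := isParamSet_Ioo_prod_Icc hε
  set u : ℝ × ℝ → X → ℝ := fun p => Φ p.1 p.2
  set D := paramDeriv A (0, 1) u
  set Ψ := paramDeriv A (1, 0) u
  have hD : SmoothFamily n A D := hΦ.paramDeriv hA _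
  have hΨ : SmoothFamily n A Ψ := hΦ.paramDeriv hA _
  have hDΨ : SmoothFamily n A (paramDeriv A (1, 0) D) := hD.paramDeriv hA _
  have h0 : (0 : ℝ) ∈ Ioo (-ε) ε := ⟨by linarith, hε⟩
  have hsl : ∀ s ∈ Ioo (-ε) ε, ContDiffOn ℝ ∞ (fun t : ℝ => (s, t)) (Icc (0 : ℝ) 1) :=
    fun s _ => contDiffOn_const.prodMk contDiffOn_id
  have hm : ∀ s ∈ Ioo (-ε) ε, MapsTo (fun t : ℝ => (s, t)) (Icc (0 : ℝ) 1) A :=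
    fun s hs t ht => ⟨hs, ht⟩
  have hψs : SmoothFamily n (Icc 0 1) ψ := by
    refine (hΨ.comp (hsl 0 h0) (hm 0 h0)).congr fun t _ x => ?_
    rw [hψ]
  refine ⟨hψs, ?_⟩
  have hDdot : ∀ s ∈ Ioo (-ε) ε, ∀ t ∈ Icc (0 : ℝ) 1, D (s, t) = dot (Φ s) t :=
    fun s hs t ht => funext fun x => (dot_eq_paramDeriv_right hΦ hs ht x).symm
  have hEdot : ∀ t ∈ Icc (0 : ℝ) 1, paramDeriv A (1, 0) D (0, t) = dot ψ t := by
    intro t ht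
    funext x
    have hq : ((0 : ℝ), t) ∈ A := ⟨h0, ht⟩
    have hcl : ((0 : ℝ), t) ∈ closure (interior A) := by
      rw [hA.convex.closure_interior_eq_closure_of_nonempty_interior hA.nonempty]
      exact subset_closure hq
    have h1 := dot_eq_paramDeriv_right hΨ h0 ht x
    have h2 : dot (fun t => Ψ (0, t)) t x = dot ψ t x := by
      have : (fun t => Ψ (0, t)) = ψ := by funext t; rw [hψ]
      rw [this]
    rw [← h2, h1]
    exact fderivWithin_apply_comm hA.uniqueDiffOn (hΦ.contDiffOn_param x) hq hcl _ _
  have hJ := (κ.smoothDensities_lagrangian hA hΦ hD)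
  have hJ' := (κ.smoothDensities_lagrangianDeriv hA hΦ hD hΨ hDΨ)
  have hpull : ∀ {η : ℝ × ℝ → OpenPartialHomeomorph X (Fin n → ℂ) → (Fin n → ℂ) → ℝ},
      SmoothDensities A η → ∀ t ∈ Icc (0 : ℝ) 1, ∀ e ∈ atlas (Fin n → ℂ) X,
      ContinuousOn (fun q : ℝ × (Fin n → ℂ) => η (q.1, t) e q.2) (Ioo (-ε) ε ×ˢ e.target) := by
    intro η hη t ht e he
    exact (hη e he).continuousOn.comp (f := fun q : ℝ × (Fin n → ℂ) => ((q.1, t), q.2))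
      (by fun_prop) fun q hq => ⟨⟨hq.1, ht⟩, hq.2⟩
  have hder := hasDerivAt_integral_compact (μ := volume) isCompact_Icc (a := -ε) (b := ε) (r := 0)
    (K := Icc (0 : ℝ) 1)
    (G := fun s t => integralTop (X := X) (κ.lagrangian (u (s, t)) (D (s, t))))
    (G' := fun s t => integralTop (X := X) (κ.lagrangianDeriv (u (s, t)) (D (s, t)) (Ψ (s, t))
      (paramDeriv A (1, 0) D (s, t))))
    hJ.continuousOn_integralTop hJ'.continuousOn_integralTop
    (fun s hs t ht => hasDerivAt_integralTop (a := -ε) (b := ε)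
      (η := fun s => κ.lagrangian (u (s, t)) (D (s, t)))
      (η' := fun s => κ.lagrangianDeriv (u (s, t)) (D (s, t)) (Ψ (s, t))
        (paramDeriv A (1, 0) D (s, t)))
      (hpull hJ t ht) (hpull hJ' t ht)
      (fun e he r hr w hw => κ.hasDerivAt_lagrangian hA hΦ hD (isLine_left hr ht) he hw) hs) h0
  refine (hder.congr_deriv ?_).congr_of_eventuallyEq ?_
  · refine setIntegral_congr_fun measurableSet_Icc fun t ht => ?_
    simp only [hDdot 0 h0 t ht, hEdot t ht, hψ, u, Ψ]
  · filter_upwards [isOpen_Ioo.mem_nhds h0] with s hs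
    rw [κ.landauHall_eq (hΦ.comp (hsl s hs) (hm s hs))]
    refine setIntegral_congr_fun measurableSet_Icc fun t ht => ?_
    simp only [hDdot s hs t ht, u]

variable [IsManifold 𝓘(ℂ, Fin n → ℂ) ω X]

/-- Green's formula for the form `ω + ddᶜu`. The factor `n` covers the dimension `0`, where no slot
is left for `ddᶜv`. -/
lemma green (u : X → ℝ) (hu : SmoothFn n u) {v v' : X → ℝ} (hv : SmoothFn n v)
    (hv' : SmoothFn n v') (c : ℝ) :
    integralTop (X := X) (fun e w => (n * c) * (v' (e.symm w) *
        wedgeDensity (slots₁ (ddcCoeff v e w) (κ.perturb u e w)))) =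
      integralTop (X := X) (fun e w => (n * c) * (v (e.symm w) *
        wedgeDensity (slots₁ (ddcCoeff v' e w) (κ.perturb u e w)))) := by
  rw [integralTop_const_mul, integralTop_const_mul]
  rcases Nat.eq_zero_or_pos n with rfl | hn
  · simp
  have : NeZero n := ⟨hn.ne'⟩
  rw [integralTop_green hv hv' (IsClosedForm.perturb (κ := κ) hu)]

lemma smoothDensities_eulerLagrange {φ : ℝ → X → ℝ} (hφ : SmoothFamily n (Icc 0 1) φ) :
    SmoothDensities (Icc (0 : ℝ) 1) (κ.eulerLagrange φ) :=
  (hφ.dot.dot.fun_mul (κ.smoothDensities_MA isParamSet_Icc hφ)).sub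
    ((((hφ.wedge_grad isParamSet_Icc κ hφ.dot).const_mul _).sub
      ((hφ.dot.wedge_ddc isParamSet_Icc κ hφ.dot.dot).const_mul _)).sub
      ((hφ.dot.wedge_ddc₂ isParamSet_Icc κ hφ.dot hφ.dot.dot).const_mul _))

/-- Green's formula and integration by parts in time turn the first variation in the direction of a
family `ψ` which vanishes at both ends into the integral of `ψ` against the equation. -/
lemma integral_lagrangianDeriv {φ ψ : ℝ → X → ℝ} (hφ : SmoothFamily n (Icc 0 1) φ)
    (hψ : SmoothFamily n (Icc 0 1) ψ) (h0 : ∀ x, ψ 0 x = 0) (h1 : ∀ x, ψ 1 x = 0) :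
    ∫ t in Icc (0 : ℝ) 1, integralTop (X := X)
      (κ.lagrangianDeriv (φ t) (dot φ t) (ψ t) (dot ψ t)) =
    -∫ t in Icc (0 : ℝ) 1, integralTop (X := X)
      fun e w => ψ t (e.symm w) * κ.eulerLagrange φ t e w := by
  have hI := isParamSet_Icc
  have hφ1 := hφ.dot
  have hφ2 := hφ1.dot
  have hψ1 := hψ.dot
  -- the momentum, paired with `ψ`, and its derivative in time
  set mom : ℝ → OpenPartialHomeomorph X (Fin n → ℂ) → (Fin n → ℂ) → ℝ := fun t e w =>
    dot φ t (e.symm w) * κ.MA (φ t) e w + κ.MA (dot φ t) e w +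
      κ.vol⁻¹ * (n * wedgeDensity (slots₁ (ddcCoeff (dot φ t) e w) (κ.perturb (dot φ t) e w)))
  set mom' : ℝ → OpenPartialHomeomorph X (Fin n → ℂ) → (Fin n → ℂ) → ℝ := fun t e w =>
    dot (dot φ) t (e.symm w) * κ.MA (φ t) e w +
      (n / κ.vol) * (dot φ t (e.symm w) *
        wedgeDensity (slots₁ (ddcCoeff (dot φ t) e w) (κ.perturb (φ t) e w))) +
      (2 * n / κ.vol) *
        wedgeDensity (slots₁ (ddcCoeff (dot (dot φ) t) e w) (κ.perturb (dot φ t) e w)) +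
      (n * (n - 1) / κ.vol) * wedgeDensity (slots₂ (ddcCoeff (dot φ t) e w)
        (ddcCoeff (dot (dot φ) t) e w) (κ.perturb (dot φ t) e w))
  have hmom : SmoothDensities (Icc (0 : ℝ) 1) mom :=
    ((hφ1.fun_mul (κ.smoothDensities_MA hI hφ)).add (κ.smoothDensities_MA hI hφ1)).add
      (((hφ1.wedge_ddc hI κ hφ1).const_mul _).const_mul _)
  have hmom' : SmoothDensities (Icc (0 : ℝ) 1) mom' :=
    (((hφ2.fun_mul (κ.smoothDensities_MA hI hφ)).add
      ((hφ1.fun_mul (hφ.wedge_ddc hI κ hφ1)).const_mul _)).add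
      ((hφ1.wedge_ddc hI κ hφ2).const_mul _)).add ((hφ1.wedge_ddc₂ hI κ hφ1 hφ2).const_mul _)
  set S : ℝ → OpenPartialHomeomorph X (Fin n → ℂ) → (Fin n → ℂ) → ℝ := fun t e w =>
    dot ψ t (e.symm w) * mom t e w + ψ t (e.symm w) * mom' t e w
  have hS : SmoothDensities (Icc (0 : ℝ) 1) S := (hψ1.fun_mul hmom).add (hψ.fun_mul hmom')
  have hmomd : ∀ e ∈ atlas (Fin n → ℂ) X, ∀ t ∈ Ioo (0 : ℝ) 1, ∀ w ∈ e.target,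
      HasDerivAt (fun t => mom t e w) (mom' t e w) t := by
    intro e he t ht w hw
    have hl := isLine_id ht
    refine ((((hφ1.hasDerivAt hl (e.symm w)).mul (hφ.hasDerivAt_MA κ hI hl he hw)).add
      (hφ1.hasDerivAt_MA κ hI hl he hw)).add ((hasDerivAt_wedgeDensity_slots₁
        (fun i j => hφ1.hasDerivAt_ddcCoeff hI hl he hw i j)
        (fun i j => hφ1.hasDerivAt_perturb κ hI hl he hw i j)).const_mul κ.vol⁻¹)).congr_deriv ?_
    simp only [← dot_eq_paramDeriv, mom']
    ring
  have hibp : ∫ t in Icc (0 : ℝ) 1, integralTop (X := X) (S t) = 0 := by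
    have hP : SmoothDensities (Icc (0 : ℝ) 1) fun t e w => ψ t (e.symm w) * mom t e w :=
      hψ.fun_mul hmom
    have hmono : ∀ {η : ℝ → OpenPartialHomeomorph X (Fin n → ℂ) → (Fin n → ℂ) → ℝ},
        SmoothDensities (Icc (0 : ℝ) 1) η → ∀ e ∈ atlas (Fin n → ℂ) X,
        ContinuousOn (fun q : ℝ × (Fin n → ℂ) => η q.1 e q.2) (Ioo 0 1 ×ˢ e.target) :=
      fun hη e he => (hη e he).continuousOn.mono (prod_mono_left Ioo_subset_Icc_self)
    rw [integral_Icc_eq_integral_Ioc, ← intervalIntegral.integral_of_le zero_le_one,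
      intervalIntegral.integral_eq_sub_of_hasDerivAt_of_le zero_le_one
        hP.continuousOn_integralTop
        (fun t ht => hasDerivAt_integralTop (η := fun t e w => ψ t (e.symm w) * mom t e w)
          (η' := S) (hmono hP) (hmono hS)
          (fun e he r hr w hw => (hψ.hasDerivAt (isLine_id hr) _).mul (hmomd e he r hr w hw)) ht)
        (hS.continuousOn_integralTop.intervalIntegrable_of_Icc zero_le_one)]
    have hz : ∀ t, (∀ x, ψ t x = 0) →
        integralTop (X := X) (fun e w => ψ t (e.symm w) * mom t e w) = 0 := by
      intro t ht
      simp only [ht, zero_mul]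
      simpa using integralTop_const_mul (X := X) 0 fun _ (_ : Fin n → ℂ) => 0
    rw [hz 0 h0, hz 1 h1, sub_zero]
  have hEL : SmoothDensities (Icc (0 : ℝ) 1) fun t e w =>
      ψ t (e.symm w) * κ.eulerLagrange φ t e w :=
    hψ.fun_mul (κ.smoothDensities_eulerLagrange hφ)
  have hL := κ.smoothDensities_lagrangianDeriv hI hφ hφ1 hψ hψ1
  have hsq := hφ1.mul hφ1
  -- the four terms which Green's formula exchanges
  set c := κ.vol⁻¹
  have a1 : SmoothDensities (Icc (0 : ℝ) 1) fun t (e : OpenPartialHomeomorph X (Fin n → ℂ)) w =>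
      (n * (1 / 2 * c)) * (ψ t (e.symm w) * wedgeDensity
        (slots₁ (ddcCoeff (fun x => dot φ t x * dot φ t x) e w) (κ.perturb (φ t) e w))) :=
    (hψ.fun_mul (hφ.wedge_ddc hI κ hsq)).const_mul _
  have a2 : SmoothDensities (Icc (0 : ℝ) 1) fun t (e : OpenPartialHomeomorph X (Fin n → ℂ)) w =>
      (n * c) * (dot ψ t (e.symm w) * wedgeDensity
        (slots₁ (ddcCoeff (dot φ t) e w) (κ.perturb (dot φ t) e w))) :=
    (hψ1.fun_mul (hφ1.wedge_ddc hI κ hφ1)).const_mul _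
  have b1 : SmoothDensities (Icc (0 : ℝ) 1) fun t (e : OpenPartialHomeomorph X (Fin n → ℂ)) w =>
      (n * (1 / 2 * c)) * ((dot φ t (e.symm w) * dot φ t (e.symm w)) * wedgeDensity
        (slots₁ (ddcCoeff (ψ t) e w) (κ.perturb (φ t) e w))) :=
    (hsq.fun_mul (hφ.wedge_ddc hI κ hψ)).const_mul _
  have b2 : SmoothDensities (Icc (0 : ℝ) 1) fun t (e : OpenPartialHomeomorph X (Fin n → ℂ)) w =>
      (n * c) * (dot φ t (e.symm w) * wedgeDensity
        (slots₁ (ddcCoeff (dot ψ t) e w) (κ.perturb (dot φ t) e w))) :=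
    (hφ1.fun_mul (hφ1.wedge_ddc hI κ hψ1)).const_mul _
  have hpt : ∀ t ∈ Icc (0 : ℝ) 1, integralTop (X := X)
      (κ.lagrangianDeriv (φ t) (dot φ t) (ψ t) (dot ψ t)) =
      integralTop (X := X) (S t) -
        integralTop (X := X) fun e w => ψ t (e.symm w) * κ.eulerLagrange φ t e w := by
    intro t ht
    have g1 := κ.green (φ t) (hφ.smoothFn ht) (hsq.smoothFn ht) (hψ.smoothFn ht) (1 / 2 * c)
    have g2 := κ.green (dot φ t) (hφ1.smoothFn ht) (hφ1.smoothFn ht) (hψ1.smoothFn ht) c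
    have hLE := integralTop_add (hL.isContDensity ht) (hEL.isContDensity ht)
    have hLE1 := integralTop_add ((hL.add hEL).isContDensity ht) (a1.isContDensity ht)
    have hLE2 := integralTop_add (((hL.add hEL).add a1).isContDensity ht) (a2.isContDensity ht)
    have hR1 := integralTop_add (hS.isContDensity ht) (b1.isContDensity ht)
    have hR2 := integralTop_add ((hS.add b1).isContDensity ht) (b2.isContDensity ht)
    have hid := integralTop_congr (X := X) (η := fun e w =>
        κ.lagrangianDeriv (φ t) (dot φ t) (ψ t) (dot ψ t) e w +
          ψ t (e.symm w) * κ.eulerLagrange φ t e w +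
          (n * (1 / 2 * c)) * (ψ t (e.symm w) * wedgeDensity
            (slots₁ (ddcCoeff (fun x => dot φ t x * dot φ t x) e w) (κ.perturb (φ t) e w))) +
          (n * c) * (dot ψ t (e.symm w) * wedgeDensity
            (slots₁ (ddcCoeff (dot φ t) e w) (κ.perturb (dot φ t) e w))))
      (η' := fun e w => S t e w +
          (n * (1 / 2 * c)) * ((dot φ t (e.symm w) * dot φ t (e.symm w)) * wedgeDensity
            (slots₁ (ddcCoeff (ψ t) e w) (κ.perturb (φ t) e w))) +
          (n * c) * (dot φ t (e.symm w) * wedgeDensity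
            (slots₁ (ddcCoeff (dot ψ t) e w) (κ.perturb (dot φ t) e w)))) ?_
    · linarith
    · intro e he w hw
      have hsq' : (n : ℝ) * wedgeDensity (slots₁ (ddcCoeff (fun x => dot φ t x * dot φ t x) e w)
          (κ.perturb (φ t) e w)) = n * (2 * (dot φ t (e.symm w) * wedgeDensity
            (slots₁ (ddcCoeff (dot φ t) e w) (κ.perturb (φ t) e w)))) +
          n * (2 * wedgeDensity
            (slots₁ (dWedgeDcCoeff (dot φ t) e w) (κ.perturb (φ t) e w))) := by
        rcases Nat.eq_zero_or_pos n with rfl | hn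
        · simp
        have : NeZero n := ⟨hn.ne'⟩
        have h2 := cHess_sq (((hφ1.smoothFn ht).contDiffAt he hw).of_le two_le_infty)
        have h3 : ddcCoeff (fun x => dot φ t x * dot φ t x) e w =
            (2 * (dot φ t (e.symm w) : ℂ)) • ddcCoeff (dot φ t) e w +
              (2 : ℂ) • dWedgeDcCoeff (dot φ t) e w := by
          rw [ddcCoeff, ddcCoeff, dWedgeDcCoeff, ← h2]
          congr 1
          funext v
          ring
        rw [h3, wedgeDensity, mixedDet_slots₁_lin, wedgeDensity, wedgeDensity]
        have h4 : (2 * (dot φ t (e.symm w) : ℂ)) = ((2 * dot φ t (e.symm w) : ℝ) : ℂ) := by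
          push_cast; ring
        rw [h4, Complex.add_re, Complex.re_ofReal_mul, show (2 : ℂ) = ((2 : ℝ) : ℂ) by norm_num,
          Complex.re_ofReal_mul]
        ring
      simp only [lagrangianDeriv, eulerLagrange, S, mom, mom']
      have : (n : ℝ) * (1 / 2 * c) * (ψ t (e.symm w) * wedgeDensity
          (slots₁ (ddcCoeff (fun x => dot φ t x * dot φ t x) e w) (κ.perturb (φ t) e w))) =
          (1 / 2 * c) * ψ t (e.symm w) * (n * wedgeDensity
            (slots₁ (ddcCoeff (fun x => dot φ t x * dot φ t x) e w) (κ.perturb (φ t) e w))) := by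
        ring
      rw [this, hsq']
      simp only [div_eq_mul_inv]
      ring
  rw [setIntegral_congr_fun measurableSet_Icc hpt, integral_sub
    (hS.continuousOn_integralTop.integrableOn_compact isCompact_Icc)
    (hEL.continuousOn_integralTop.integrableOn_compact isCompact_Icc), hibp, zero_sub]

end KahlerForm

end FirstVariation

/-! ### Magnetic geodesics and the magnetic geodesic equation -/

section Positivity

variable {n : ℕ}

lemma isHermitian_cHess {u : (Fin n → ℂ) → ℝ} {w : Fin n → ℂ} (hu : ContDiffAt ℝ 2 u w) :
    (cHess u w).IsHermitian := by
  ext i j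
  have hs : ∀ k, wirtBar k (fun v => (u v : ℂ)) =
      fun v => star (wirt k (fun v => (u v : ℂ)) v) := by
    intro k
    funext v
    have h : (fun v => (u v : ℂ)) = fun v => star (u v : ℂ) := by
      funext v; exact (Complex.conj_ofReal _).symm
    conv_lhs => rw [h]
    exact (wirt_star k).2
  simp only [Matrix.conjTranspose_apply, cHess, Matrix.of_apply]
  rw [hs i, (wirt_star j).1, star_star]
  exact (wirt_wirtBar_comm (contDiffAt_ofReal hu) i j).symm

/-- Positivity is an open condition among hermitian matrices. -/
lemma eventually_posDef {Z : Type*} [TopologicalSpace Z] {s : Set Z} {z₀ : Z}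
    {M : Z → Matrix (Fin n) (Fin n) ℂ} (hM : ∀ i j, ContinuousWithinAt (fun z => M z i j) s z₀)
    (hh : ∀ z ∈ s, (M z).IsHermitian) (h0 : (M z₀).PosDef) :
    ∀ᶠ z in 𝓝[s] z₀, (M z).PosDef := by
  have hK : IsCompact (Metric.sphere (0 : Fin n → ℂ) 1) := isCompact_sphere _ _
  have h1 : ∀ᶠ z in 𝓝 z₀, ∀ x ∈ Metric.sphere (0 : Fin n → ℂ) 1,
      z ∈ s → 0 < (star x ⬝ᵥ (M z *ᵥ x)).re := by
    refine hK.eventually_forall_of_forall_eventually fun x hx => ?_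
    have hx0 : x ≠ 0 := by
      rintro rfl
      simp at hx
    have hc : ContinuousWithinAt (fun q : Z × (Fin n → ℂ) => (star q.2 ⬝ᵥ (M q.1 *ᵥ q.2)).re)
        (s ×ˢ univ) (z₀, x) := by
      refine Complex.continuous_re.continuousAt.comp_continuousWithinAt ?_
      simp only [dotProduct, Matrix.mulVec]
      refine tendsto_finsetSum _ fun i _ => ?_
      refine ContinuousWithinAt.mul (f := fun q : Z × (Fin n → ℂ) => star q.2 i)
        (by fun_prop) ?_
      refine tendsto_finsetSum _ fun j _ => ?_
      refine ContinuousWithinAt.mul (f := fun q : Z × (Fin n → ℂ) => M q.1 i j) ?_ (by fun_prop)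
      exact (hM i j).comp (x := (z₀, x)) (f := Prod.fst) (by fun_prop) fun q hq => hq.1
    have hp : 0 < (star x ⬝ᵥ (M z₀ *ᵥ x)).re := (Complex.pos_iff.1 (h0.dotProduct_mulVec_pos hx0)).1
    have h2 := hc.eventually (eventually_gt_nhds hp)
    rw [eventually_nhdsWithin_iff] at h2
    filter_upwards [h2] with q hq hqs using hq ⟨hqs, mem_univ _⟩
  rw [eventually_nhdsWithin_iff]
  filter_upwards [h1] with z hz hzs
  refine Matrix.PosDef.of_dotProduct_mulVec_pos (hh z hzs) fun x hx => ?_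
  have hnx : 0 < ‖x‖ := norm_pos_iff.2 hx
  set c : ℂ := ((‖x‖⁻¹ : ℝ) : ℂ)
  have hcx : c • x ∈ Metric.sphere (0 : Fin n → ℂ) 1 := by
    rw [mem_sphere_zero_iff_norm, norm_smul, Complex.norm_real, norm_inv, norm_norm,
      inv_mul_cancel₀ hnx.ne']
  have h3 := hz (c • x) hcx hzs
  have h4 : star (c • x) ⬝ᵥ (M z *ᵥ (c • x)) =
      ((‖x‖⁻¹ ^ 2 : ℝ) : ℂ) * (star x ⬝ᵥ (M z *ᵥ x)) := by
    rw [Matrix.mulVec_smul, star_smul, smul_dotProduct, dotProduct_smul, smul_eq_mul, smul_eq_mul,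
      ← mul_assoc]
    congr 1
    simp only [c, Complex.star_def, Complex.conj_ofReal]
    push_cast
    ring
  rw [h4, Complex.re_ofReal_mul] at h3
  have h5 : (star x ⬝ᵥ (M z *ᵥ x)).im = 0 := by
    exact (hh z hzs).im_star_dotProduct_mulVec_self x
  exact Complex.pos_iff.2 ⟨pos_of_mul_pos_right h3 (by positivity), h5.symm⟩

lemma wedgeDensity_const_pos {A : Matrix (Fin n) (Fin n) ℂ} (hA : A.PosDef) :
    0 < wedgeDensity fun _ => A := by
  rw [wedgeDensity, mixedDet_const]
  have h := (Complex.pos_iff.1 hA.det_pos).1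
  have h1 : ((n.factorial : ℂ) * A.det).re = n.factorial * A.det.re := by
    simp
  rw [h1]
  have := n.factorial_pos
  have := Real.pi_pos
  positivity

variable {X : Type*} [TopologicalSpace X] [ChartedSpace (Fin n → ℂ) X]

namespace KahlerForm

variable (κ : KahlerForm n X)

lemma isHermitian_perturb {u : X → ℝ} (hu : SmoothFn n u)
    {e : OpenPartialHomeomorph X (Fin n → ℂ)} (he : e ∈ atlas (Fin n → ℂ) X)
    {w : Fin n → ℂ} (hw : w ∈ e.target) : (κ.perturb u e w).IsHermitian :=
  (κ.posDef e he w hw).isHermitian.add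
    (isHermitian_cHess (((hu e he).contDiffAt (e.open_target.mem_nhds hw)).of_le two_le_infty))

variable [IsManifold 𝓘(ℂ, Fin n → ℂ) ω X]

/-- Positivity of `ω + ddᶜu` at a point may be checked in one chart. -/
lemma posDef_perturb_of_mem {u : X → ℝ} (hu : SmoothFn n u)
    {e e' : OpenPartialHomeomorph X (Fin n → ℂ)} (he : e ∈ atlas (Fin n → ℂ) X)
    (he' : e' ∈ atlas (Fin n → ℂ) X) {x : X} (hx : x ∈ e.source ∩ e'.source)
    (h : (κ.perturb u e' (e' x)).PosDef) : (κ.perturb u e (e x)).PosDef := by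
  rw [(IsClosedForm.perturb (κ := κ) hu).form e he e' he' x hx]
  exact (posDef_pullCoeff_iff (det_transition_ne_zero he he' hx) _).2 h

variable [CompactSpace X]

/-- The space of Kähler potentials is open: small perturbations of a path stay inside it. -/
lemma exists_forall_posDef {φ ψ : ℝ → X → ℝ} (hφ : SmoothFamily n (Icc 0 1) φ)
    (hψ : SmoothFamily n (Icc 0 1) ψ) (hpos : ∀ t ∈ Icc (0 : ℝ) 1, ∀ e ∈ atlas (Fin n → ℂ) X,
      ∀ w ∈ e.target, (κ.perturb (φ t) e w).PosDef) :
    ∃ ε > 0, SmoothFamily n (Ioo (-ε) ε ×ˢ Icc (0 : ℝ) 1)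
        (fun p x => φ p.2 x + p.1 * ψ p.2 x) ∧
      ∀ s ∈ Ioo (-ε) ε, ∀ t ∈ Icc (0 : ℝ) 1, ∀ e ∈ atlas (Fin n → ℂ) X,
      ∀ w ∈ e.target, (κ.perturb (fun x => φ t x + s * ψ t x) e w).PosDef := by
  set u : ℝ × ℝ → X → ℝ := fun p x => φ p.2 x + p.1 * ψ p.2 x
  have hu : ∀ B : Set ℝ, SmoothFamily n (B ×ˢ Icc (0 : ℝ) 1) u := by
    intro B e he
    have hm : MapsTo (fun q : (ℝ × ℝ) × (Fin n → ℂ) => (q.1.2, q.2))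
        ((B ×ˢ Icc (0 : ℝ) 1) ×ˢ e.target) (Icc (0 : ℝ) 1 ×ˢ e.target) :=
      fun q hq => ⟨hq.1.2, hq.2⟩
    have hc : ContDiffOn ℝ ∞ (fun q : (ℝ × ℝ) × (Fin n → ℂ) => (q.1.2, q.2))
        ((B ×ˢ Icc (0 : ℝ) 1) ×ˢ e.target) := by fun_prop
    have hc' : ContDiffOn ℝ ∞ (fun q : (ℝ × ℝ) × (Fin n → ℂ) => q.1.1)
        ((B ×ˢ Icc (0 : ℝ) 1) ×ˢ e.target) := by fun_prop
    exact ((hφ e he).comp hc hm).add (hc'.mul ((hψ e he).comp hc hm))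
  have hA := isParamSet_Ioo_prod_Icc (ε := 1) one_pos
  have hK : IsCompact (Icc (0 : ℝ) 1 ×ˢ (univ : Set X)) := isCompact_Icc.prod isCompact_univ
  have h1 : ∀ᶠ s in 𝓝 (0 : ℝ), ∀ y ∈ Icc (0 : ℝ) 1 ×ˢ (univ : Set X), s ∈ Ioo (-1 : ℝ) 1 →
      y.1 ∈ Icc (0 : ℝ) 1 → ∃ e ∈ atlas (Fin n → ℂ) X, y.2 ∈ e.source ∧
        (κ.perturb (u (s, y.1)) e (e y.2)).PosDef := by
    refine hK.eventually_forall_of_forall_eventually ?_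
    rintro ⟨t, x⟩ ⟨ht, -⟩
    set e := chartAt (Fin n → ℂ) x
    have he : e ∈ atlas (Fin n → ℂ) X := chart_mem_atlas _ x
    have hx : x ∈ e.source := mem_chart_source _ x
    set S : Set (ℝ × ℝ × X) := {q | q.1 ∈ Ioo (-1 : ℝ) 1 ∧ q.2.1 ∈ Icc (0 : ℝ) 1 ∧ q.2.2 ∈ e.source}
    have h2 : ∀ᶠ q in 𝓝[S] ((0 : ℝ), t, x),
        (κ.perturb (u (q.1, q.2.1)) e (e q.2.2)).PosDef := by
      refine eventually_posDef (fun i j => ?_) (fun q hq => ?_) ?_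
      · have hc : ContinuousWithinAt (fun q : (ℝ × ℝ) × (Fin n → ℂ) =>
            κ.perturb (u q.1) e q.2 i j) ((Ioo (-1 : ℝ) 1 ×ˢ Icc (0 : ℝ) 1) ×ˢ e.target)
            (((0 : ℝ), t), e x) :=
          ((hu _).perturb κ hA he i j).continuousOn _ ⟨⟨by norm_num, ht⟩, e.map_source hx⟩
        refine ContinuousWithinAt.comp (x := ((0 : ℝ), t, x)) (s := S)
          (f := fun q : ℝ × ℝ × X => ((q.1, q.2.1), e q.2.2)) hc ?_
          fun q hq => ⟨⟨hq.1, hq.2.1⟩, e.map_source hq.2.2⟩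
        have hce : ContinuousAt (fun q : ℝ × ℝ × X => e q.2.2) ((0 : ℝ), t, x) :=
          ContinuousAt.comp (x := ((0 : ℝ), t, x)) (g := e) (e.continuousAt hx) (by fun_prop)
        exact ((by fun_prop : ContinuousAt (fun q : ℝ × ℝ × X => (q.1, q.2.1))
          ((0 : ℝ), t, x)).prodMk hce).continuousWithinAt
      · exact κ.isHermitian_perturb ((hu _).smoothFn ⟨hq.1, hq.2.1⟩) he (e.map_source hq.2.2)
      · have : u ((0 : ℝ), t) = φ t := by funext y; simp [u]
        simp only [this]
        exact hpos t ht e he _ (e.map_source hx)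
    rw [eventually_nhdsWithin_iff] at h2
    have h3 : ∀ᶠ q : ℝ × ℝ × X in 𝓝 ((0 : ℝ), t, x), q.2.2 ∈ e.source :=
      (continuous_snd.comp continuous_snd).continuousAt.eventually (e.open_source.mem_nhds hx)
    filter_upwards [h2, h3] with q hq hqe hs ht
    exact ⟨e, he, hqe, hq ⟨hs, ht, hqe⟩⟩
  obtain ⟨ε, hε, h4⟩ := Metric.eventually_nhds_iff.1
    (h1.and (Ioo_mem_nhds (by norm_num : (-1 : ℝ) < 0) one_pos))
  refine ⟨ε, hε, hu _, fun s hs t ht e he w hw => ?_⟩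
  obtain ⟨h5, h6⟩ := h4 (y := s) (by rw [Real.dist_eq, sub_zero]; exact abs_lt.2 hs)
  obtain ⟨e', he', hx, h7⟩ := h5 (t, e.symm w) ⟨ht, mem_univ _⟩ h6 ht
  have h8 := κ.posDef_perturb_of_mem ((hu _).smoothFn (p := (s, t)) (A := Ioo (-1 : ℝ) 1 ×ˢ Icc (0 : ℝ) 1) ⟨h6, ht⟩) he he'
    ⟨e.map_target hw, hx⟩ h7
  rwa [e.right_inv hw] at h8

variable [T2Space X]

lemma vol_pos [Nonempty X] : 0 < κ.vol := by
  obtain ⟨x⟩ := ‹Nonempty X›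
  exact integralTop_pos
    (fun e he => (ContDiffOn.wedgeDensity fun _ i j => κ.smooth e he i j).continuousOn)
    (fun e he w hw => (wedgeDensity_const_pos (κ.posDef e he w hw)).le) x
    fun e he hx => wedgeDensity_const_pos (κ.posDef e he _ (e.map_source hx))

lemma MA_pos [Nonempty X] {u : X → ℝ} {e : OpenPartialHomeomorph X (Fin n → ℂ)}
    {w : Fin n → ℂ} (h : (κ.perturb u e w).PosDef) : 0 < κ.MA u e w :=
  div_pos (wedgeDensity_const_pos h) κ.vol_pos

lemma isDensity_MA {u : X → ℝ} (hu : SmoothFn n u) : IsDensity (κ.MA u) := by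
  have h := (IsDensity.wedgeDensity (A := fun _ : Fin n => κ.perturb u)
    fun _ => (IsClosedForm.perturb (κ := κ) hu).form).const_mul κ.vol⁻¹
  convert h using 3
  rw [MA, div_eq_inv_mul]

lemma isDensity_eulerLagrange {φ : ℝ → X → ℝ} (hφ : SmoothFamily n (Icc 0 1) φ) {t : ℝ}
    (ht : t ∈ Icc (0 : ℝ) 1) : IsDensity (κ.eulerLagrange φ t) := by
  have h0 := hφ.smoothFn ht
  have h1 := hφ.dot.smoothFn ht
  have h2 := hφ.dot.dot.smoothFn ht
  have p0 := (IsClosedForm.perturb (κ := κ) h0).form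
  have p1 := (IsClosedForm.perturb (κ := κ) h1).form
  exact ((κ.isDensity_MA h0).fun_mul _).sub
    ((((IsDensity.wedgeDensity_slots₁ (IsForm.dWedgeDcCoeff h1) p0).const_mul _).sub
      ((IsDensity.wedgeDensity_slots₁ (IsForm.ddcCoeff h2) p1).const_mul _)).sub
      ((IsDensity.wedgeDensity_slots₂ (IsForm.ddcCoeff h1) (IsForm.ddcCoeff h2) p1).const_mul _))

end KahlerForm

end Positivity

section Extremals

open MeasureTheory

lemma dot_congr {Y : Type*} {φ φ' : ℝ → Y → ℝ} (h : ∀ t ∈ Icc (0 : ℝ) 1, φ t = φ' t) {t : ℝ}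
    (ht : t ∈ Icc (0 : ℝ) 1) : dot φ t = dot φ' t := by
  funext y
  exact derivWithin_congr (fun s hs => by rw [h s hs]) (by rw [h t ht])

variable {n : ℕ} {X : Type*} [TopologicalSpace X] [ChartedSpace (Fin n → ℂ) X]
  [CompactSpace X] [T2Space X]

lemma integralTop_zero : integralTop (X := X) (fun _ (_ : Fin n → ℂ) => 0) = 0 := by
  simpa using integralTop_const_mul (X := X) 0 fun _ (_ : Fin n → ℂ) => 0

namespace KahlerForm

variable (κ : KahlerForm n X)

lemma eulerLagrange_congr {φ φ' : ℝ → X → ℝ} (h : ∀ t ∈ Icc (0 : ℝ) 1, φ t = φ' t) {t : ℝ}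
    (ht : t ∈ Icc (0 : ℝ) 1) : κ.eulerLagrange φ t = κ.eulerLagrange φ' t := by
  funext e w
  have h1 : ∀ t ∈ Icc (0 : ℝ) 1, dot φ t = dot φ' t := fun t ht => dot_congr h ht
  simp only [eulerLagrange, h t ht, h1 t ht, dot_congr h1 ht]

variable [IsManifold 𝓘(ℂ, Fin n → ℂ) ω X]

/-- The first variation formula: at the centre of a variation with fixed end points, the derivative
of the functional is the integral of the variation field against the equation. -/
lemma exists_hasDerivAt_landauHall {ε : ℝ} (hε : 0 < ε) {φ : ℝ → X → ℝ} {Φ : ℝ → ℝ → X → ℝ}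
    (hΦ : SmoothFamily n (Ioo (-ε) ε ×ˢ Icc (0 : ℝ) 1) fun p : ℝ × ℝ => Φ p.1 p.2)
    (hzero : ∀ t ∈ Icc (0 : ℝ) 1, Φ 0 t = φ t)
    (h0 : ∀ s ∈ Ioo (-ε) ε, Φ s 0 = φ 0) (h1 : ∀ s ∈ Ioo (-ε) ε, Φ s 1 = φ 1) :
    ∃ ψ : ℝ → X → ℝ, (∀ t ∈ Icc (0 : ℝ) 1, ∀ x, HasDerivAt (fun s => Φ s t x) (ψ t x) 0) ∧
      HasDerivAt (fun s => κ.landauHall (Φ s)) (-∫ t in Icc (0 : ℝ) 1, integralTop (X := X)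
        fun e w => ψ t (e.symm w) * κ.eulerLagrange φ t e w) 0 := by
  have h0m : (0 : ℝ) ∈ Ioo (-ε) ε := ⟨by linarith, hε⟩
  set ψ : ℝ → X → ℝ := fun t => paramDeriv (Ioo (-ε) ε ×ˢ Icc (0 : ℝ) 1) (1, 0)
      (fun p : ℝ × ℝ => Φ p.1 p.2) (0, t)
  have hψ : ∀ t ∈ Icc (0 : ℝ) 1, ∀ x, HasDerivAt (fun s => Φ s t x) (ψ t x) 0 := fun t ht x =>
    hΦ.hasDerivAt (isLine_left h0m ht) x
  have hend : ∀ t ∈ Icc (0 : ℝ) 1, (∀ s ∈ Ioo (-ε) ε, Φ s t = φ t) → ∀ x, ψ t x = 0 := by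
    intro t ht h x
    refine (hψ t ht x).unique ((hasDerivAt_const (0 : ℝ) (φ t x)).congr_of_eventuallyEq ?_)
    filter_upwards [isOpen_Ioo.mem_nhds h0m] with s hs
    rw [h s hs]
  refine ⟨ψ, hψ, ?_⟩
  obtain ⟨h2, h3⟩ := κ.hasDerivAt_landauHall hε hΦ (ψ := ψ) fun t => rfl
  have h4 : SmoothFamily n (Icc 0 1) (Φ 0) :=
    hΦ.comp (f := fun t => ((0 : ℝ), t)) (B := Icc 0 1) (contDiffOn_const.prodMk contDiffOn_id)
      fun t ht => ⟨h0m, ht⟩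
  rw [κ.integral_lagrangianDeriv h4 h2 (hend 0 (by norm_num) h0) (hend 1 (by norm_num) h1)] at h3
  convert h3 using 2
  refine setIntegral_congr_fun measurableSet_Icc fun t ht => ?_
  simp only [κ.eulerLagrange_congr hzero ht]

lemma isMagneticGeodesic_of_eq {φ : ℝ → X → ℝ} (hφ : κ.IsPath φ)
    (h : κ.MagneticGeodesicEq φ) : κ.IsMagneticGeodesic φ := by
  rw [magneticGeodesicEq_iff] at h
  refine ⟨hφ, fun ε Φ hΦ => ?_⟩
  obtain ⟨ψ, -, hd⟩ := κ.exists_hasDerivAt_landauHall hΦ.pos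
    (smoothFamily_of_contMDiffOn₂ hΦ.smooth) hΦ.zero hΦ.left hΦ.right
  refine hd.congr_deriv ?_
  rw [neg_eq_zero]
  refine setIntegral_eq_zero_of_forall_eq_zero fun t ht => ?_
  rw [← integralTop_zero (n := n) (X := X)]
  exact integralTop_congr fun e he w hw => by rw [h t ht e he w hw, mul_zero]

/-- The quotient of the equation by the volume form `MA(φ)`: a function on `X`. -/
def eulerLagrangeFn (φ : ℝ → X → ℝ) (t : ℝ) (x : X) : ℝ :=
  κ.eulerLagrange φ t (chartAt (Fin n → ℂ) x) (chartAt (Fin n → ℂ) x x) /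
    κ.MA (φ t) (chartAt (Fin n → ℂ) x) (chartAt (Fin n → ℂ) x x)

lemma eulerLagrangeFn_symm {φ : ℝ → X → ℝ} (hφ : SmoothFamily n (Icc 0 1) φ) {t : ℝ}
    (ht : t ∈ Icc (0 : ℝ) 1) {e : OpenPartialHomeomorph X (Fin n → ℂ)}
    (he : e ∈ atlas (Fin n → ℂ) X) {w : Fin n → ℂ} (hw : w ∈ e.target) :
    κ.eulerLagrangeFn φ t (e.symm w) = κ.eulerLagrange φ t e w / κ.MA (φ t) e w := by
  set x := e.symm w
  have hx : x ∈ e.source ∩ (chartAt (Fin n → ℂ) x).source :=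
    ⟨e.map_target hw, mem_chart_source _ x⟩
  have hdet := det_transition_ne_zero he (chart_mem_atlas _ x) hx
  have h1 := κ.isDensity_eulerLagrange hφ ht e he _ (chart_mem_atlas _ x) x hx
  have h2 := κ.isDensity_MA (hφ.smoothFn ht) e he _ (chart_mem_atlas _ x) x hx
  rw [e.right_inv hw] at h1 h2 hdet
  rw [eulerLagrangeFn, h1, h2, mul_div_mul_left]
  exact pow_ne_zero 2 (norm_ne_zero_iff.2 hdet)

/-- The variation in the direction of the equation, divided by the volume form `MA(φ)` and multiplied
by the cut-off `t (1 - t)` in time, shows that an extremal satisfies the equation. -/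
lemma eq_of_isMagneticGeodesic [Nonempty X] {φ : ℝ → X → ℝ} (h : κ.IsMagneticGeodesic φ) :
    κ.MagneticGeodesicEq φ := by
  obtain ⟨hφ, h⟩ := h
  have hs : SmoothFamily n (Icc 0 1) φ := smoothFamily_of_contMDiffOn hφ.smooth
  have hI := isParamSet_Icc
  have hMA : ∀ t ∈ Icc (0 : ℝ) 1, ∀ e ∈ atlas (Fin n → ℂ) X, ∀ w ∈ e.target,
      0 < κ.MA (φ t) e w := fun t ht e he w hw => κ.MA_pos ((hφ.mem t ht).2 e he w hw)
  have hEL := κ.smoothDensities_eulerLagrange hs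
  set f := κ.eulerLagrangeFn φ
  have hf : ∀ t ∈ Icc (0 : ℝ) 1, ∀ e ∈ atlas (Fin n → ℂ) X, ∀ w ∈ e.target,
      κ.eulerLagrange φ t e w = f t (e.symm w) * κ.MA (φ t) e w := fun t ht e he w hw => by
    simp only [f]
    rw [κ.eulerLagrangeFn_symm hs ht he hw, div_mul_cancel₀ _ (hMA t ht e he w hw).ne']
  have hfs : SmoothFamily n (Icc 0 1) f := fun e he =>
    ((hEL e he).div (hs.MA κ hI he) fun q hq => (hMA q.1 hq.1 e he q.2 hq.2).ne').congr
      fun q hq => κ.eulerLagrangeFn_symm hs hq.1 he hq.2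
  -- a variation field with fixed end points, in the direction of the equation itself
  set ψ : ℝ → X → ℝ := fun t x => (t * (1 - t)) * f t x
  have hψ : SmoothFamily n (Icc 0 1) ψ := fun e he =>
    ContDiffOn.mul (f := fun q : ℝ × (Fin n → ℂ) => q.1 * (1 - q.1)) (by fun_prop) (hfs e he)
  obtain ⟨ε, hε, hΦ, hpos⟩ := κ.exists_forall_posDef hs hψ fun t ht => (hφ.mem t ht).2
  set Φ : ℝ → ℝ → X → ℝ := fun s t x => φ t x + s * ψ t x
  have h0 : ∀ t, Φ 0 t = φ t := fun t => by funext x; simp [Φ]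
  have hl : ∀ s, Φ s 0 = φ 0 := fun s => by funext x; simp [Φ, ψ]
  have hr : ∀ s, Φ s 1 = φ 1 := fun s => by funext x; simp [Φ, ψ]
  have hvar : κ.IsVariation φ ε Φ :=
    ⟨hε, SmoothFamily.contMDiffOn₂ (u := Φ) hΦ, fun s hs' t ht =>
      ⟨(hΦ.smoothFn (p := (s, t)) ⟨hs', ht⟩).contMDiff, hpos s hs' t ht⟩, fun t _ => h0 t,
      fun s _ => hl s, fun s _ => hr s⟩
  obtain ⟨ψ', hψ', hd⟩ := κ.exists_hasDerivAt_landauHall hε (Φ := Φ) hΦ (fun t _ => h0 t)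
    (fun s _ => hl s) (fun s _ => hr s)
  have heq : ∀ t ∈ Icc (0 : ℝ) 1, ψ' t = ψ t := by
    intro t ht
    funext x
    refine (hψ' t ht x).unique ?_
    have h1 := ((hasDerivAt_id (0 : ℝ)).mul_const (ψ t x)).const_add (φ t x)
    rwa [one_mul] at h1
  have hint := neg_eq_zero.1 (hd.unique (h ε Φ hvar))
  set g : ℝ → ℝ := fun t => integralTop (X := X) fun e w =>
    ψ t (e.symm w) * κ.eulerLagrange φ t e w
  have hgd : SmoothDensities (Icc (0 : ℝ) 1) fun t e w =>
      ψ t (e.symm w) * κ.eulerLagrange φ t e w := hψ.fun_mul hEL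
  have hg0 : ∫ t in Icc (0 : ℝ) 1, g t = 0 := by
    refine Eq.trans ?_ hint
    exact setIntegral_congr_fun measurableSet_Icc fun t ht => by simp only [g, heq t ht]
  have hnn : ∀ t ∈ Icc (0 : ℝ) 1, ∀ e ∈ atlas (Fin n → ℂ) X, ∀ w ∈ e.target,
      0 ≤ ψ t (e.symm w) * κ.eulerLagrange φ t e w := by
    intro t ht e he w hw
    have h1 : ψ t (e.symm w) * κ.eulerLagrange φ t e w =
        (t * (1 - t)) * (f t (e.symm w) ^ 2 * κ.MA (φ t) e w) := by
      rw [hf t ht e he w hw]; simp only [ψ]; ring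
    rw [h1]
    exact mul_nonneg (mul_nonneg ht.1 (sub_nonneg.2 ht.2))
      (mul_nonneg (sq_nonneg _) (hMA t ht e he w hw).le)
  have hgc : ContinuousOn g (Icc 0 1) := hgd.continuousOn_integralTop
  have hgz : ∀ t ∈ Icc (0 : ℝ) 1, g t = 0 := by
    have h1 : g =ᵐ[volume.restrict (Icc 0 1)] fun _ => (0 : ℝ) :=
      (setIntegral_eq_zero_iff_of_nonneg_ae
        ((ae_restrict_iff' measurableSet_Icc).2 (Filter.Eventually.of_forall fun t ht =>
          integralTop_nonneg (hnn t ht))) (hgc.integrableOn_compact isCompact_Icc)).1 hg0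
    exact fun t ht => Measure.eqOn_Icc_of_ae_eq volume zero_ne_one h1 hgc continuousOn_const ht
  have hopen : ∀ t ∈ Ioo (0 : ℝ) 1, ∀ e ∈ atlas (Fin n → ℂ) X, ∀ w ∈ e.target,
      κ.eulerLagrange φ t e w = 0 := by
    intro t ht e he w hw
    have ht' := Ioo_subset_Icc_self ht
    by_contra hne
    have hfx : f t (e.symm w) ≠ 0 := by
      intro h0
      exact hne (by rw [hf t ht' e he w hw, h0, zero_mul])
    refine (integralTop_pos (hgd.isContDensity ht') (hnn t ht') (e.symm w) ?_).ne'
      (hgz t ht')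
    intro e' he' hx
    rw [hf t ht' e' he' _ (e'.map_source hx), e'.left_inv hx]
    have h1 := hMA t ht' e' he' _ (e'.map_source hx)
    have h2 : 0 < f t (e.symm w) ^ 2 := by positivity
    have h3 : 0 < t * (1 - t) := mul_pos ht.1 (sub_pos.2 ht.2)
    calc 0 < (t * (1 - t)) * (f t (e.symm w) ^ 2 * κ.MA (φ t) e' (e' (e.symm w))) := by positivity
      _ = _ := by simp only [ψ]; ring
  rw [magneticGeodesicEq_iff]
  intro t ht e he w hw
  have hc : ContinuousOn (fun t => κ.eulerLagrange φ t e w) (Icc 0 1) :=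
    (hEL e he).continuousOn.comp (f := fun t => (t, w)) (by fun_prop) fun t ht => ⟨ht, hw⟩
  exact EqOn.of_subset_closure (s := Ioo 0 1) (g := fun _ => (0 : ℝ))
    (fun t ht => hopen t ht e he w hw) hc continuousOn_const Ioo_subset_Icc_self
    (by rw [closure_Ioo zero_ne_one]) ht

end KahlerForm

end Extremals

/-! ### Logarithmic coordinates on the open orbit -/

section TorusExp

variable {n : ℕ}

lemma torusExp_add (v w : Fin n → ℂ) : torusExp (v + w) = torusExp v * torusExp w := by
  funext i
  ext
  simp [torusExp, Complex.exp_add]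

lemma torusLog_torusExp (w : Fin n → ℂ) : torusLog (torusExp w) = fun i => (w i).re := by
  funext i
  simp [torusLog, torusExp, Complex.norm_exp]

lemma torusExp_surjective : Function.Surjective (torusExp (n := n)) := fun z =>
  ⟨fun i => Complex.log (z i), by
    funext i
    ext
    simp [torusExp, Complex.exp_log]⟩

lemma torusExp_mem_compactTorus {w : Fin n → ℂ} (hw : ∀ i, (w i).re = 0) :
    torusExp w ∈ compactTorus n := fun i => by
  simp [torusExp, Complex.norm_exp, hw]

end TorusExp

section Orbit

variable {n : ℕ} {X : Type*} [TopologicalSpace X] [ChartedSpace (Fin n → ℂ) X]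
  [MulAction (Fin n → ℂˣ) X] {x₀ : X}

namespace IsToric

lemma continuous_smul (hX : IsToric n x₀) (x : X) : Continuous fun v : Fin n → ℂ => torusExp v • x :=
  hX.holomorphic.continuous.comp (f := fun v : Fin n → ℂ => (v, x)) (by fun_prop)

variable [IsManifold 𝓘(ℂ, Fin n → ℂ) ω X]

lemma contDiffAt_orbit (hX : IsToric n x₀) {e : OpenPartialHomeomorph X (Fin n → ℂ)}
    (he : e ∈ atlas (Fin n → ℂ) X) {x : X} {v : Fin n → ℂ} (hv : torusExp v • x ∈ e.source) :
    ContDiffAt ℂ ω (fun v => e (torusExp v • x)) v := by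
  have h1 : ContMDiffAt 𝓘(ℂ, Fin n → ℂ) 𝓘(ℂ, Fin n → ℂ) ω e (torusExp v • x) :=
    contMDiffAt_of_mem_maximalAtlas (IsManifold.subset_maximalAtlas he) hv
  have h2 : ContMDiffAt 𝓘(ℂ, Fin n → ℂ) 𝓘(ℂ, Fin n → ℂ) ω (fun v => torusExp v • x) v :=
    (hX.holomorphic (v, x)).comp v (f := fun v : Fin n → ℂ => (v, x))
      (contMDiffAt_id.prodMk contMDiffAt_const)
  exact (ContMDiffAt.comp v h1 h2).contDiffAt

lemma differentiableAt_smul (hX : IsToric n x₀) {e e' : OpenPartialHomeomorph X (Fin n → ℂ)}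
    (he : e ∈ atlas (Fin n → ℂ) X) (he' : e' ∈ atlas (Fin n → ℂ) X) {x : X} {v : Fin n → ℂ}
    (hx : x ∈ e.source) (hv : torusExp v • x ∈ e'.source) :
    DifferentiableAt ℂ (fun w => e' (torusExp v • e.symm w)) (e x) := by
  have h0 : ContMDiffAt 𝓘(ℂ, Fin n → ℂ) 𝓘(ℂ, Fin n → ℂ) ω e.symm (e x) :=
    (contMDiffOn_symm_of_mem_maximalAtlas (IsManifold.subset_maximalAtlas he)).contMDiffAt
      (e.open_target.mem_nhds (e.map_source hx))
  have h1 : ContMDiffAt 𝓘(ℂ, Fin n → ℂ) 𝓘(ℂ, Fin n → ℂ) ω e' (torusExp v • e.symm (e x)) :=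
    contMDiffAt_of_mem_maximalAtlas (IsManifold.subset_maximalAtlas he')
      (by rwa [e.left_inv hx])
  have h2 : ContMDiffAt 𝓘(ℂ, Fin n → ℂ) 𝓘(ℂ, Fin n → ℂ) ω
      (fun w => torusExp v • e.symm w) (e x) :=
    (hX.holomorphic (v, e.symm (e x))).comp (e x) (f := fun w : Fin n → ℂ => (v, e.symm w))
      (contMDiffAt_const.prodMk h0)
  exact (ContMDiffAt.comp (e x) h1 h2).contDiffAt.differentiableAt (by simp)

/-- The logarithmic coordinates are local coordinates: a vector killed by the derivative would,
by equivariance, generate a one-parameter subgroup which fixes a point of the orbit. -/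
lemma det_cJac_orbit_ne_zero (hX : IsToric n x₀) {e : OpenPartialHomeomorph X (Fin n → ℂ)}
    (he : e ∈ atlas (Fin n → ℂ) X) {v : Fin n → ℂ} (hv : torusExp v • x₀ ∈ e.source) :
    (cJac (fun v => e (torusExp v • x₀)) v).det ≠ 0 := by
  intro hdet
  obtain ⟨ξ, hξ, hker⟩ := Matrix.exists_mulVec_eq_zero_iff.2 hdet
  set g : (Fin n → ℂ) → (Fin n → ℂ) := fun v => e (torusExp v • x₀)
  have hgd : DifferentiableAt ℂ g v := (hX.contDiffAt_orbit he hv).differentiableAt (by simp)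
  have hgξ : fderiv ℂ g v ξ = 0 := by
    rw [← hker]
    have hξs : ξ = ∑ j, ξ j • (Pi.single j 1 : Fin n → ℂ) := pi_eq_sum_univ' ξ
    conv_lhs => rw [hξs]
    funext i
    simp only [map_sum, map_smul, Finset.sum_apply, Pi.smul_apply, smul_eq_mul, Matrix.mulVec,
      dotProduct, cJac, Matrix.of_apply]
    exact Finset.sum_congr rfl fun j _ => mul_comm _ _
  set c : ℝ → (Fin n → ℂ) := fun s => v + s • ξ
  have hcd : ∀ s, HasDerivAt c ξ s := fun s =>
    (((hasDerivAt_id s).smul_const ξ).const_add v).congr_deriv (one_smul ℝ ξ)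
  have hcont : Continuous fun s => torusExp (c s) • x₀ :=
    (hX.continuous_smul x₀).comp (by fun_prop)
  have hc0 : c 0 = v := by simp [c]
  have hnear : ∀ᶠ s in 𝓝 (0 : ℝ), torusExp (c s) • x₀ ∈ e.source :=
    hcont.continuousAt.eventually (e.open_source.mem_nhds (by simpa only [hc0] using hv))
  have hg0 : HasDerivAt (fun s => g (c s)) 0 0 := by
    have h1 : HasFDerivAt g ((fderiv ℂ g v).restrictScalars ℝ) (c 0) := by
      rw [hc0]; exact hgd.hasFDerivAt.restrictScalars ℝ
    exact (h1.comp_hasDerivAt (0 : ℝ) (hcd 0)).congr_deriv hgξ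
  have hzero : ∀ s, torusExp (c s) • x₀ ∈ e.source → HasDerivAt (fun s => g (c s)) 0 s := by
    intro s hs
    have hsplit : ∀ r, torusExp (c r) • x₀ = torusExp (s • ξ) • torusExp (c (r - s)) • x₀ := by
      intro r
      rw [← mul_smul, ← torusExp_add]
      congr 2
      simp only [c, sub_smul]
      abel
    have h1 := hX.differentiableAt_smul he he (x := torusExp v • x₀) (v := s • ξ) hv
      (by have := hsplit s; rw [sub_self, hc0] at this; rwa [← this])
    have h2 : HasDerivAt (fun r => g (c (r - s))) 0 s := by
      have h3 : HasDerivAt (fun s => g (c s)) 0 (s - s) := by rwa [sub_self]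
      exact h3.comp_sub_const s s
    have h4 := h1.hasFDerivAt.restrictScalars ℝ
    have hgs : e (torusExp v • x₀) = g (c (s - s)) := by rw [sub_self, hc0]
    rw [hgs] at h4
    have h5 := h4.comp_hasDerivAt s h2
    rw [map_zero] at h5
    refine h5.congr_of_eventuallyEq ?_
    have h6 : ∀ᶠ r in 𝓝 s, torusExp (c (r - s)) • x₀ ∈ e.source := by
      have : ContinuousAt (fun r => torusExp (c (r - s)) • x₀) s :=
        (hcont.comp (continuous_id.sub continuous_const)).continuousAt
      refine this.eventually (e.open_source.mem_nhds ?_)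
      simpa only [sub_self, hc0] using hv
    filter_upwards [h6] with r hr
    simp only [Function.comp_apply, g]
    rw [e.left_inv hr, ← hsplit]
  obtain ⟨δ, hδ, hball⟩ := Metric.eventually_nhds_iff_ball.1 hnear
  have hconst : ∀ s ∈ Metric.ball (0 : ℝ) δ, torusExp (s • ξ) = 1 := by
    intro s hs
    have h1 : g (c s) = g (c 0) :=
      (Metric.isOpen_ball).is_const_of_deriv_eq_zero (convex_ball _ _).isPreconnected
        (fun r hr => (hzero r (hball r hr)).differentiableAt.differentiableWithinAt)
        (fun r hr => (hzero r (hball r hr)).deriv) hs (Metric.mem_ball_self hδ)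
    have h2 := e.injOn (hball s hs) (by rwa [hc0]) h1
    have h3 := hX.injective h2
    rw [hc0, torusExp_add] at h3
    exact mul_eq_left.1 h3
  refine hξ (funext fun i => ?_)
  have h1 : HasDerivAt (fun s : ℝ => Complex.exp (s • ξ i)) (ξ i) 0 := by
    refine ((hasDerivAt_id (0 : ℝ)).smul_const (ξ i)).cexp.congr_deriv ?_
    simp
  refine h1.unique ((hasDerivAt_const (0 : ℝ) (1 : ℂ)).congr_of_eventuallyEq ?_)
  filter_upwards [Metric.ball_mem_nhds (0 : ℝ) hδ] with s hs
  have := congrFun (hconst s hs) i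
  simpa [torusExp] using congrArg Units.val this

end IsToric

end Orbit

/-! ### Functions of the real parts of the coordinates -/

section RealPart

variable {n : ℕ} {F G : (Fin n → ℝ) → ℝ}

/-- The real parts of the coordinates. -/
def rePart : (Fin n → ℂ) →L[ℝ] (Fin n → ℝ) :=
  ContinuousLinearMap.pi fun i => Complex.reCLM.comp (ContinuousLinearMap.proj i)

lemma rePart_apply (w : Fin n → ℂ) (i : Fin n) : rePart w i = (w i).re := rfl

lemma rePart_single_one (k : Fin n) : rePart (Pi.single k 1) = Pi.single k 1 := by
  funext i
  rcases eq_or_ne i k with rfl | h <;> simp [rePart_apply, *]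

lemma rePart_single_I (k : Fin n) : rePart (Pi.single k Complex.I) = 0 := by
  funext i
  rcases eq_or_ne i k with rfl | h <;> simp [rePart_apply, *]

/-- On functions of the real parts, both Wirtinger derivatives are half of the real derivative. -/
lemma wirt_comp_rePart {w : Fin n → ℂ} (hF : DifferentiableAt ℝ F (rePart w)) (k : Fin n) :
    wirt k (fun v => (F (rePart v) : ℂ)) w =
        ((2⁻¹ * fderiv ℝ F (rePart w) (Pi.single k 1) : ℝ) : ℂ) ∧
      wirtBar k (fun v => (F (rePart v) : ℂ)) w =
        ((2⁻¹ * fderiv ℝ F (rePart w) (Pi.single k 1) : ℝ) : ℂ) := by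
  have h : HasFDerivAt (fun v => (F (rePart v) : ℂ))
      (Complex.ofRealCLM.comp ((fderiv ℝ F (rePart w)).comp rePart)) w :=
    Complex.ofRealCLM.hasFDerivAt.comp w (hF.hasFDerivAt.comp w rePart.hasFDerivAt)
  simp only [wirt, wirtBar, h.fderiv, ContinuousLinearMap.comp_apply, rePart_single_one,
    rePart_single_I, map_zero, mul_zero, sub_zero, add_zero, Complex.ofRealCLM_apply]
  push_cast
  exact ⟨by ring, by ring⟩

lemma contDiff_fderiv_single (hF : ContDiff ℝ ∞ F) (k : Fin n) :
    ContDiff ℝ ∞ fun y => fderiv ℝ F y (Pi.single k 1) :=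
  (hF.fderiv_right (m := ∞) (by simp)).clm_apply contDiff_const

/-- The complex Hessian of `F ∘ Re` is a quarter of the real Hessian of `F`. -/
lemma cHess_comp_rePart (hF : ContDiff ℝ ∞ F) (w : Fin n → ℂ) :
    cHess (fun v => F (rePart v)) w =
      (4⁻¹ : ℂ) • (realHess F (rePart w)).map Complex.ofRealHom := by
  ext i j
  have h1 : wirtBar j (fun v => (F (rePart v) : ℂ)) =
      fun v => ((2⁻¹ * fderiv ℝ F (rePart v) (Pi.single j 1) : ℝ) : ℂ) := by
    funext v
    exact (wirt_comp_rePart (hF.differentiable (by simp) _) j).2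
  have h2 : DifferentiableAt ℝ (fun y => fderiv ℝ F y (Pi.single j 1)) (rePart w) :=
    (contDiff_fderiv_single hF j).differentiable (by simp) _
  simp only [cHess, Matrix.of_apply, h1]
  rw [(wirt_comp_rePart (F := fun y => 2⁻¹ * fderiv ℝ F y (Pi.single j 1))
    (h2.const_mul _) i).1, fderiv_const_mul h2]
  simp [realHess]
  ring

lemma cGradSq_comp_rePart (hF : ContDiff ℝ ∞ F) (w : Fin n → ℂ) :
    cGradSq (fun v => F (rePart v)) w =
      (4⁻¹ : ℂ) • (realGradSq F (rePart w)).map Complex.ofRealHom := by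
  ext i j
  have h := fun k => wirt_comp_rePart (hF.differentiable (by simp) (rePart w)) k
  simp only [cGradSq, Matrix.of_apply, (h i).1, (h j).2]
  simp [realGradSq]
  ring

lemma realHess_add (hF : ContDiff ℝ ∞ F) (hG : ContDiff ℝ ∞ G) (x : Fin n → ℝ) :
    realHess (fun y => F y + G y) x = realHess F x + realHess G x := by
  ext i j
  have h1 : (fun y => fderiv ℝ (fun y => F y + G y) y (Pi.single j 1)) =
      fun y => fderiv ℝ F y (Pi.single j 1) + fderiv ℝ G y (Pi.single j 1) := by
    funext y
    rw [fderiv_fun_add (hF.differentiable (by simp) y) (hG.differentiable (by simp) y)]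
    rfl
  simp only [realHess, Matrix.of_apply, Matrix.add_apply, h1]
  rw [fderiv_fun_add ((contDiff_fderiv_single hF j).differentiable (by simp) x)
    ((contDiff_fderiv_single hG j).differentiable (by simp) x)]
  rfl

/-- A real matrix is positive definite if, up to the factor `1/4` of `cHess_comp_rePart`, it is so as
a hermitian matrix. -/
lemma posDef_of_map_ofReal {H : Matrix (Fin n) (Fin n) ℝ}
    (h : ((4⁻¹ : ℂ) • H.map Complex.ofRealHom).PosDef) : H.PosDef := by
  refine Matrix.PosDef.of_dotProduct_mulVec_pos ?_ fun x hx => ?_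
  · ext i j
    have := h.isHermitian.apply i j
    simpa using this
  · have hx' : (fun i => (x i : ℂ)) ≠ 0 := by
      intro h0
      refine hx (funext fun i => ?_)
      simpa using congrFun h0 i
    have h1 := h.dotProduct_mulVec_pos hx'
    have h2 : star (fun i => (x i : ℂ)) ⬝ᵥ (((4⁻¹ : ℂ) • H.map Complex.ofRealHom) *ᵥ
        fun i => (x i : ℂ)) = ((4⁻¹ * (star x ⬝ᵥ (H *ᵥ x)) : ℝ) : ℂ) := by
      rw [Matrix.smul_mulVec, dotProduct_smul]
      simp [dotProduct, Matrix.mulVec]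
    rw [h2] at h1
    have h3 : 0 < 4⁻¹ * (star x ⬝ᵥ (H *ᵥ x)) := by exact_mod_cast h1
    linarith

lemma fderiv_eq_sum_single (x v : Fin n → ℝ) :
    fderiv ℝ F x v = ∑ j, v j * fderiv ℝ F x (Pi.single j 1) := by
  have hv : v = ∑ j, v j • (Pi.single j 1 : Fin n → ℝ) := pi_eq_sum_univ' v
  conv_lhs => rw [hv]
  simp [map_sum]

/-- A function with positive definite Hessian is strictly convex, by restriction to lines. -/
lemma strictConvexOn_of_posDef (hF : ContDiff ℝ ∞ F) (hpos : ∀ x, (realHess F x).PosDef) :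
    StrictConvexOn ℝ univ F := by
  have hline : ∀ x v : Fin n → ℝ, v ≠ 0 → StrictConvexOn ℝ univ fun s : ℝ => F (x + s • v) := by
    intro x v hv
    have hl : ∀ s : ℝ, HasDerivAt (fun s : ℝ => x + s • v) v s := fun s =>
      (((hasDerivAt_id s).smul_const v).const_add x).congr_deriv (one_smul ℝ v)
    have hd : ∀ {H : (Fin n → ℝ) → ℝ}, ContDiff ℝ ∞ H → ∀ s : ℝ,
        HasDerivAt (fun s : ℝ => H (x + s • v))
          (∑ j, v j * fderiv ℝ H (x + s • v) (Pi.single j 1)) s := fun hH s =>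
      ((hH.differentiable (by simp) _).hasFDerivAt.comp_hasDerivAt s (hl s)).congr_deriv
        (fderiv_eq_sum_single _ _)
    have h1 : deriv (fun s : ℝ => F (x + s • v)) =
        fun s => ∑ j, v j * fderiv ℝ F (x + s • v) (Pi.single j 1) :=
      funext fun s => (hd hF s).deriv
    refine strictConvexOn_of_deriv2_pos convex_univ
      (hF.continuous.comp (g := F) (f := fun s : ℝ => x + s • v) (by fun_prop)).continuousOn
      fun s _ => ?_
    · have h2 : HasDerivAt (fun s => ∑ j, v j * fderiv ℝ F (x + s • v) (Pi.single j 1))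
          (∑ j, v j * ∑ i, v i * realHess F (x + s • v) i j) s :=
        HasDerivAt.fun_sum fun j _ => (hd (contDiff_fderiv_single hF j) s).const_mul _
      have h3 : deriv^[2] (fun s : ℝ => F (x + s • v)) s =
          star v ⬝ᵥ (realHess F (x + s • v) *ᵥ v) := by
        simp only [Function.iterate_succ, Function.iterate_zero, Function.comp_apply, id, h1]
        rw [h2.deriv]
        simp only [dotProduct, Matrix.mulVec, Finset.mul_sum, star_trivial]
        rw [Finset.sum_comm]
        exact Finset.sum_congr rfl fun i _ => Finset.sum_congr rfl fun j _ => by ring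
      rw [h3]
      exact (hpos _).dotProduct_mulVec_pos hv
  refine ⟨convex_univ, fun x _ y _ hxy a b ha hb hab => ?_⟩
  have h1 := (hline x (y - x) (sub_ne_zero.2 hxy.symm)).2 (mem_univ 0) (mem_univ 1) zero_ne_one
    ha hb hab
  have h2 : x + b • (y - x) = a • x + b • y := by
    rw [eq_sub_iff_add_eq.2 hab, smul_sub, sub_smul, one_smul]
    abel
  simpa [h2] using h1

lemma realMA_pos {x : Fin n → ℝ} (h : (realHess F x).PosDef) : 0 < realMA F x :=
  mul_pos (by exact_mod_cast n.factorial_pos) h.det_pos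

/-- The density of a wedge product of forms whose coefficients are a quarter of real matrices, as is
the case in logarithmic coordinates. -/
lemma wedgeDensity_map_ofReal (A : Fin n → Matrix (Fin n) (Fin n) ℝ) :
    wedgeDensity (fun k => (4⁻¹ : ℂ) • (A k).map Complex.ofRealHom) =
      (2 / Real.pi) ^ n * (4⁻¹) ^ n * mixedDet A := by
  rw [wedgeDensity, mixedDet_smul, mixedDet_map]
  have : ((4⁻¹ : ℂ) ^ n * Complex.ofRealHom (mixedDet A)) =
      (((4⁻¹) ^ n * mixedDet A : ℝ) : ℂ) := by push_cast; rfl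
  rw [this, Complex.ofReal_re]
  ring

end RealPart

/-! ### Toric potentials in logarithmic coordinates -/

section Toric

variable {n : ℕ} {X : Type*} [TopologicalSpace X] [ChartedSpace (Fin n → ℂ) X]
  [MulAction (Fin n → ℂˣ) X] {x₀ : X} {u : X → ℝ} {F₀ : (Fin n → ℝ) → ℝ}

/-- The restriction of a function on `X` to the real points of the open orbit. -/
def orbitFn (x₀ : X) (u : X → ℝ) (x : Fin n → ℝ) : ℝ :=
  u (torusExp (fun i => (x i : ℂ)) • x₀)

lemma orbitFn_rePart (hu : ∀ z ∈ compactTorus n, ∀ x, u (z • x) = u x) (w : Fin n → ℂ) :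
    u (torusExp w • x₀) = orbitFn x₀ u (rePart w) := by
  have h : w = (fun i => (((w i).im : ℝ) : ℂ) * Complex.I) + fun i => ((rePart w i : ℝ) : ℂ) := by
    funext i
    simp only [Pi.add_apply, rePart_apply]
    rw [add_comm, Complex.re_add_im]
  conv_lhs => rw [h, torusExp_add, mul_smul]
  exact hu _ (torusExp_mem_compactTorus fun i => by simp) _

lemma toricRep_torusLog (hu : ∀ z ∈ compactTorus n, ∀ x, u (z • x) = u x) (z : Fin n → ℂˣ) :
    toricRep x₀ F₀ u (torusLog z) = F₀ (torusLog z) + u (z • x₀) := by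
  obtain ⟨w, rfl⟩ := torusExp_surjective z
  rw [torusLog_torusExp, orbitFn_rePart hu w]
  rfl

lemma toricRep_eq_add (x₀ : X) (F₀ : (Fin n → ℝ) → ℝ) (u : X → ℝ) :
    toricRep x₀ F₀ u = fun x => F₀ x + orbitFn x₀ u x := rfl

lemma dot_orbitFn (φ : ℝ → X → ℝ) (t : ℝ) :
    dot (fun t => orbitFn (n := n) x₀ (φ t)) t = orbitFn x₀ (dot φ t) := rfl

lemma dot_toricRep (φ : ℝ → X → ℝ) :
    (dot fun t => toricRep x₀ F₀ (φ t)) = fun t => orbitFn x₀ (dot φ t) := by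
  funext t x
  exact derivWithin_const_add _

lemma dot_invariant {φ : ℝ → X → ℝ}
    (h : ∀ t ∈ Icc (0 : ℝ) 1, ∀ z ∈ compactTorus n, ∀ x, φ t (z • x) = φ t x) :
    ∀ t ∈ Icc (0 : ℝ) 1, ∀ z ∈ compactTorus n, ∀ x, dot φ t (z • x) = dot φ t x :=
  fun t ht z hz x => derivWithin_congr (fun s hs => h s hs z hz x) (h t ht z hz x)

variable [IsManifold 𝓘(ℂ, Fin n → ℂ) ω X]

lemma contDiff_orbitFn (hX : IsToric n x₀) (hu : SmoothFn n u) :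
    ContDiff ℝ ∞ (orbitFn (n := n) x₀ u) := by
  rw [contDiff_iff_contDiffAt]
  intro x
  set v : Fin n → ℂ := fun i => (x i : ℂ)
  set e := chartAt (Fin n → ℂ) (torusExp v • x₀)
  have he : e ∈ atlas (Fin n → ℂ) X := chart_mem_atlas _ _
  have hv : torusExp v • x₀ ∈ e.source := mem_chart_source _ _
  have h1 : ContDiffAt ℝ ∞ (fun v => e (torusExp v • x₀)) v :=
    ((hX.contDiffAt_orbit he hv).restrict_scalars ℝ).of_le le_top
  have h2 : ContDiffAt ℝ ∞ (fun v => u (torusExp v • x₀)) v := by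
    refine ((hu.contDiffAt he (e.map_source hv)).comp v h1).congr_of_eventuallyEq ?_
    filter_upwards [(hX.continuous_smul x₀).continuousAt.eventually (e.open_source.mem_nhds hv)]
      with w hw
    simp only [Function.comp_apply]
    rw [e.left_inv hw]
  have h3 : ContDiffAt ℝ ∞ (fun (x : Fin n → ℝ) i => (x i : ℂ)) x :=
    contDiffAt_pi.2 fun i => contDiffAt_ofReal (contDiff_apply ℝ ℝ i).contDiffAt
  exact ContDiffAt.comp x (g := fun v : Fin n → ℂ => u (torusExp v • x₀)) h2 h3

section Pull

variable {e : OpenPartialHomeomorph X (Fin n → ℂ)} {w : Fin n → ℂ}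

lemma pullCoeff_ddcCoeff (hX : IsToric n x₀) (hu : SmoothFn n u)
    (hinv : ∀ z ∈ compactTorus n, ∀ x, u (z • x) = u x) (he : e ∈ atlas (Fin n → ℂ) X)
    (hw : torusExp w • x₀ ∈ e.source) :
    pullCoeff (fun v => e (torusExp v • x₀)) (ddcCoeff u e (e (torusExp w • x₀))) w =
      (4⁻¹ : ℂ) • (realHess (orbitFn x₀ u) (rePart w)).map Complex.ofRealHom := by
  rw [← cHess_comp_rePart (contDiff_orbitFn hX hu), ddcCoeff,
    ← cHess_comp (u := fun v => u (e.symm v)) (f := fun v => e (torusExp v • x₀))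
      ((hu.contDiffAt he (e.map_source hw)).of_le two_le_infty)
      ((hX.contDiffAt_orbit he hw).of_le le_top)]
  refine cHess_congr ?_
  filter_upwards [(hX.continuous_smul x₀).continuousAt.eventually (e.open_source.mem_nhds hw)]
    with v hv
  rw [e.left_inv hv, orbitFn_rePart hinv]

lemma pullCoeff_dWedgeDcCoeff (hX : IsToric n x₀) (hu : SmoothFn n u)
    (hinv : ∀ z ∈ compactTorus n, ∀ x, u (z • x) = u x) (he : e ∈ atlas (Fin n → ℂ) X)
    (hw : torusExp w • x₀ ∈ e.source) :
    pullCoeff (fun v => e (torusExp v • x₀)) (dWedgeDcCoeff u e (e (torusExp w • x₀))) w =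
      (4⁻¹ : ℂ) • (realGradSq (orbitFn x₀ u) (rePart w)).map Complex.ofRealHom := by
  rw [← cGradSq_comp_rePart (contDiff_orbitFn hX hu), dWedgeDcCoeff,
    ← cGradSq_comp (u := fun v => u (e.symm v)) (f := fun v => e (torusExp v • x₀))
      ((hu.contDiffAt he (e.map_source hw)).differentiableAt (by simp))
      ((hX.contDiffAt_orbit he hw).differentiableAt (by simp))]
  refine cGradSq_congr ?_
  filter_upwards [(hX.continuous_smul x₀).continuousAt.eventually (e.open_source.mem_nhds hw)]
    with v hv
  rw [e.left_inv hv, orbitFn_rePart hinv]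

variable {κ : KahlerForm n X}

lemma KahlerForm.HasTorusPotential.pullCoeff_coeff (hκ : κ.HasTorusPotential x₀ F₀)
    (hF₀ : ContDiff ℝ ∞ F₀) (he : e ∈ atlas (Fin n → ℂ) X) (hw : torusExp w • x₀ ∈ e.source) :
    pullCoeff (fun v => e (torusExp v • x₀)) (κ.coeff e (e (torusExp w • x₀))) w =
      (4⁻¹ : ℂ) • (realHess F₀ (rePart w)).map Complex.ofRealHom := by
  rw [← cHess_comp_rePart hF₀, hκ e he w hw]
  simp only [torusLog_torusExp]
  rfl

lemma KahlerForm.HasTorusPotential.pullCoeff_perturb (hX : IsToric n x₀)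
    (hκ : κ.HasTorusPotential x₀ F₀) (hF₀ : ContDiff ℝ ∞ F₀) (hu : SmoothFn n u)
    (hinv : ∀ z ∈ compactTorus n, ∀ x, u (z • x) = u x) (he : e ∈ atlas (Fin n → ℂ) X)
    (hw : torusExp w • x₀ ∈ e.source) :
    pullCoeff (fun v => e (torusExp v • x₀)) (κ.perturb u e (e (torusExp w • x₀))) w =
      (4⁻¹ : ℂ) • (realHess (toricRep x₀ F₀ u) (rePart w)).map Complex.ofRealHom := by
  rw [KahlerForm.perturb, pullCoeff_add, hκ.pullCoeff_coeff hF₀ he hw,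
    pullCoeff_ddcCoeff hX hu hinv he hw, toricRep_eq_add,
    realHess_add hF₀ (contDiff_orbitFn hX hu), ← smul_add]
  congr 1
  ext i j
  simp

end Pull

variable {κ : KahlerForm n X}

lemma posDef_realHess_toricRep (hX : IsToric n x₀) (hκ : κ.HasTorusPotential x₀ F₀)
    (hF₀ : ContDiff ℝ ∞ F₀) (hu : u ∈ κ.toricPotentials) (x : Fin n → ℝ) :
    (realHess (toricRep x₀ F₀ u) x).PosDef := by
  set w : Fin n → ℂ := fun i => (x i : ℂ)
  set e := chartAt (Fin n → ℂ) (torusExp w • x₀)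
  have he : e ∈ atlas (Fin n → ℂ) X := chart_mem_atlas _ _
  have hw : torusExp w • x₀ ∈ e.source := mem_chart_source _ _
  refine posDef_of_map_ofReal ?_
  have h := hκ.pullCoeff_perturb hX hF₀ (smoothFn_of_contMDiff hu.1.1) hu.2 he hw
  rw [show rePart w = x from rfl] at h
  rw [← h]
  exact (posDef_pullCoeff_iff (hX.det_cJac_orbit_ne_zero he hw) _).2
    (hu.1.2 e he _ (e.map_source hw))

lemma posDef_realHess (hX : IsToric n x₀) (hκ : κ.HasTorusPotential x₀ F₀)
    (hF₀ : ContDiff ℝ ∞ F₀) (x : Fin n → ℝ) : (realHess F₀ x).PosDef := by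
  set w : Fin n → ℂ := fun i => (x i : ℂ)
  set e := chartAt (Fin n → ℂ) (torusExp w • x₀)
  have he : e ∈ atlas (Fin n → ℂ) X := chart_mem_atlas _ _
  have hw : torusExp w • x₀ ∈ e.source := mem_chart_source _ _
  refine posDef_of_map_ofReal ?_
  have h := hκ.pullCoeff_coeff hF₀ he hw
  rw [show rePart w = x from rfl] at h
  rw [← h]
  exact (posDef_pullCoeff_iff (hX.det_cJac_orbit_ne_zero he hw) _).2
    (κ.posDef e he _ (e.map_source hw))

/-- The difference of the two sides of the real equation, multiplied by the total mass. -/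
def realEulerLagrange (F₀ : (Fin n → ℝ) → ℝ) (F : ℝ → (Fin n → ℝ) → ℝ) (t : ℝ)
    (x : Fin n → ℝ) : ℝ :=
  dot (dot F) t x * realMA (F t) x -
    (n * mixedDet (slots₁ (realGradSq (dot F t) x) (realHess (F t) x)) -
    2 * n * mixedDet
      (slots₁ (realHess (dot (dot F) t) x) (realHess (fun y => F₀ y + dot F t y) x)) -
    n * (n - 1) * mixedDet
      (slots₂ (realHess (dot F t) x) (realHess (dot (dot F) t) x)
        (realHess (fun y => F₀ y + dot F t y) x)))

lemma realMagneticGeodesicEq_iff {F₀ : (Fin n → ℝ) → ℝ} (hV : ∫ y, realMA F₀ y ≠ 0)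
    (F : ℝ → (Fin n → ℝ) → ℝ) :
    RealMagneticGeodesicEq F₀ F ↔ ∀ t ∈ Icc (0 : ℝ) 1, ∀ x, realEulerLagrange F₀ F t x = 0 := by
  refine forall₂_congr fun t _ => forall_congr' fun x => ?_
  rw [realEulerLagrange, sub_eq_zero]
  constructor
  · intro h
    have := congrArg (fun a => a * ∫ y, realMA F₀ y) h
    field_simp at this
    linarith
  · intro h
    rw [← mul_div_assoc, h]
    field_simp

variable [CompactSpace X] [T2Space X]

/-- In logarithmic coordinates the equation on `X` is the real equation, up to positive factors. -/
lemma eulerLagrange_orbit (hX : IsToric n x₀) (hκ : κ.HasTorusPotential x₀ F₀)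
    (hF₀ : ContDiff ℝ ∞ F₀) {φ : ℝ → X → ℝ} (hφ : SmoothFamily n (Icc 0 1) φ)
    (hinv : ∀ t ∈ Icc (0 : ℝ) 1, ∀ z ∈ compactTorus n, ∀ x, φ t (z • x) = φ t x)
    {t : ℝ} (ht : t ∈ Icc (0 : ℝ) 1) {e : OpenPartialHomeomorph X (Fin n → ℂ)}
    (he : e ∈ atlas (Fin n → ℂ) X) {w : Fin n → ℂ} (hw : torusExp w • x₀ ∈ e.source) :
    ‖(cJac (fun v => e (torusExp v • x₀)) w).det‖ ^ 2 *
        κ.eulerLagrange φ t e (e (torusExp w • x₀)) =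
      (2 / Real.pi) ^ n * (4⁻¹) ^ n / κ.vol *
        realEulerLagrange F₀ (fun t => toricRep x₀ F₀ (φ t)) t (rePart w) := by
  have s0 := hφ.smoothFn ht
  have s1 := hφ.dot.smoothFn ht
  have s2 := hφ.dot.dot.smoothFn ht
  have i1 := dot_invariant hinv
  have i2 := dot_invariant i1
  have p0 := hκ.pullCoeff_perturb hX hF₀ s0 (hinv t ht) he hw
  have p1 := hκ.pullCoeff_perturb hX hF₀ s1 (i1 t ht) he hw
  have d1 := pullCoeff_ddcCoeff hX s1 (i1 t ht) he hw
  have d2 := pullCoeff_ddcCoeff hX s2 (i2 t ht) he hw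
  have g1 := pullCoeff_dWedgeDcCoeff hX s1 (i1 t ht) he hw
  set J := ‖(cJac (fun v : Fin n → ℂ => e (torusExp v • x₀)) w).det‖ ^ 2
  set g := fun v : Fin n → ℂ => e (torusExp v • x₀)
  set x := rePart w
  have w0 : J * wedgeDensity (fun _ => κ.perturb (φ t) e (g w)) =
      (2 / Real.pi) ^ n * (4⁻¹) ^ n * realMA (toricRep x₀ F₀ (φ t)) x := by
    rw [← wedgeDensity_pullCoeff, p0, wedgeDensity_map_ofReal (fun _ => _), mixedDet_const]
    rfl
  have hs1 : ∀ (A C : Matrix (Fin n) (Fin n) ℂ) (A' C' : Matrix (Fin n) (Fin n) ℝ),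
      pullCoeff g A w = (4⁻¹ : ℂ) • A'.map Complex.ofRealHom →
      pullCoeff g C w = (4⁻¹ : ℂ) • C'.map Complex.ofRealHom →
      J * wedgeDensity (slots₁ A C) =
        (2 / Real.pi) ^ n * (4⁻¹) ^ n * mixedDet (slots₁ A' C') := by
    intro A C A' C' hA hC
    rw [← wedgeDensity_pullCoeff, ← wedgeDensity_map_ofReal]
    congr 1
    funext k
    simp only [slots₁]
    split_ifs
    exacts [hA, hC]
  have hs2 : ∀ (A B C : Matrix (Fin n) (Fin n) ℂ) (A' B' C' : Matrix (Fin n) (Fin n) ℝ),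
      pullCoeff g A w = (4⁻¹ : ℂ) • A'.map Complex.ofRealHom →
      pullCoeff g B w = (4⁻¹ : ℂ) • B'.map Complex.ofRealHom →
      pullCoeff g C w = (4⁻¹ : ℂ) • C'.map Complex.ofRealHom →
      J * wedgeDensity (slots₂ A B C) =
        (2 / Real.pi) ^ n * (4⁻¹) ^ n * mixedDet (slots₂ A' B' C') := by
    intro A B C A' B' C' hA hB hC
    rw [← wedgeDensity_pullCoeff, ← wedgeDensity_map_ofReal]
    congr 1
    funext k
    simp only [slots₂]
    split_ifs
    exacts [hA, hB, hC]
  have w1 := hs1 _ _ _ _ g1 p0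
  have w2 := hs1 _ _ _ _ d2 p1
  have w3 := hs2 _ _ _ _ _ _ d1 d2 p1
  have hdot : dot (fun t => toricRep x₀ F₀ (φ t)) = fun t => orbitFn x₀ (dot φ t) :=
    dot_toricRep φ
  have hddot : dot (fun t => orbitFn (n := n) x₀ (dot φ t)) t = orbitFn x₀ (dot (dot φ) t) :=
    dot_orbitFn _ t
  have hval : dot (dot φ) t (e.symm (g w)) = orbitFn x₀ (dot (dot φ) t) x := by
    simp only [g]
    rw [e.left_inv hw, orbitFn_rePart (i2 t ht)]
  simp only [realEulerLagrange, hdot, hddot, ← toricRep_eq_add]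
  simp only [KahlerForm.eulerLagrange, KahlerForm.MA]
  change J * (dot (dot φ) t (e.symm (g w)) * (wedgeDensity (fun _ => κ.perturb (φ t) e (g w)) /
    κ.vol) - _) = _
  rw [hval]
  linear_combination (orbitFn x₀ (dot (dot φ) t) x / κ.vol) * w0 - (n / κ.vol) * w1 +
    (2 * n / κ.vol) * w2 + (n * (n - 1) / κ.vol) * w3

end Toric

/-! ### The total mass of the real Monge-Ampère measure -/

section Mass

open MeasureTheory

variable {n : ℕ} {X : Type*} [TopologicalSpace X] [ChartedSpace (Fin n → ℂ) X]
  [MulAction (Fin n → ℂˣ) X] {x₀ : X} {F₀ : (Fin n → ℝ) → ℝ}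

variable (n) in
/-- A fundamental domain of the map `torusExp`: the imaginary parts are in `(-π, π]`. -/
def expDomain : Set (Fin n → ℂ) := univ.pi fun _ => {z | z.im ∈ Ioc (-Real.pi) Real.pi}

lemma measurableSet_expDomain : MeasurableSet (expDomain n) :=
  MeasurableSet.univ_pi fun _ => Complex.measurable_im measurableSet_Ioc

lemma injOn_torusExp : InjOn torusExp (expDomain n) := by
  intro v hv w hw h
  funext i
  have h1 := congrArg Units.val (congrFun h i)
  have hv' := hv i (mem_univ i)
  have hw' := hw i (mem_univ i)
  exact Complex.exp_inj_of_neg_pi_lt_of_le_pi hv'.1 hv'.2 hw'.1 hw'.2 h1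

variable [IsManifold 𝓘(ℂ, Fin n → ℂ) ω X] [CompactSpace X] [T2Space X]
  {κ : KahlerForm n X}

/-- The compact manifold has finite volume, hence so has the part of the orbit that corresponds to
a fundamental domain; it is covered by the compact supports of a partition of unity. -/
lemma integrableOn_realMA_rePart (hX : IsToric n x₀) (hκ : κ.HasTorusPotential x₀ F₀)
    (hF₀ : ContDiff ℝ ∞ F₀) :
    IntegrableOn (fun w => realMA F₀ (rePart w)) (expDomain n) := by
  set S : X → Set (Fin n → ℂ) := fun p =>
    expDomain n ∩ (fun w => torusExp w • x₀) ⁻¹' tsupport (chartPartition n X p)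
  have hcover : expDomain n = ⋃ p ∈ chartIndices n X, S p := by
    ext w
    simp only [mem_iUnion, exists_prop, S, mem_inter_iff, mem_preimage]
    refine ⟨fun hw => ?_, fun ⟨_, _, hw, _⟩ => hw⟩
    have h1 : ∑ p ∈ chartIndices n X, chartPartition n X p (torusExp w • x₀) ≠ 0 := by
      rw [sum_chartPartition]; exact one_ne_zero
    obtain ⟨p, hp, hne⟩ := Finset.exists_ne_zero_of_sum_ne_zero h1
    exact ⟨p, hp, hw, subset_tsupport _ hne⟩
  rw [hcover, integrableOn_finset_iUnion]
  intro p _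
  set e := chartAt (Fin n → ℂ) p
  have he : e ∈ atlas (Fin n → ℂ) X := chart_mem_atlas _ p
  set g : (Fin n → ℂ) → (Fin n → ℂ) := fun v => e (torusExp v • x₀)
  have hSe : ∀ w ∈ S p, torusExp w • x₀ ∈ e.source := fun w hw =>
    chartPartition_subordinate p hw.2
  have hSm : MeasurableSet (S p) := measurableSet_expDomain.inter
    ((isClosed_tsupport _).preimage (hX.continuous_smul x₀)).measurableSet
  have hder : ∀ w ∈ S p, HasFDerivWithinAt g ((fderiv ℂ g w).restrictScalars ℝ) (S p) w :=
    fun w hw => (((hX.contDiffAt_orbit he (hSe w hw)).differentiableAt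
      (by simp)).hasFDerivAt.restrictScalars ℝ).hasFDerivWithinAt
  have hinj : InjOn g (S p) := fun v hv w hw h =>
    injOn_torusExp hv.1 hw.1 (hX.injective (e.injOn (hSe v hv) (hSe w hw) h))
  have himg : g '' S p ⊆ chartSupport n p := by
    rintro _ ⟨w, hw, rfl⟩
    exact ⟨_, hw.2, rfl⟩
  have hint : IntegrableOn (fun w => wedgeDensity fun _ => κ.coeff e w) (g '' S p) := by
    refine IntegrableOn.mono_set (ContinuousOn.integrableOn_compact (isCompact_chartSupport p) ?_)
      himg
    exact (ContDiffOn.wedgeDensity fun _ i j => κ.smooth e he i j).continuousOn.mono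
      (chartSupport_subset p)
  rw [integrableOn_image_iff_integrableOn_abs_det_fderiv_smul volume hSm hder hinj] at hint
  set c : ℝ := (2 / Real.pi) ^ n * (4⁻¹) ^ n
  have hc : c ≠ 0 := by
    have := Real.pi_pos
    positivity
  refine IntegrableOn.congr_fun (hint.const_mul c⁻¹) (fun w hw => ?_) hSm
  have h1 : ‖(cJac g w).det‖ ^ 2 * wedgeDensity (fun _ => κ.coeff e (g w)) =
      c * realMA F₀ (rePart w) := by
    rw [← wedgeDensity_pullCoeff, hκ.pullCoeff_coeff hF₀ he (hSe w hw),
      wedgeDensity_map_ofReal (fun _ => _), mixedDet_const]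
    rfl
  simp only [abs_det_restrictScalars_fderiv, smul_eq_mul, h1]
  rw [inv_mul_cancel_left₀ hc]

variable (n) in
/-- The real and imaginary parts of the coordinates, as a measurable equivalence. -/
def realImagEquiv : (Fin n → ℂ) ≃ᵐ (Fin n → ℝ) × (Fin n → ℝ) :=
  (MeasurableEquiv.piCongrRight fun _ => Complex.measurableEquivRealProd).trans
    (MeasurableEquiv.arrowProdEquivProdArrow ℝ ℝ (Fin n))

lemma measurePreserving_realImagEquiv : MeasurePreserving (realImagEquiv n) :=
  (volume_preserving_pi fun _ => Complex.volume_preserving_equiv_real_prod).trans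
    (volume_measurePreserving_arrowProdEquivProdArrow ℝ ℝ (Fin n))

lemma integrable_realMA (hX : IsToric n x₀) (hκ : κ.HasTorusPotential x₀ F₀)
    (hF₀ : ContDiff ℝ ∞ F₀) : Integrable (realMA F₀) := by
  have h := integrableOn_realMA_rePart hX hκ hF₀
  set Q : Set (Fin n → ℝ) := univ.pi fun _ => Ioc (-Real.pi) Real.pi
  have hpre : realImagEquiv n ⁻¹' (univ ×ˢ Q) = expDomain n := by
    ext w
    simp only [expDomain, Q, mem_preimage, mem_prod, mem_univ, true_and, mem_pi, true_imp_iff]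
    exact Iff.rfl
  rw [← hpre] at h
  have h2 : IntegrableOn (fun q : (Fin n → ℝ) × (Fin n → ℝ) => realMA F₀ q.1) (univ ×ˢ Q) :=
    (measurePreserving_realImagEquiv.integrableOn_comp_preimage
      (realImagEquiv n).measurableEmbedding).1 h
  rw [IntegrableOn, Measure.volume_eq_prod, ← Measure.prod_restrict, Measure.restrict_univ] at h2
  have hQ : volume Q ≠ 0 := by
    have := Real.pi_pos
    simp only [Q, volume_pi_pi, Real.volume_Ioc, Finset.prod_ne_zero_iff]
    intro i _
    simp only [ne_eq, ENNReal.ofReal_eq_zero, not_le]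
    linarith
  have : NeZero (volume.restrict Q) := ⟨by rwa [ne_eq, Measure.restrict_eq_zero]⟩
  -- the function does not depend on the imaginary parts, so one slice is enough
  obtain ⟨_, hy⟩ := h2.prod_left_ae.exists
  exact hy

lemma integral_realMA_pos (hX : IsToric n x₀) (hκ : κ.HasTorusPotential x₀ F₀)
    (hF₀ : ContDiff ℝ ∞ F₀) : 0 < ∫ y, realMA F₀ y := by
  have hpos : ∀ y, 0 < realMA F₀ y := fun y => realMA_pos (posDef_realHess hX hκ hF₀ y)
  rw [integral_pos_iff_support_of_nonneg (fun y => (hpos y).le) (integrable_realMA hX hκ hF₀)]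
  have : Function.support (realMA F₀) = univ := eq_univ_of_forall fun y => (hpos y).ne'
  rw [this]
  exact Measure.measure_univ_pos.2 (NeZero.ne _)

/-- The equation on `X` and the real equation correspond to each other on the open orbit, and both
sides of the former are continuous, so that the density of the orbit suffices. -/
lemma magneticGeodesicEq_iff_real (hX : IsToric n x₀) (hκ : κ.HasTorusPotential x₀ F₀)
    (hF₀ : ContDiff ℝ ∞ F₀) {φ : ℝ → X → ℝ} (hφ : SmoothFamily n (Icc 0 1) φ)
    (hinv : ∀ t ∈ Icc (0 : ℝ) 1, ∀ z ∈ compactTorus n, ∀ x, φ t (z • x) = φ t x) :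
    κ.MagneticGeodesicEq φ ↔ RealMagneticGeodesicEq F₀ fun t => toricRep x₀ F₀ (φ t) := by
  have : Nonempty X := ⟨x₀⟩
  rw [κ.magneticGeodesicEq_iff, realMagneticGeodesicEq_iff (integral_realMA_pos hX hκ hF₀).ne']
  have hc : (2 / Real.pi) ^ n * (4⁻¹) ^ n / κ.vol ≠ 0 := by
    have := Real.pi_pos
    have := κ.vol_pos
    positivity
  constructor
  · intro h t ht x
    set w : Fin n → ℂ := fun i => (x i : ℂ)
    set e := chartAt (Fin n → ℂ) (torusExp w • x₀)
    have he : e ∈ atlas (Fin n → ℂ) X := chart_mem_atlas _ _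
    have hw : torusExp w • x₀ ∈ e.source := mem_chart_source _ _
    have h1 := eulerLagrange_orbit hX hκ hF₀ hφ hinv ht he hw
    rw [h t ht e he _ (e.map_source hw), mul_zero] at h1
    exact (mul_eq_zero.1 h1.symm).resolve_left hc
  · intro h t ht e he w hw
    have horbit : ∀ v : Fin n → ℂ, torusExp v • x₀ ∈ e.source →
        κ.eulerLagrange φ t e (e (torusExp v • x₀)) = 0 := by
      intro v hv
      have h1 := eulerLagrange_orbit hX hκ hF₀ hφ hinv ht he hv
      rw [h t ht, mul_zero] at h1
      refine (mul_eq_zero.1 h1).resolve_left ?_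
      exact pow_ne_zero 2 (norm_ne_zero_iff.2 (hX.det_cJac_orbit_ne_zero he hv))
    set O : Set (Fin n → ℂ) := {y | ∃ v : Fin n → ℂ, torusExp v • x₀ ∈ e.source ∧
      e (torusExp v • x₀) = y}
    have hO : e.target ⊆ closure O := by
      intro y hy
      refine mem_closure_iff.2 fun o ho hyo => ?_
      obtain ⟨x, hx, z, rfl⟩ := hX.dense_orbit.inter_open_nonempty _ (e.isOpen_inter_preimage ho)
        ⟨e.symm y, e.map_target hy, by rwa [mem_preimage, e.right_inv hy]⟩
      obtain ⟨v, rfl⟩ := torusExp_surjective z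
      exact ⟨_, hx.2, v, hx.1, rfl⟩
    refine EqOn.of_subset_closure (s := O) (t := e.target) (g := fun _ => (0 : ℝ)) ?_
      ((κ.smoothDensities_eulerLagrange hφ).isContDensity ht e he) continuousOn_const ?_ hO hw
    · rintro _ ⟨v, hv, rfl⟩
      exact horbit v hv
    · rintro _ ⟨v, hv, rfl⟩
      exact e.map_source hv

end Mass

end

theorem mainTheorem2 (n : ℕ) (X : Type*) [TopologicalSpace X] [ChartedSpace (Fin n → ℂ) X]
    [IsManifold 𝓘(ℂ, Fin n → ℂ) ω X] [CompactSpace X] [T2Space X]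
    [MulAction (Fin n → ℂˣ) X] (x₀ : X) (hX : IsToric n x₀)
    (κ : KahlerForm n X) (hκ : κ.IsTorusInvariant)
    (F₀ : (Fin n → ℝ) → ℝ) (hF₀ : ContDiff ℝ ∞ F₀) (hκF₀ : κ.HasTorusPotential x₀ F₀)
    (φ : ℝ → X → ℝ) (hφ : κ.IsPath φ) (hφtor : ∀ t ∈ Set.Icc (0 : ℝ) 1, φ t ∈ κ.toricPotentials) :
    (∀ t ∈ Set.Icc (0 : ℝ) 1,
      (∀ z : Fin n → ℂˣ,
        toricRep x₀ F₀ (φ t) (torusLog z) = F₀ (torusLog z) + φ t (z • x₀)) ∧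
      ContDiff ℝ ∞ (toricRep x₀ F₀ (φ t)) ∧
      StrictConvexOn ℝ Set.univ (toricRep x₀ F₀ (φ t))) ∧
    (MeasureTheory.Integrable (realMA F₀) ∧ 0 < ∫ y, realMA F₀ y) ∧
    (κ.IsMagneticGeodesic φ ↔ κ.MagneticGeodesicEq φ) ∧
    (κ.MagneticGeodesicEq φ ↔
      RealMagneticGeodesicEq F₀ (fun t => toricRep x₀ F₀ (φ t))) := by
  have : Nonempty X := ⟨x₀⟩
  have hs : ∀ t ∈ Icc (0 : ℝ) 1, ContDiff ℝ ∞ (toricRep x₀ F₀ (φ t)) := fun t ht =>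
    hF₀.add (contDiff_orbitFn hX (smoothFn_of_contMDiff (hφtor t ht).1.1))
  exact ⟨fun t ht => ⟨toricRep_torusLog (hφtor t ht).2, hs t ht,
      strictConvexOn_of_posDef (hs t ht) (posDef_realHess_toricRep hX hκF₀ hF₀ (hφtor t ht))⟩,
    ⟨integrable_realMA hX hκF₀ hF₀, integral_realMA_pos hX hκF₀ hF₀⟩,
    ⟨κ.eq_of_isMagneticGeodesic, κ.isMagneticGeodesic_of_eq hφ⟩,
    magneticGeodesicEq_iff_real hX hκF₀ hF₀ (smoothFamily_of_contMDiffOn hφ.smooth)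
      fun t ht => (hφtor t ht).2⟩
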